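/- **Theorem 1.2.** Let $n\ge 3$ and let $(M,g)$ be a smooth $n$-dimensional Lorentzian manifold of signature $(-,+,\dots,+)$, with Levi-Civita covariant derivative denoted by a comma and curvature tensor $R_{hijk}$. Suppose that $(M,g)$ is a pseudosymmetric spacetime $(PS)_n$ in the sense of Chaki with timelike associated covector, i.e. there is a smooth covector field $v$ with $v_pv^p<0$ everywhere on $M$ and $$R_{hijk,l}=2v_lR_{hijk}+v_hR_{lijk}+v_iR_{hljk}+v_jR_{hilk}+v_kR_{hijl}.$$ Suppose also that $(M,g)$ is conformally flat, i.e. its Weyl conformal curvature tensor vanishes if $n\ge 4$, and its Cotton tensor vanishes if $n=3$. Then $(M,g)$ is locally a generalized Robertson–Walker spacetime: every point of $M$ has an open neighbourhood isometric to a warped product $-I\times_f N$, that is, to $I\times N$ with the metric $-dt^2+f(t)^2h$, where $I\subseteq\mathbb R$ is a nonempty open interval, $f:I\to(0,\infty)$ is smooth and $(N,h)$ is a connected Riemannian manifold of dimension $n-1$. -/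

import Mathlib

open scoped Manifold ContDiff

noncomputable section

namespace Spacetime

/-- The model space of an `n`-dimensional manifold. -/
abbrev Coord (n : ℕ) : Type := EuclideanSpace ℝ (Fin n)

/-! ### Tensor calculus in a coordinate system

`G y` is the matrix `(g_{ij})` at the point with coordinates `y`. All tensors are functions of the
indices followed by the point `y`. -/

section Coordinates

variable {n : ℕ}

/-- The partial derivative `∂_i F`. -/
def partialDeriv (i : Fin n) (F : Coord n → ℝ) (y : Coord n) : ℝ :=
  fderiv ℝ F y (EuclideanSpace.single i 1)

/-- The Christoffel symbols `Γ^k_{ij} = ½ g^{kl} (∂_i g_{jl} + ∂_j g_{il} - ∂_l g_{ij})` of the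
Levi-Civita connection. -/
def christoffel (G : Coord n → Matrix (Fin n) (Fin n) ℝ) (k i j : Fin n) (y : Coord n) : ℝ :=
  (1 / 2) * ∑ l, (G y)⁻¹ k l *
    (partialDeriv i (fun z => G z j l) y + partialDeriv j (fun z => G z i l) y
      - partialDeriv l (fun z => G z i j) y)

/-- The curvature tensor `R^h_{ijk}`, with the sign for which `R_{ij} = R^h_{ijh}` is the Ricci
tensor (positive on round spheres). -/
def riemannUp (G : Coord n → Matrix (Fin n) (Fin n) ℝ) (h i j k : Fin n) (y : Coord n) : ℝ :=
  partialDeriv k (christoffel G h i j) y - partialDeriv j (christoffel G h i k) y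
    + ∑ p, (christoffel G h k p y * christoffel G p i j y
      - christoffel G h j p y * christoffel G p i k y)

/-- The curvature tensor `R_{hijk} = g_{hp} R^p_{ijk}`. -/
def riemann (G : Coord n → Matrix (Fin n) (Fin n) ℝ) (h i j k : Fin n) (y : Coord n) : ℝ :=
  ∑ p, G y h p * riemannUp G p i j k y

/-- The covariant derivative `R_{hijk,l}`. -/
def covRiemann (G : Coord n → Matrix (Fin n) (Fin n) ℝ) (h i j k l : Fin n) (y : Coord n) : ℝ :=
  partialDeriv l (riemann G h i j k) y
    - ∑ p, (christoffel G p l h y * riemann G p i j k y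
      + christoffel G p l i y * riemann G h p j k y
      + christoffel G p l j y * riemann G h i p k y
      + christoffel G p l k y * riemann G h i j p y)

/-- The Ricci tensor `R_{ij} = R^h_{ijh}`. -/
def ricci (G : Coord n → Matrix (Fin n) (Fin n) ℝ) (i j : Fin n) (y : Coord n) : ℝ :=
  ∑ h, riemannUp G h i j h y

/-- The scalar curvature `R = g^{ij} R_{ij}`. -/
def scalarCurv (G : Coord n → Matrix (Fin n) (Fin n) ℝ) (y : Coord n) : ℝ :=
  ∑ i, ∑ j, (G y)⁻¹ i j * ricci G i j y

/-- The Weyl conformal curvature tensor `C_{hijk}`. -/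
def weyl (G : Coord n → Matrix (Fin n) (Fin n) ℝ) (h i j k : Fin n) (y : Coord n) : ℝ :=
  riemann G h i j k y
    - 1 / ((n : ℝ) - 2) * (G y h k * ricci G i j y - G y h j * ricci G i k y
        + G y i j * ricci G h k y - G y i k * ricci G h j y)
    + scalarCurv G y / (((n : ℝ) - 1) * ((n : ℝ) - 2)) * (G y h k * G y i j - G y h j * G y i k)

/-- The Schouten tensor `P_{ij} = (R_{ij} - R g_{ij} / (2(n-1))) / (n-2)`. -/
def schouten (G : Coord n → Matrix (Fin n) (Fin n) ℝ) (i j : Fin n) (y : Coord n) : ℝ :=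
  1 / ((n : ℝ) - 2) * (ricci G i j y - scalarCurv G y / (2 * ((n : ℝ) - 1)) * G y i j)

/-- The covariant derivative `P_{ij,k}` of the Schouten tensor. -/
def covSchouten (G : Coord n → Matrix (Fin n) (Fin n) ℝ) (i j k : Fin n) (y : Coord n) : ℝ :=
  partialDeriv k (schouten G i j) y
    - ∑ p, (christoffel G p k i y * schouten G p j y + christoffel G p k j y * schouten G i p y)

/-- The Cotton tensor `P_{ij,k} - P_{ik,j}`. -/
def cotton (G : Coord n → Matrix (Fin n) (Fin n) ℝ) (i j k : Fin n) (y : Coord n) : ℝ :=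
  covSchouten G i j k y - covSchouten G i k j y

end Coordinates

/-! ### Lorentzian manifolds -/

section Lorentzian

variable {n : ℕ} {M : Type*} [TopologicalSpace M] [ChartedSpace (Coord n) M]
  [IsManifold 𝓘(ℝ, Coord n) ∞ M]

variable (n M) in
/-- A smooth Lorentzian metric, of signature `(-,+,…,+)`: at each point there is a timelike vector
on whose orthogonal complement the metric is positive definite. -/
structure LorentzMetric where
  /-- The scalar product of two tangent vectors. -/
  inner (x : M) :
    TangentSpace 𝓘(ℝ, Coord n) x →L[ℝ] TangentSpace 𝓘(ℝ, Coord n) x →L[ℝ] ℝ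
  symm (x : M) (X Y : TangentSpace 𝓘(ℝ, Coord n) x) : inner x X Y = inner x Y X
  lorentzian (x : M) : ∃ U : TangentSpace 𝓘(ℝ, Coord n) x, inner x U U < 0 ∧
    ∀ X : TangentSpace 𝓘(ℝ, Coord n) x, inner x U X = 0 → X ≠ 0 → 0 < inner x X X
  contMDiff : ContMDiff 𝓘(ℝ, Coord n)
    (𝓘(ℝ, Coord n).prod 𝓘(ℝ, Coord n →L[ℝ] Coord n →L[ℝ] ℝ)) ∞
    (fun x => Bundle.TotalSpace.mk' (Coord n →L[ℝ] Coord n →L[ℝ] ℝ)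
      (E := fun x : M =>
        TangentSpace 𝓘(ℝ, Coord n) x →L[ℝ] TangentSpace 𝓘(ℝ, Coord n) x →L[ℝ] ℝ) x (inner x))

variable (n M) in
/-- A smooth covector field (1-form). -/
structure CovectorField where
  /-- The value of the covector at a point. -/
  form (x : M) : TangentSpace 𝓘(ℝ, Coord n) x →L[ℝ] ℝ
  contMDiff : ContMDiff 𝓘(ℝ, Coord n) (𝓘(ℝ, Coord n).prod 𝓘(ℝ, Coord n →L[ℝ] ℝ)) ∞
    (fun x => Bundle.TotalSpace.mk' (Coord n →L[ℝ] ℝ)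
      (E := fun x : M => TangentSpace 𝓘(ℝ, Coord n) x →L[ℝ] ℝ) x (form x))

/-- The coordinate vector `∂_i` of the chart `e`, at the point with coordinates `y`. -/
def coordVector (e : OpenPartialHomeomorph M (Coord n)) (i : Fin n) (y : Coord n) :
    TangentSpace 𝓘(ℝ, Coord n) (e.symm y) :=
  mfderiv 𝓘(ℝ, Coord n) 𝓘(ℝ, Coord n) e.symm y (EuclideanSpace.single i (1 : ℝ) : Coord n)

/-- The components `g_{ij}` of the metric in the chart `e`. -/
def LorentzMetric.comp (g : LorentzMetric n M) (e : OpenPartialHomeomorph M (Coord n))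
    (y : Coord n) : Matrix (Fin n) (Fin n) ℝ :=
  Matrix.of fun i j => g.inner (e.symm y) (coordVector e i y) (coordVector e j y)

/-- The components `v_i` of a covector field in the chart `e`. -/
def CovectorField.comp (v : CovectorField n M) (e : OpenPartialHomeomorph M (Coord n))
    (i : Fin n) (y : Coord n) : ℝ :=
  v.form (e.symm y) (coordVector e i y)

/-- The covector field `v` is timelike, `v_p v^p < 0`, at every point: the vector `V = v^♯` metrically
equivalent to it is timelike. -/
def IsTimelike (g : LorentzMetric n M) (v : CovectorField n M) : Prop :=
  ∀ x : M, ∃ V : TangentSpace 𝓘(ℝ, Coord n) x,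
    (∀ X : TangentSpace 𝓘(ℝ, Coord n) x, v.form x X = g.inner x V X) ∧ g.inner x V V < 0

/-- Pseudosymmetry in the sense of Chaki, with associated covector `v`:
`R_{hijk,l} = 2 v_l R_{hijk} + v_h R_{lijk} + v_i R_{hljk} + v_j R_{hilk} + v_k R_{hijl}`. -/
def IsPseudosymmetric (g : LorentzMetric n M) (v : CovectorField n M) : Prop :=
  ∀ e ∈ atlas (Coord n) M, ∀ y ∈ e.target, ∀ h i j k l : Fin n,
    covRiemann (g.comp e) h i j k l y =
      2 * v.comp e l y * riemann (g.comp e) h i j k y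
        + v.comp e h y * riemann (g.comp e) l i j k y
        + v.comp e i y * riemann (g.comp e) h l j k y
        + v.comp e j y * riemann (g.comp e) h i l k y
        + v.comp e k y * riemann (g.comp e) h i j l y

/-- Conformal flatness in dimension `n ≥ 3`: the Weyl tensor vanishes, and in dimension three, where
the Weyl tensor is identically zero, the Cotton tensor vanishes. -/
def IsConformallyFlat (g : LorentzMetric n M) : Prop :=
  ∀ e ∈ atlas (Coord n) M, ∀ y ∈ e.target,
    (∀ h i j k : Fin n, weyl (g.comp e) h i j k y = 0) ∧
      (n = 3 → ∀ i j k : Fin n, cotton (g.comp e) i j k y = 0)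

/-- `Φ` is an isometry of the generalized Robertson–Walker spacetime `-I ×_f N`, i.e. of `I × N` with
the metric `-dt² + f(t)² h`, onto an open subset of the Lorentzian manifold `(M, g)`. Here `I` is a
nonempty open interval, `(N, h)` is a Riemannian manifold of dimension `n - 1`, and `f` is smooth and
positive on `I`. -/
structure IsGRWChart (g : LorentzMetric n M) (I : Set ℝ) (f : ℝ → ℝ)
    {N : Type*} [TopologicalSpace N] [ChartedSpace (Coord (n - 1)) N]
    [IsManifold 𝓘(ℝ, Coord (n - 1)) ∞ N]
    (h : Bundle.ContMDiffRiemannianMetric 𝓘(ℝ, Coord (n - 1)) ∞ (Coord (n - 1))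
      (fun q : N => TangentSpace 𝓘(ℝ, Coord (n - 1)) q))
    (Φ : PartialDiffeomorph (𝓘(ℝ, ℝ).prod 𝓘(ℝ, Coord (n - 1))) 𝓘(ℝ, Coord n) (ℝ × N) M ∞) :
    Prop where
  isOpen : IsOpen I
  nonempty : I.Nonempty
  ordConnected : I.OrdConnected
  contDiffOn : ContDiffOn ℝ ∞ f I
  pos : ∀ t ∈ I, 0 < f t
  source_eq : Φ.source = I ×ˢ Set.univ
  isometry : ∀ t ∈ I, ∀ (q : N) (a b : ℝ) (X Y : TangentSpace 𝓘(ℝ, Coord (n - 1)) q),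
    g.inner (Φ (t, q))
        (mfderiv (𝓘(ℝ, ℝ).prod 𝓘(ℝ, Coord (n - 1))) 𝓘(ℝ, Coord n) Φ (t, q) (a, X))
        (mfderiv (𝓘(ℝ, ℝ).prod 𝓘(ℝ, Coord (n - 1))) 𝓘(ℝ, Coord n) Φ (t, q) (b, Y)) =
      -(a * b) + f t ^ 2 * h.inner q X Y

/-- `(M, g)` is (locally) a generalized Robertson–Walker spacetime: every point has an open
neighbourhood isometric to some `-I ×_f N`. -/
def IsLocallyGRW (g : LorentzMetric n M) : Prop :=
  ∀ x : M, ∃ (I : Set ℝ) (f : ℝ → ℝ) (N : Type) (_ : TopologicalSpace N)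
    (_ : ChartedSpace (Coord (n - 1)) N) (_ : IsManifold 𝓘(ℝ, Coord (n - 1)) ∞ N)
    (_ : T2Space N) (_ : SecondCountableTopology N) (_ : ConnectedSpace N)
    (h : Bundle.ContMDiffRiemannianMetric 𝓘(ℝ, Coord (n - 1)) ∞ (Coord (n - 1))
      (fun q : N => TangentSpace 𝓘(ℝ, Coord (n - 1)) q))
    (Φ : PartialDiffeomorph (𝓘(ℝ, ℝ).prod 𝓘(ℝ, Coord (n - 1))) 𝓘(ℝ, Coord n) (ℝ × N) M ∞),
    x ∈ Φ.target ∧ IsGRWChart g I f h Φ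

end Lorentzian

end Spacetime

end

/-!
Let `P` be the Schouten tensor. Where the Weyl tensor vanishes the curvature tensor is the
Kulkarni–Nomizu product of `g` and `P` (`riemann_eq_kulkarni`), so pseudosymmetry becomes an
algebraic equation between `P_{ij,l}`, `P_{ij}`, `v_i` and `g_{ij}`. Its right-hand side satisfies
the second Bianchi identity, which for `n ≥ 4` makes `P` a Codazzi tensor; for `n = 3` this is the vanishing of
the Cotton tensor. The traces of the equation then give `P = α v ⊗ v + β g` together with
`P_{ij,l} = 4α v_i v_j v_l + 2β (v_l g_{ij} + v_i g_{lj} + v_j g_{il})`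
(`schouten_eq_of_pseudosymmetric`). Comparing with the derivative of `α v ⊗ v + β g` determines
`dβ = 2β v`, the differential of `α v_p v^p`, and `α v_{i,l}` (`deriv_eq_of_schouten_eq`).

Put `u = v / √(-v_p v^p)`, and fix a point.
* If `α ≠ 0` there, then nearby `u_{i,l} = φ (g_{il} + u_i u_l)`. Since `dβ = 2β v` is closed,
  `β dv = 0`, and this makes `dφ` a multiple of `u` (`torseForming_of_ne_zero`).
* If `α = 0` there, then also `β = 0`, and the linear equations satisfied by `β` and `α v_p v^p`
  propagate these zeros along rays: the metric is flat near the point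
  (`schouten_eq_zero_of_eq_zero`), and `u` is replaced by a parallel unit timelike field, with
  `φ = 0` (`exists_parallel`).

In both cases there is a unit timelike vector field `U` whose dual `u` is closed and satisfies
`L_U g = 2φ (g + u ⊗ u)`. The primitive of `-u` and the flow of `U` give synchronous coordinates
`-dt² + H_t` (`exists_synchronous_chart`). There `φ` depends on `t` alone and `∂_t H = 2φ H`, so
`H_t = f(t)² H_0` (`exists_warped_chart`).

The analytic tools are proved first: the smoothness of flows, from the inverse function theorem on a
space of curves (`exists_smooth_flow`), and the solvability of flat linear total differential
equations (`exists_solution_of_flat`), which gives parallel fields and the Poincaré lemma.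
-/

section

open Set Metric Filter Topology

/-! ### Inverse functions and smooth dependence of flows on the initial condition -/

/-- Inverse function theorem for smooth maps, with an inverse that is smooth on an open set. (For
`C^∞` maps this is stronger than `ContDiffAt ℝ ∞` of the inverse at one point.) -/
theorem exists_smooth_localInverse {E F : Type*} [NormedAddCommGroup E] [NormedSpace ℝ E]
    [CompleteSpace E] [NormedAddCommGroup F] [NormedSpace ℝ F]
    {f : E → F} {S : Set E} (hS : IsOpen S) (hf : ContDiffOn ℝ ∞ f S) {a : E} (ha : a ∈ S)
    {f' : E ≃L[ℝ] F} (hf' : HasFDerivAt f (f' : E →L[ℝ] F) a) :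
    ∃ e : OpenPartialHomeomorph E F, a ∈ e.source ∧ e.source ⊆ S ∧ (∀ x, e x = f x) ∧
      ContDiffOn ℝ ∞ e.symm e.target := by
  have hfa : ∀ x ∈ S, ContDiffAt ℝ ∞ f x := fun x hx => hf.contDiffAt (hS.mem_nhds hx)
  let e₀ := (hfa a ha).toOpenPartialHomeomorph f hf' (by simp)
  have he₀ : a ∈ e₀.source := (hfa a ha).mem_toOpenPartialHomeomorph_source hf' (by simp)
  have hcont : ContinuousOn (fderiv ℝ f) S := hf.continuousOn_fderiv_of_isOpen hS (by simp)
  -- points where the derivative is invertible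
  let S' : Set E := S ∩ (fderiv ℝ f) ⁻¹' (range ((↑) : (E ≃L[ℝ] F) → E →L[ℝ] F))
  have hS' : IsOpen S' := hcont.isOpen_inter_preimage hS ContinuousLinearEquiv.isOpen
  have haS' : a ∈ S' := ⟨ha, f', hf'.fderiv.symm⟩
  let e := e₀.restrOpen S' hS'
  have hsrc : e.source = e₀.source ∩ S' := e₀.restrOpen_source S' hS'
  refine ⟨e, ?_, ?_, fun x => rfl, ?_⟩
  · rw [hsrc]; exact ⟨he₀, haS'⟩
  · rw [hsrc]; exact fun x hx => hx.2.1
  · intro y hy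
    have hx : e.symm y ∈ e.source := e.map_target hy
    rw [hsrc] at hx
    obtain ⟨g', hg'⟩ := hx.2.2
    refine (e.contDiffAt_symm hy (f₀' := g') ?_ (hfa _ hx.2.1)).contDiffWithinAt
    rw [hg']
    exact ((hfa _ hx.2.1).differentiableAt (by simp)).hasFDerivAt

section CompLeft

variable {K : Type} [TopologicalSpace K] [CompactSpace K] {E F : Type}
  [NormedAddCommGroup E] [NormedSpace ℝ E] [NormedAddCommGroup F] [NormedSpace ℝ F]

/-- Pointwise evaluation of a continuous family of operators along a curve. -/
noncomputable def pointwiseApply (K E F : Type) [TopologicalSpace K] [CompactSpace K]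
    [NormedAddCommGroup E] [NormedSpace ℝ E] [NormedAddCommGroup F] [NormedSpace ℝ F] :
    C(K, E →L[ℝ] F) →L[ℝ] C(K, E) →L[ℝ] C(K, F) :=
  LinearMap.mkContinuous₂
    (LinearMap.mk₂ ℝ (fun (A : C(K, E →L[ℝ] F)) (η : C(K, E)) =>
        (⟨fun t => A t (η t), A.continuous.clm_apply η.continuous⟩ : C(K, F)))
      (by intros; ext; simp) (by intros; ext; simp) (by intros; ext; simp) (by intros; ext; simp)) 1
    (by
      intro A η
      rw [one_mul, ContinuousMap.norm_le _ (by positivity)]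
      intro t
      exact ((A t).le_opNorm _).trans (by gcongr <;> exact ContinuousMap.norm_coe_le_norm _ _))

@[simp]
theorem pointwiseApply_apply (A : C(K, E →L[ℝ] F)) (η : C(K, E)) (t : K) :
    pointwiseApply K E F A η t = A t (η t) := rfl

/-- The derivative of `γ ↦ V ∘ γ` is `η ↦ (t ↦ DV(γ t) (η t))`. The estimate of the remainder,
uniform in `t`, comes from the continuity of `γ ↦ DV ∘ γ`. -/
theorem hasFDerivAt_compLeft {V : E → F} {V' : E → E →L[ℝ] F} (hV : ∀ x, HasFDerivAt V (V' x) x)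
    (hV' : Continuous V') (γ : C(K, E)) :
    HasFDerivAt (fun γ : C(K, E) => (⟨V, continuous_iff_continuousAt.2
        fun x => (hV x).continuousAt⟩ : C(E, F)).comp γ)
      (pointwiseApply K E F ((⟨V', hV'⟩ : C(E, E →L[ℝ] F)).comp γ)) γ := by
  rw [hasFDerivAt_iff_isLittleO_nhds_zero, Asymptotics.isLittleO_iff]
  intro c hc
  have hcont : ContinuousAt (fun γ : C(K, E) => (⟨V', hV'⟩ : C(E, E →L[ℝ] F)).comp γ) γ :=
    (ContinuousMap.continuous_postcomp _).continuousAt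
  obtain ⟨δ, hδ, hball⟩ := (Metric.continuousAt_iff (a := γ)
    (f := fun γ : C(K, E) => (⟨V', hV'⟩ : C(E, E →L[ℝ] F)).comp γ)).1 hcont c hc
  filter_upwards [Metric.ball_mem_nhds (0 : C(K, E)) hδ] with η hη
  rw [ContinuousMap.norm_le _ (by positivity)]
  intro t
  have key : ∀ z ∈ segment ℝ (γ t) (γ t + η t), ‖V' z - V' (γ t)‖ ≤ c := by
    intro z hz
    rw [segment_eq_image'] at hz
    obtain ⟨s, hs, rfl⟩ := hz
    have h1 : dist (γ + s • η) γ < δ := by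
      rw [dist_eq_norm, add_sub_cancel_left, norm_smul, Real.norm_eq_abs, abs_of_nonneg hs.1]
      have := mem_ball_zero_iff.1 hη
      nlinarith [hs.2, norm_nonneg η]
    have h2 := (ContinuousMap.dist_le (C := c) hc.le).1 (hball h1).le t
    rw [dist_eq_norm] at h2
    simpa using h2
  have h := (convex_segment (𝕜 := ℝ) (γ t)
    (γ t + η t)).norm_image_sub_le_of_norm_hasFDerivWithin_le'
    (fun z _ => (hV z).hasFDerivWithinAt) key (left_mem_segment ℝ _ _) (right_mem_segment ℝ _ _)
  rw [add_sub_cancel_left] at h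
  refine le_trans (le_of_eq ?_) (h.trans (by gcongr; exact ContinuousMap.norm_coe_le_norm _ _))
  simp

theorem contDiff_nat_compLeft (m : ℕ) {E : Type} [NormedAddCommGroup E] [NormedSpace ℝ E] :
    ∀ {F : Type} [NormedAddCommGroup F] [NormedSpace ℝ F] (V : C(E, F)), ContDiff ℝ m V →
      ContDiff ℝ m (fun γ : C(K, E) => V.comp γ) := by
  induction m with
  | zero => intro F _ _ V _; exact contDiff_zero.2 (ContinuousMap.continuous_postcomp _)
  | succ m ih =>
    intro F _ _ V hV
    obtain ⟨V', hV', h⟩ := contDiff_succ_iff_hasFDerivAt.1 (by exact_mod_cast hV)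
    have h0 : ContDiff ℝ m (pointwiseApply K E F) := ContinuousLinearMap.contDiff _
    have h1 : ContDiff ℝ m fun γ : C(K, E) =>
        pointwiseApply K E F ((⟨V', hV'.continuous⟩ : C(E, E →L[ℝ] F)).comp γ) :=
      h0.comp (ih ⟨V', hV'.continuous⟩ hV')
    have : ContDiff ℝ (m + 1) (fun γ : C(K, E) => V.comp γ) :=
      contDiff_succ_iff_hasFDerivAt.2 ⟨_, h1, fun γ => hasFDerivAt_compLeft h hV'.continuous γ⟩
    exact_mod_cast this

/-- Composition with a smooth map is a smooth operator on spaces of continuous maps on a compact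
space. -/
theorem contDiff_compLeft (V : C(E, F)) (hV : ContDiff ℝ ∞ V) :
    ContDiff ℝ ∞ (fun γ : C(K, E) => V.comp γ) :=
  contDiff_infty.2 fun m => contDiff_nat_compLeft m V (contDiff_infty.1 hV m)

end CompLeft

section Flow

variable {E : Type} [NormedAddCommGroup E] [NormedSpace ℝ E]

/-- The interval `[-1, 1]` on which rescaled integral curves are parametrized. -/
abbrev UnitTime : Type := Icc (-1 : ℝ) 1

/-- The point of `[-1, 1]` nearest to a real number. -/
noncomputable abbrev toUnitTime (s : ℝ) : UnitTime := projIcc (-1) 1 (by norm_num) s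

theorem continuous_comp_toUnitTime {X : Type} [TopologicalSpace X] (γ : C(UnitTime, X)) :
    Continuous fun s : ℝ => γ (toUnitTime s) :=
  γ.continuous.comp continuous_projIcc

theorem hasDerivAt_integral_unitTime [CompleteSpace E] (γ : C(UnitTime, E)) (t : ℝ) :
    HasDerivAt (fun t => ∫ s in (0 : ℝ)..t, γ (toUnitTime s)) (γ (toUnitTime t)) t :=
  (continuous_comp_toUnitTime γ).integral_hasStrictDerivAt 0 t |>.hasDerivAt

/-- The primitive, vanishing at `0`, of a continuous curve on `[-1, 1]`. -/
noncomputable def primitiveCLM (E : Type) [NormedAddCommGroup E] [NormedSpace ℝ E]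
    [CompleteSpace E] : C(UnitTime, E) →L[ℝ] C(UnitTime, E) :=
  LinearMap.mkContinuous
    { toFun := fun γ => ⟨fun t => ∫ s in (0 : ℝ)..t, γ (toUnitTime s),
        (continuous_iff_continuousAt.2 fun t =>
          (hasDerivAt_integral_unitTime γ t).continuousAt).comp continuous_subtype_val⟩
      map_add' := fun γ η => by
        ext t
        exact intervalIntegral.integral_add
          ((continuous_comp_toUnitTime γ).intervalIntegrable _ _)
          ((continuous_comp_toUnitTime η).intervalIntegrable _ _)
      map_smul' := fun c γ => by
        ext t
        exact intervalIntegral.integral_smul c _ } 1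
    (by
      intro γ
      rw [one_mul, ContinuousMap.norm_le _ (norm_nonneg _)]
      intro t
      refine (intervalIntegral.norm_integral_le_of_norm_le_const
        (C := ‖γ‖) fun s _ => ContinuousMap.norm_coe_le_norm _ _).trans ?_
      have : |(t : ℝ) - 0| ≤ 1 := by rw [sub_zero, abs_le]; exact t.2
      nlinarith [norm_nonneg γ])

theorem primitiveCLM_apply [CompleteSpace E] (γ : C(UnitTime, E)) (t : UnitTime) :
    primitiveCLM E γ t = ∫ s in (0 : ℝ)..t, γ (toUnitTime s) := rfl

/-- Reparametrization `t ↦ γ (σ t)` of a curve on `[-1, 1]`, for `σ ∈ [-1, 1]`. -/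
noncomputable def rescale (σ : UnitTime) (γ : C(UnitTime, E)) : C(UnitTime, E) :=
  ⟨fun t => γ (toUnitTime (σ * t)), (continuous_comp_toUnitTime γ).comp (by fun_prop)⟩

theorem mul_mem_unitTime (σ t : UnitTime) : (σ : ℝ) * t ∈ Icc (-1 : ℝ) 1 := by
  rw [mem_Icc, ← abs_le, abs_mul]
  exact mul_le_one₀ (abs_le.2 σ.2) (abs_nonneg _) (abs_le.2 t.2)

theorem primitiveCLM_rescale [CompleteSpace E] (σ : UnitTime) (γ : C(UnitTime, E)) (t : UnitTime) :
    (σ : ℝ) • primitiveCLM E (rescale σ γ) t = primitiveCLM E γ (toUnitTime (σ * t)) := by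
  have h : toUnitTime (σ * t) = (⟨σ * t, mul_mem_unitTime σ t⟩ : UnitTime) :=
    projIcc_of_mem _ (mul_mem_unitTime σ t)
  rw [primitiveCLM_apply, primitiveCLM_apply, h]
  have h2 : ∫ s in (0 : ℝ)..t, rescale σ γ (toUnitTime s)
      = ∫ s in (0 : ℝ)..t, γ (toUnitTime (σ * s)) := by
    refine intervalIntegral.integral_congr fun s hs => ?_
    have hs' : s ∈ Icc (-1 : ℝ) 1 := by
      rw [mem_uIcc] at hs
      rcases hs with hs | hs <;> constructor <;> linarith [hs.1, hs.2, t.2.1, t.2.2]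
    simp only [rescale, ContinuousMap.coe_mk, toUnitTime, projIcc_of_mem _ hs']
  rw [h2, intervalIntegral.smul_integral_comp_mul_left (fun s => γ (toUnitTime s)) σ, mul_zero]

/-- A smooth vector field on a Banach space has a smooth local flow. The equation
`γ(t) = x + s ∫₀ᵗ V(γ)` for the integral curve of `V` through `x`, run at speed `s` on `[-1, 1]`, is
solved by the inverse function theorem at `s = 0`; its value at `t = 1` is the flow of `V` at time
`s`. -/
theorem exists_smooth_flow_of_contDiff [CompleteSpace E] {V : E → E} (hV : ContDiff ℝ ∞ V)
    (x₀ : E) :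
    ∃ φ : ℝ × E → E, ∃ ε > 0, ContDiffOn ℝ ∞ φ (ball ((0 : ℝ), x₀) ε) ∧
      ∀ p ∈ ball ((0 : ℝ), x₀) ε, φ (0, p.2) = p.2 ∧
        HasDerivAt (fun t => φ (t, p.2)) (V (φ p)) p.1 := by
  let Vc : C(E, E) := ⟨V, hV.continuous⟩
  let N : C(UnitTime, E) → C(UnitTime, E) := fun γ => primitiveCLM E (Vc.comp γ)
  have hN : ContDiff ℝ ∞ N := (primitiveCLM E).contDiff.comp (contDiff_compLeft Vc hV)
  let H : ℝ × C(UnitTime, E) → ℝ × C(UnitTime, E) := fun p => (p.1, p.2 - p.1 • N p.2)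
  have hH : ContDiff ℝ ∞ H :=
    contDiff_fst.prodMk (contDiff_snd.sub (contDiff_fst.smul (hN.comp contDiff_snd)))
  let cst : E →L[ℝ] C(UnitTime, E) := ContinuousLinearMap.const ℝ UnitTime
  let γ₀ : C(UnitTime, E) := cst x₀
  let L : (ℝ × C(UnitTime, E)) ≃L[ℝ] ℝ × C(UnitTime, E) :=
    ContinuousLinearEquiv.equivOfInverse
      ((ContinuousLinearMap.fst ℝ ℝ C(UnitTime, E)).prod
        (ContinuousLinearMap.snd ℝ ℝ C(UnitTime, E)
          - (ContinuousLinearMap.fst ℝ ℝ C(UnitTime, E)).smulRight (N γ₀)))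
      ((ContinuousLinearMap.fst ℝ ℝ C(UnitTime, E)).prod
        (ContinuousLinearMap.snd ℝ ℝ C(UnitTime, E)
          + (ContinuousLinearMap.fst ℝ ℝ C(UnitTime, E)).smulRight (N γ₀)))
      (fun p => by ext <;> simp) (fun p => by ext <;> simp)
  have hL : HasFDerivAt H (L : (ℝ × C(UnitTime, E)) →L[ℝ] ℝ × C(UnitTime, E)) (0, γ₀) := by
    have h1 : HasFDerivAt (fun p : ℝ × C(UnitTime, E) => N p.2)
        ((fderiv ℝ N γ₀).comp (ContinuousLinearMap.snd ℝ ℝ C(UnitTime, E))) ((0 : ℝ), γ₀) :=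
      HasFDerivAt.comp (g := N) ((0 : ℝ), γ₀)
        ((hN.differentiable (by simp)) γ₀).hasFDerivAt hasFDerivAt_snd
    have h2 := (hasFDerivAt_fst (𝕜 := ℝ) (p := ((0 : ℝ), γ₀))).prodMk
      ((hasFDerivAt_snd (𝕜 := ℝ) (p := ((0 : ℝ), γ₀))).sub
        ((hasFDerivAt_fst (𝕜 := ℝ) (p := ((0 : ℝ), γ₀))).smul h1))
    refine h2.congr_fderiv ?_
    ext p <;> simp [L]
  obtain ⟨e, he₀, -, he, hsymm⟩ := exists_smooth_localInverse isOpen_univ hH.contDiffOn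
    (mem_univ _) hL
  have hH₀ : H (0, γ₀) = (0, γ₀) := by simp [H]
  have ht₀ : (0, γ₀) ∈ e.target := by rw [← hH₀, ← he]; exact e.map_source he₀
  have hs₀ : e.symm (0, γ₀) = (0, γ₀) := by
    have := e.left_inv he₀
    rwa [he, hH₀] at this
  obtain ⟨δ, hδ, hδs⟩ := Metric.isOpen_iff.1 e.open_source _ he₀
  let c : ℝ × E → ℝ × C(UnitTime, E) := fun p => (p.1, cst p.2)
  have hc : ContDiff ℝ ∞ c := contDiff_fst.prodMk (cst.contDiff.comp contDiff_snd)
  -- the integral curve, as a function of the speed and of the initial point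
  let Γ : ℝ × E → C(UnitTime, E) := fun p => (e.symm (c p)).2
  have hΓ : ContDiffOn ℝ ∞ Γ (c ⁻¹' e.target) :=
    contDiff_snd.comp_contDiffOn (hsymm.comp hc.contDiffOn (fun p hp => hp))
  have hopen : IsOpen (c ⁻¹' e.target) := e.open_target.preimage hc.continuous
  have hmem : ((0 : ℝ), x₀) ∈ c ⁻¹' e.target := ht₀
  have hΓ₀ : Γ (0, x₀) = γ₀ := by
    change (e.symm (0, γ₀)).2 = γ₀
    rw [hs₀]
  have hnear : ∀ᶠ p in 𝓝 ((0 : ℝ), x₀), p ∈ c ⁻¹' e.target ∧ dist (Γ p) γ₀ < δ := by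
    have h0 : ∀ᶠ p in 𝓝 ((0 : ℝ), x₀), p ∈ c ⁻¹' e.target := hopen.mem_nhds hmem
    refine h0.and ?_
    have h := (hΓ.continuousOn.continuousAt (hopen.mem_nhds hmem)).tendsto
    rw [hΓ₀] at h
    exact h.eventually (Metric.ball_mem_nhds γ₀ hδ)
  obtain ⟨ε', hε', hball'⟩ := Metric.eventually_nhds_iff_ball.1 hnear
  set ε := min ε' δ with hεdef
  have hε : 0 < ε := lt_min hε' hδ
  have hball : ∀ p ∈ ball ((0 : ℝ), x₀) ε, p ∈ c ⁻¹' e.target ∧ dist (Γ p) γ₀ < δ :=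
    fun p hp => hball' p (ball_subset_ball (min_le_left _ _) hp)
  have hmemball : ∀ p : ℝ × E, p ∈ ball ((0 : ℝ), x₀) ε ↔ |p.1| < ε ∧ dist p.2 x₀ < ε := by
    intro p
    rw [mem_ball, Prod.dist_eq, max_lt_iff, Real.dist_eq, sub_zero]
  -- the integral equation
  have heq : ∀ p ∈ ball ((0 : ℝ), x₀) ε, Γ p - p.1 • N (Γ p) = cst p.2 := by
    intro p hp
    have h1 := e.right_inv (hball p hp).1
    rw [he] at h1
    have h2 : (e.symm (c p)).1 = p.1 := congrArg Prod.fst h1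
    have h3 : (e.symm (c p)).2 - (e.symm (c p)).1 • N (e.symm (c p)).2 = cst p.2 :=
      congrArg Prod.snd h1
    rwa [h2] at h3
  have heq' : ∀ p ∈ ball ((0 : ℝ), x₀) ε, ∀ t : UnitTime,
      Γ p t = p.2 + p.1 • primitiveCLM E (Vc.comp (Γ p)) t := by
    intro p hp t
    have h := congrArg (fun γ : C(UnitTime, E) => γ t) (heq p hp)
    simp only [ContinuousMap.sub_apply, ContinuousMap.smul_apply] at h
    exact sub_eq_iff_eq_add.1 h
  let one : UnitTime := ⟨1, by norm_num⟩
  let ev : C(UnitTime, E) →L[ℝ] E := ContinuousMap.evalCLM ℝ one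
  -- rescaling a solution gives the solution of the rescaled problem
  have hscale : ∀ p ∈ ball ((0 : ℝ), x₀) ε, ∀ σ : UnitTime,
      Γ (σ * p.1, p.2) one = Γ p σ := by
    intro p hp σ
    have hp' := (hmemball p).1 hp
    have hσ : |(σ : ℝ) * p.1| ≤ |p.1| := by
      rw [abs_mul]; exact mul_le_of_le_one_left (abs_nonneg _) (abs_le.2 σ.2)
    have hq : ((σ : ℝ) * p.1, p.2) ∈ ball ((0 : ℝ), x₀) ε :=
      (hmemball _).2 ⟨hσ.trans_lt hp'.1, hp'.2⟩
    have hsol : H ((σ : ℝ) * p.1, rescale σ (Γ p)) = c ((σ : ℝ) * p.1, p.2) := by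
      refine Prod.ext rfl ?_
      ext t
      change rescale σ (Γ p) t - ((σ : ℝ) * p.1) • primitiveCLM E (Vc.comp (rescale σ (Γ p))) t
        = p.2
      have h1 := primitiveCLM_rescale σ (Vc.comp (Γ p)) t
      have h2 : Vc.comp (rescale σ (Γ p)) = rescale σ (Vc.comp (Γ p)) := rfl
      have h3 := heq' p hp (toUnitTime (σ * t))
      rw [h2, mul_comm, mul_smul, h1]
      exact sub_eq_iff_eq_add.2 h3
    have hsrc : ((σ : ℝ) * p.1, rescale σ (Γ p)) ∈ e.source := by
      apply hδs
      rw [mem_ball, Prod.dist_eq, max_lt_iff]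
      constructor
      · rw [Real.dist_eq, sub_zero]
        exact hσ.trans_lt (hp'.1.trans_le (min_le_right _ _))
      · refine (ContinuousMap.dist_lt_iff hδ).2 fun t => ?_
        exact (ContinuousMap.dist_lt_iff hδ).1 (hball p hp).2 (toUnitTime (σ * t))
    have h4 : e.symm (c ((σ : ℝ) * p.1, p.2)) = ((σ : ℝ) * p.1, rescale σ (Γ p)) := by
      rw [← hsol, ← he]; exact e.left_inv hsrc
    have h5 : Γ ((σ : ℝ) * p.1, p.2) = rescale σ (Γ p) := congrArg Prod.snd h4
    rw [h5]
    change Γ p (toUnitTime ((σ : ℝ) * 1)) = Γ p σ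
    rw [mul_one, toUnitTime, projIcc_val]
  refine ⟨fun p => Γ p one, ε, hε, ?_, ?_⟩
  · exact ev.contDiff.comp_contDiffOn (hΓ.mono fun p hp => (hball p hp).1)
  · rintro ⟨t, x⟩ hp
    have hp' := (hmemball _).1 hp
    dsimp only at hp' ⊢
    refine ⟨?_, ?_⟩
    · have h0 : ((0 : ℝ), x) ∈ ball ((0 : ℝ), x₀) ε := (hmemball _).2 ⟨by simpa using hε, hp'.2⟩
      simpa using heq' _ h0 one
    · obtain ⟨s, hs1, hs2⟩ := exists_between hp'.1
      have hs0 : 0 < s := (abs_nonneg _).trans_lt hs1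
      have hsx : (s, x) ∈ ball ((0 : ℝ), x₀) ε :=
        (hmemball _).2 ⟨by rwa [abs_of_pos hs0], hp'.2⟩
      have hval : ∀ t' : ℝ, |t'| < s →
          Γ (t', x) one = Γ (s, x) (toUnitTime (t' / s)) ∧
            (toUnitTime (t' / s) : ℝ) = t' / s := by
        intro t' ht'
        have hm : t' / s ∈ Icc (-1 : ℝ) 1 := by
          rw [mem_Icc, ← abs_le, abs_div, abs_of_pos hs0]
          exact (div_le_one hs0).2 ht'.le
        have h1 := hscale _ hsx ⟨t' / s, hm⟩
        have h2 : t' / s * s = t' := div_mul_cancel₀ _ hs0.ne'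
        rw [toUnitTime, projIcc_of_mem _ hm]
        dsimp only at h1
        rw [h2] at h1
        exact ⟨h1, rfl⟩
      have hcurve : (fun t' => Γ (t', x) one) =ᶠ[𝓝 t] fun t' =>
          x + s • ∫ r in (0 : ℝ)..(t' / s), (Vc.comp (Γ (s, x))) (toUnitTime r) := by
        have : ∀ᶠ t' in 𝓝 t, |t'| < s :=
          (continuous_abs.tendsto t).eventually (gt_mem_nhds hs1)
        filter_upwards [this] with t' ht'
        rw [(hval t' ht').1, heq' _ hsx, primitiveCLM_apply, (hval t' ht').2]
      refine HasDerivAt.congr_of_eventuallyEq ?_ hcurve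
      have h1 := (hasDerivAt_integral_unitTime (Vc.comp (Γ (s, x))) (t / s)).scomp t
        ((hasDerivAt_id t).div_const s)
      have h2 := (h1.const_smul s).const_add x
      refine h2.congr_deriv ?_
      rw [smul_smul, mul_one_div_cancel hs0.ne', one_smul, (hval t hs1).1]
      rfl

end Flow

section LocalFlow

variable {E F : Type} [NormedAddCommGroup E] [NormedSpace ℝ E]
  [NormedAddCommGroup F] [NormedSpace ℝ F]

/-- A smooth map on an open set agrees near a given point with a map that is smooth everywhere. -/
theorem exists_contDiff_eventuallyEq [HasContDiffBump E] {V : E → F} {O : Set E} (hO : IsOpen O)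
    (hV : ContDiffOn ℝ ∞ V O) {x₀ : E} (hx₀ : x₀ ∈ O) :
    ∃ W : E → F, ContDiff ℝ ∞ W ∧ ∀ᶠ x in 𝓝 x₀, W x = V x := by
  obtain ⟨δ, hδ, hsub⟩ := Metric.isOpen_iff.1 hO x₀ hx₀
  let χ : ContDiffBump x₀ := ⟨δ / 4, δ / 2, by positivity, by linarith⟩
  refine ⟨fun x => χ x • V x, contDiff_iff_contDiffAt.2 fun x => ?_, ?_⟩
  · by_cases hx : x ∈ ball x₀ δ
    · exact χ.contDiffAt.smul (hV.contDiffAt (hO.mem_nhds (hsub hx)))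
    · have h0 : ∀ᶠ y in 𝓝 x, χ y • V y = 0 := by
        have : ∀ᶠ y in 𝓝 x, δ / 2 < dist y x₀ := by
          refine (continuous_id.dist continuous_const).continuousAt.eventually
            (lt_mem_nhds (?_ : δ / 2 < dist x x₀))
          rw [mem_ball, not_lt] at hx
          linarith
        filter_upwards [this] with y hy
        rw [χ.zero_of_le_dist hy.le, zero_smul]
      exact (contDiffAt_const (c := (0 : F))).congr_of_eventuallyEq h0
  · filter_upwards [χ.eventuallyEq_one] with x hx
    rw [hx, Pi.one_apply, one_smul]

/-- A smooth vector field has a local flow that is smooth in the time and the initial point. -/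
theorem exists_smooth_flow [CompleteSpace E] [HasContDiffBump E] {V : E → E} {O : Set E}
    (hO : IsOpen O) (hV : ContDiffOn ℝ ∞ V O) {x₀ : E} (hx₀ : x₀ ∈ O) :
    ∃ φ : ℝ × E → E, ∃ ε > 0, ContDiffOn ℝ ∞ φ (ball ((0 : ℝ), x₀) ε) ∧
      ∀ p ∈ ball ((0 : ℝ), x₀) ε, φ p ∈ O ∧ φ (0, p.2) = p.2 ∧
        HasDerivAt (fun t => φ (t, p.2)) (V (φ p)) p.1 := by
  obtain ⟨W, hW, hWV⟩ := exists_contDiff_eventuallyEq hO hV hx₀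
  obtain ⟨φ, ε, hε, hφ, hflow⟩ := exists_smooth_flow_of_contDiff hW x₀
  have hmem : ((0 : ℝ), x₀) ∈ ball ((0 : ℝ), x₀) ε := mem_ball_self hε
  have hφ₀ : φ (0, x₀) = x₀ := (hflow _ hmem).1
  have hev : ∀ᶠ p in 𝓝 ((0 : ℝ), x₀), φ p ∈ O ∧ W (φ p) = V (φ p) := by
    have h := (hφ.continuousOn.continuousAt (isOpen_ball.mem_nhds hmem)).tendsto
    rw [hφ₀] at h
    have hO' : ∀ᶠ x in 𝓝 x₀, x ∈ O := hO.mem_nhds hx₀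
    exact h.eventually (hO'.and hWV)
  obtain ⟨δ, hδ, hδ'⟩ := Metric.eventually_nhds_iff_ball.1 hev
  refine ⟨φ, min ε δ, lt_min hε hδ, hφ.mono (ball_subset_ball (min_le_left _ _)), ?_⟩
  intro p hp
  have h1 := hflow p (ball_subset_ball (min_le_left _ _) hp)
  have h2 := hδ' p (ball_subset_ball (min_le_right _ _) hp)
  exact ⟨h2.1, h1.1, h2.2 ▸ h1.2⟩

/-- Interchanging a derivative in time with a derivative in the other variable. -/
theorem hasDerivAt_fderiv_inr {w g : ℝ × E → F} {S : Set (ℝ × E)} (hS : IsOpen S)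
    (hw : ContDiffOn ℝ ∞ w S) (hg : ∀ p ∈ S, HasDerivAt (fun t => w (t, p.2)) (g p) p.1)
    {p : ℝ × E} (hp : p ∈ S) (Y : E) :
    HasDerivAt (fun t => fderiv ℝ w (t, p.2) (0, Y)) (fderiv ℝ g p (0, Y)) p.1 := by
  have hdiff : ∀ q ∈ S, DifferentiableAt ℝ w q := fun q hq =>
    (hw.contDiffAt (hS.mem_nhds hq)).differentiableAt (by simp)
  have hgw : ∀ q ∈ S, g q = fderiv ℝ w q (1, 0) := by
    intro q hq
    have hline : HasDerivAt (fun t : ℝ => (t, q.2)) ((1 : ℝ), (0 : E)) q.1 :=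
      (hasDerivAt_id q.1).prodMk (hasDerivAt_const q.1 q.2)
    have h1 : HasDerivAt (fun t => w (t, q.2)) (fderiv ℝ w q (1, 0)) q.1 :=
      HasFDerivAt.comp_hasDerivAt (l := w) q.1 (hdiff q hq).hasFDerivAt hline
    exact (hg q hq).unique h1
  have hwp : ContDiffAt ℝ ∞ w p := hw.contDiffAt (hS.mem_nhds hp)
  have hsymm : IsSymmSndFDerivAt ℝ w p := hwp.isSymmSndFDerivAt (by
    rw [minSmoothness_of_isRCLikeNormedField]; exact ENat.LEInfty.out)
  have hD : DifferentiableAt ℝ (fderiv ℝ w) p :=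
    (hwp.fderiv_right (m := ∞) (by simp)).differentiableAt (by simp)
  have h2 : fderiv ℝ g p (0, Y) = fderiv ℝ (fderiv ℝ w) p (1, 0) (0, Y) := by
    have : g =ᶠ[𝓝 p] fun q => fderiv ℝ w q (1, 0) := by
      filter_upwards [hS.mem_nhds hp] with q hq using hgw q hq
    rw [this.fderiv_eq, fderiv_clm_apply hD (differentiableAt_const _)]
    simp [hsymm.eq (1, 0) (0, Y)]
  rw [h2]
  have hline : HasDerivAt (fun t : ℝ => (t, p.2)) ((1 : ℝ), (0 : E)) p.1 :=
    (hasDerivAt_id p.1).prodMk (hasDerivAt_const p.1 p.2)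
  have h3 : HasDerivAt (fun t => fderiv ℝ w (t, p.2)) (fderiv ℝ (fderiv ℝ w) p (1, 0)) p.1 :=
    HasFDerivAt.comp_hasDerivAt (l := fderiv ℝ w) p.1 hD.hasFDerivAt hline
  simpa using h3.clm_apply (hasDerivAt_const p.1 ((0 : ℝ), Y))

/-- A solution of a linear differential inequality `‖f'‖ ≤ K ‖f‖` that vanishes at `0` vanishes. -/
theorem eq_zero_of_norm_deriv_le {f f' : ℝ → E} {K b : ℝ}
    (hf : ∀ t ∈ Icc 0 b, HasDerivAt f (f' t) t) (h0 : f 0 = 0)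
    (hK : ∀ t ∈ Icc 0 b, ‖f' t‖ ≤ K * ‖f t‖) : ∀ t ∈ Icc 0 b, f t = 0 :=
  eq_zero_of_abs_deriv_le_mul_abs_self_of_eq_zero_right
    (fun t ht => (hf t ht).continuousAt.continuousWithinAt)
    (fun t ht => (hf t (Ico_subset_Icc_self ht)).hasDerivWithinAt) h0
    (fun t ht => hK t (Ico_subset_Icc_self ht))

/-- A solution of a homogeneous linear equation `f' = A f` that vanishes at `0` vanishes. -/
theorem eq_zero_of_hasDerivAt_clm {f : ℝ → E} {A : ℝ → E →L[ℝ] E} {b : ℝ}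
    (hA : ContinuousOn A (Icc 0 b)) (hf : ∀ t ∈ Icc 0 b, HasDerivAt f (A t (f t)) t)
    (h0 : f 0 = 0) : ∀ t ∈ Icc 0 b, f t = 0 := by
  obtain ⟨K, hK⟩ := isCompact_Icc.exists_bound_of_continuousOn hA
  exact eq_zero_of_norm_deriv_le hf h0 fun t ht =>
    ((A t).le_opNorm _).trans (by gcongr; exact hK t ht)

end LocalFlow

/-! ### Total differential equations -/

section Frobenius

variable {E F : Type} [NormedAddCommGroup E] [NormedSpace ℝ E] [FiniteDimensional ℝ E]
  [NormedAddCommGroup F] [NormedSpace ℝ F] [FiniteDimensional ℝ F]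

/-- A linear total differential equation `dU(X) = Γ(X) U` whose connection `Γ` is flat has a smooth
solution near `y₀` with any initial value. The solution is found by integrating along the rays from
`y₀`; flatness makes the defect `∂_X w(t, X) Y - t Γ(Y) w` of the ray solution `w` satisfy a
homogeneous linear equation in `t`. -/
theorem exists_solution_of_flat {Γ : E → E →L[ℝ] F →L[ℝ] F} {O : Set E} (hO : IsOpen O)
    (hΓ : ContDiffOn ℝ ∞ Γ O)
    (hflat : ∀ y ∈ O, ∀ X Y : E, ∀ w : F, fderiv ℝ Γ y X Y w + Γ y Y (Γ y X w)
      = fderiv ℝ Γ y Y X w + Γ y X (Γ y Y w))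
    {y₀ : E} (hy₀ : y₀ ∈ O) (U₀ : F) :
    ∃ (r : ℝ) (U : E → F), 0 < r ∧ ball y₀ r ⊆ O ∧ ContDiffOn ℝ ∞ U (ball y₀ r) ∧ U y₀ = U₀ ∧
      ∀ y ∈ ball y₀ r, ∀ X, fderiv ℝ U y X = Γ y X (U y) := by
  have : CompleteSpace E := FiniteDimensional.complete ℝ E
  have : CompleteSpace F := FiniteDimensional.complete ℝ F
  have hΓa : ∀ y ∈ O, HasFDerivAt Γ (fderiv ℝ Γ y) y := fun y hy =>
    ((hΓ.contDiffAt (hO.mem_nhds hy)).differentiableAt (by simp)).hasFDerivAt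
  let W : E × E × F → E × E × F := fun p => (p.2.1, 0, Γ p.1 p.2.1 p.2.2)
  have hOW : IsOpen (Prod.fst ⁻¹' O : Set (E × E × F)) := hO.preimage continuous_fst
  have hW : ContDiffOn ℝ ∞ W (Prod.fst ⁻¹' O) := by
    have h1 : ContDiffOn ℝ ∞ (fun p : E × E × F => Γ p.1) (Prod.fst ⁻¹' O) :=
      hΓ.comp contDiff_fst.contDiffOn fun p hp => hp
    have h2 : ContDiff ℝ ∞ (fun p : E × E × F => p.2.1) := contDiff_fst.comp contDiff_snd
    have h3 : ContDiff ℝ ∞ (fun p : E × E × F => p.2.2) := contDiff_snd.comp contDiff_snd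
    exact h2.contDiffOn.prodMk
      (contDiffOn_const.prodMk ((h1.clm_apply h2.contDiffOn).clm_apply h3.contDiffOn))
  obtain ⟨φ, ε, hε, hφ, hflow⟩ := exists_smooth_flow hOW hW
    (x₀ := ((y₀, 0, U₀) : E × E × F)) hy₀
  let ι : ℝ × E → ℝ × E × E × F := fun q => (q.1, y₀, q.2, U₀)
  have hι : ContDiff ℝ ∞ ι :=
    contDiff_fst.prodMk (contDiff_const.prodMk (contDiff_snd.prodMk contDiff_const))
  let S : Set (ℝ × E) := ball (0, 0) ε
  have hS : IsOpen S := isOpen_ball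
  have hmemS : ∀ q : ℝ × E, q ∈ S ↔ |q.1| < ε ∧ ‖q.2‖ < ε := by
    intro q
    rw [mem_ball, Prod.dist_eq, max_lt_iff, Real.dist_eq, sub_zero, dist_zero_right]
  have hιS : ∀ q ∈ S, ι q ∈ ball ((0 : ℝ), ((y₀, 0, U₀) : E × E × F)) ε := by
    intro q hq
    have := (hmemS q).1 hq
    simp only [ι, mem_ball, Prod.dist_eq, max_lt_iff, dist_self, dist_zero_right,
      Real.norm_eq_abs]
    exact ⟨this.1, hε, this.2, hε⟩
  have hflowS : ∀ q ∈ S, (φ (ι q)).1 ∈ O ∧ φ (ι (0, q.2)) = (y₀, q.2, U₀) ∧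
      HasDerivAt (fun t => φ (ι (t, q.2))) (W (φ (ι q))) q.1 :=
    fun q hq => hflow (ι q) (hιS q hq)
  have hI : ∀ q ∈ S, ∀ t ∈ Ioo (-ε) ε, (t, q.2) ∈ S := fun q hq t ht =>
    (hmemS _).2 ⟨abs_lt.2 ht, ((hmemS q).1 hq).2⟩
  have hmem : ∀ q ∈ S, q.1 ∈ Ioo (-ε) ε := fun q hq => abs_lt.1 ((hmemS q).1 hq).1
  have h0I : (0 : ℝ) ∈ Ioo (-ε) ε := ⟨by linarith, hε⟩
  -- the curve moves along a ray with constant velocity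
  have hξ : ∀ q ∈ S, (φ (ι q)).2.1 = q.2 := by
    intro q hq
    have hd : ∀ t ∈ Ioo (-ε) ε, HasDerivAt (fun t => (φ (ι (t, q.2))).2.1) 0 t := fun t ht =>
      (hflowS _ (hI q hq t ht)).2.2.snd.fst
    refine isOpen_Ioo.eqOn_of_deriv_eq (g := fun _ : ℝ => q.2) isPreconnected_Ioo
      (fun t ht => (hd t ht).differentiableAt.differentiableWithinAt)
      (differentiableOn_const _) (fun t ht => ?_) h0I ?_ (hmem q hq)
    · rw [(hd t ht).deriv, deriv_const]
    · rw [(hflowS q hq).2.1]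
  have hz : ∀ q ∈ S, (φ (ι q)).1 = y₀ + q.1 • q.2 := by
    intro q hq
    have hd : ∀ t ∈ Ioo (-ε) ε, HasDerivAt (fun t => (φ (ι (t, q.2))).1) q.2 t := fun t ht => by
      have h : HasDerivAt (fun t => (φ (ι (t, q.2))).1) (W (φ (ι (t, q.2)))).1 t :=
        (hflowS _ (hI q hq t ht)).2.2.fst
      have h2 : (W (φ (ι (t, q.2)))).1 = q.2 := hξ _ (hI q hq t ht)
      rwa [h2] at h
    have hd' : ∀ t : ℝ, HasDerivAt (fun t : ℝ => y₀ + t • q.2) q.2 t := fun t => by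
      simpa using ((hasDerivAt_id t).smul_const q.2).const_add y₀
    refine isOpen_Ioo.eqOn_of_deriv_eq (g := fun t : ℝ => y₀ + t • q.2) isPreconnected_Ioo
      (fun t ht => (hd t ht).differentiableAt.differentiableWithinAt)
      (fun t _ => (hd' t).differentiableAt.differentiableWithinAt) (fun t ht => ?_) h0I ?_
      (hmem q hq)
    · rw [(hd t ht).deriv, (hd' t).deriv]
    · rw [(hflowS q hq).2.1, zero_smul, add_zero]
  let w : ℝ × E → F := fun q => (φ (ι q)).2.2
  have hw : ContDiffOn ℝ ∞ w S :=
    (contDiff_snd.comp contDiff_snd).comp_contDiffOn (hφ.comp hι.contDiffOn hιS)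
  have hzO : ∀ q ∈ S, y₀ + q.1 • q.2 ∈ O := fun q hq => hz q hq ▸ (hflowS q hq).1
  let g : ℝ × E → F := fun q => Γ (y₀ + q.1 • q.2) q.2 (w q)
  have hwt : ∀ q ∈ S, HasDerivAt (fun t => w (t, q.2)) (g q) q.1 := by
    intro q hq
    have h : HasDerivAt (fun t => w (t, q.2)) (Γ (φ (ι q)).1 (φ (ι q)).2.1 (w q)) q.1 :=
      (hflowS q hq).2.2.snd.snd
    rwa [hz q hq, hξ q hq] at h
  have hw0 : ∀ X : E, ‖X‖ < ε → w (0, X) = U₀ := fun X hX => by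
    have hq : ((0 : ℝ), X) ∈ S := (hmemS _).2 ⟨by simpa using hε, hX⟩
    change (φ (ι (0, X))).2.2 = U₀
    rw [(hflowS _ hq).2.1]
  have hwd : ∀ q ∈ S, HasFDerivAt w (fderiv ℝ w q) q := fun q hq =>
    ((hw.contDiffAt (hS.mem_nhds hq)).differentiableAt (by simp)).hasFDerivAt
  have hg : ∀ q ∈ S, ∀ Y : E, fderiv ℝ g q (0, Y) =
      q.1 • fderiv ℝ Γ (y₀ + q.1 • q.2) Y q.2 (w q) + Γ (y₀ + q.1 • q.2) Y (w q)
        + Γ (y₀ + q.1 • q.2) q.2 (fderiv ℝ w q (0, Y)) := by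
    intro q hq Y
    have h1 := ((hasFDerivAt_fst (𝕜 := ℝ) (p := q)).smul
      (hasFDerivAt_snd (𝕜 := ℝ) (p := q))).const_add y₀
    have h2 := HasFDerivAt.comp (g := Γ) q (hΓa _ (hzO q hq)) h1
    have h3 := (h2.clm_apply (hasFDerivAt_snd (𝕜 := ℝ) (p := q))).clm_apply (hwd q hq)
    have h4 : fderiv ℝ g q = _ := h3.fderiv
    rw [h4]
    simp
    abel
  -- the derivative of the ray solution in the direction of the ray parameter
  have hkey : ∀ q ∈ S, 0 ≤ q.1 → ∀ Y : E,
      fderiv ℝ w q (0, Y) = q.1 • Γ (y₀ + q.1 • q.2) Y (w q) := by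
    rintro ⟨b, X⟩ hq hb Y
    have hin : ∀ t ∈ Icc 0 b, (t, X) ∈ S := fun t ht =>
      hI _ hq t ⟨by linarith [ht.1], ht.2.trans_lt (hmem _ hq).2⟩
    have hline : ∀ t : ℝ, HasDerivAt (fun t : ℝ => y₀ + t • X) X t := fun t => by
      simpa using ((hasDerivAt_id t).smul_const X).const_add y₀
    have hΓline : ∀ t ∈ Icc 0 b,
        HasDerivAt (fun t : ℝ => Γ (y₀ + t • X)) (fderiv ℝ Γ (y₀ + t • X) X) t := fun t ht =>
      HasFDerivAt.comp_hasDerivAt (l := Γ) t (hΓa _ (hzO _ (hin t ht))) (hline t)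
    have hZ : ∀ t ∈ Icc 0 b, HasDerivAt
        (fun t => fderiv ℝ w (t, X) (0, Y) - t • Γ (y₀ + t • X) Y (w (t, X)))
        (Γ (y₀ + t • X) X (fderiv ℝ w (t, X) (0, Y) - t • Γ (y₀ + t • X) Y (w (t, X)))) t := by
      intro t ht
      have h1 := hasDerivAt_fderiv_inr hS hw hwt (hin t ht) Y
      rw [hg _ (hin t ht)] at h1
      have h2 := (hasDerivAt_id t).smul
        (((hΓline t ht).clm_apply (hasDerivAt_const t Y)).clm_apply (hwt _ (hin t ht)))
      refine (h1.sub h2).congr_deriv ?_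
      have h3 := hflat _ (hzO _ (hin t ht)) X Y (w (t, X))
      have h4 : Γ (y₀ + t • X) Y (Γ (y₀ + t • X) X (w (t, X)))
          = fderiv ℝ Γ (y₀ + t • X) Y X (w (t, X)) + Γ (y₀ + t • X) X (Γ (y₀ + t • X) Y (w (t, X)))
            - fderiv ℝ Γ (y₀ + t • X) X Y (w (t, X)) := by
        rw [← h3]; abel
      simp only [g, id, map_zero, add_zero, one_smul, map_sub, map_smul, h4,
        smul_add, smul_sub]
      abel
    have h5 := eq_zero_of_hasDerivAt_clm (A := fun t => Γ (y₀ + t • X) X)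
      (fun t ht => ((hΓline t ht).clm_apply
        (hasDerivAt_const t X)).continuousAt.continuousWithinAt) hZ (by
        have hconst : (fun X : E => w (0, X)) =ᶠ[𝓝 X] fun _ => U₀ := by
          have : ∀ᶠ X' in 𝓝 X, ‖X'‖ < ε :=
            (continuous_norm.tendsto X).eventually (gt_mem_nhds ((hmemS _).1 hq).2)
          filter_upwards [this] with X' hX' using hw0 X' hX'
        have h6 : HasFDerivAt (fun X : E => ((0 : ℝ), X)) (ContinuousLinearMap.inr ℝ ℝ E) X :=
          hasFDerivAt_prodMk_right _ _
        have h7 := HasFDerivAt.comp (g := w) X (hwd _ (hin 0 ⟨le_rfl, hb⟩)) h6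
        have h8 := (hasFDerivAt_const (𝕜 := ℝ) U₀ X).congr_of_eventuallyEq hconst
        have h9 := DFunLike.congr_fun (h7.unique h8) Y
        simpa using h9) b ⟨hb, le_rfl⟩
    exact sub_eq_zero.1 h5
  -- the ray solution at a fixed time
  set b := ε / 2 with hb
  have hb0 : 0 < b := by positivity
  let k : E → ℝ × E := fun y => (b, b⁻¹ • (y - y₀))
  have hk : ContDiff ℝ ∞ k :=
    contDiff_const.prodMk ((contDiff_id.sub contDiff_const).const_smul b⁻¹)
  have hkS : ∀ y ∈ ball y₀ (b * ε), k y ∈ S := by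
    intro y hy
    rw [hmemS]
    refine ⟨by rw [abs_of_pos hb0]; linarith, ?_⟩
    change ‖b⁻¹ • (y - y₀)‖ < ε
    rw [norm_smul, norm_inv, Real.norm_eq_abs, abs_of_pos hb0, inv_mul_lt_iff₀ hb0, ← dist_eq_norm]
    exact hy
  have hky : ∀ y, y₀ + (k y).1 • (k y).2 = y := fun y => by
    simp only [k, smul_smul, mul_inv_cancel₀ hb0.ne', one_smul, add_sub_cancel]
  refine ⟨b * ε, fun y => w (k y), by positivity, fun y hy => ?_, hw.comp hk.contDiffOn hkS, ?_, ?_⟩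
  · rw [← hky y]; exact hzO _ (hkS y hy)
  · have hd : ∀ t ∈ Ioo (-ε) ε, HasDerivAt (fun t => w (t, (0 : E))) 0 t := fun t ht => by
      simpa [g] using hwt (t, 0) ((hmemS _).2 ⟨abs_lt.2 ht, by simpa using hε⟩)
    have h : w (b, 0) = U₀ :=
      isOpen_Ioo.eqOn_of_deriv_eq (g := fun _ : ℝ => U₀) isPreconnected_Ioo
        (fun t ht => (hd t ht).differentiableAt.differentiableWithinAt)
        (differentiableOn_const _) (fun t ht => by rw [(hd t ht).deriv, deriv_const]) h0I
        (hw0 0 (by simpa using hε)) ⟨by linarith, by linarith⟩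
    simpa [k] using h
  · intro y hy X
    have h1 : HasFDerivAt k ((0 : E →L[ℝ] ℝ).prod (b⁻¹ • ContinuousLinearMap.id ℝ E)) y :=
      (hasFDerivAt_const b y).prodMk (((hasFDerivAt_id y).sub_const y₀).const_smul b⁻¹)
    have h2 : fderiv ℝ (fun y => w (k y)) y = _ :=
      (HasFDerivAt.comp (g := w) y (hwd _ (hkS y hy)) h1).fderiv
    have h3 := hkey _ (hkS y hy) hb0.le (b⁻¹ • X)
    rw [hky] at h3
    rw [h2]
    simp only [ContinuousLinearMap.comp_apply, ContinuousLinearMap.prod_apply,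
      zero_apply, smul_apply, ContinuousLinearMap.id_apply]
    rw [h3]
    simp only [k, map_smul, smul_apply, smul_smul, mul_inv_cancel₀ hb0.ne',
      one_smul]

/-- **Poincaré lemma** for 1-forms: a closed smooth 1-form has a smooth primitive near each point.
It is the total differential equation for `(h, 1)` with `d(h, 1)(X) = (θ(X), 0)`. -/
theorem exists_primitive_of_closed {θ : E → E →L[ℝ] ℝ} {O : Set E} (hO : IsOpen O)
    (hθ : ContDiffOn ℝ ∞ θ O) (hclosed : ∀ y ∈ O, ∀ X Y : E, fderiv ℝ θ y X Y = fderiv ℝ θ y Y X)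
    {y₀ : E} (hy₀ : y₀ ∈ O) :
    ∃ (r : ℝ) (τ : E → ℝ), 0 < r ∧ ball y₀ r ⊆ O ∧ ContDiffOn ℝ ∞ τ (ball y₀ r) ∧ τ y₀ = 0 ∧
      ∀ y ∈ ball y₀ r, fderiv ℝ τ y = θ y := by
  let T : ℝ × ℝ →L[ℝ] ℝ × ℝ := (ContinuousLinearMap.snd ℝ ℝ ℝ).prod 0
  let L : (E →L[ℝ] ℝ) →L[ℝ] E →L[ℝ] (ℝ × ℝ →L[ℝ] ℝ × ℝ) :=
    (ContinuousLinearMap.smulRightL ℝ E (ℝ × ℝ →L[ℝ] ℝ × ℝ)).flip T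
  have hL : ∀ (α : E →L[ℝ] ℝ) (X : E) (p : ℝ × ℝ), L α X p = (α X * p.2, 0) := by
    intro α X p
    simp [L, T]
  have hLd : ∀ α, HasFDerivAt L L α := fun α => ContinuousLinearMap.hasFDerivAt _
  have hLc : ContDiff ℝ ∞ L := ContinuousLinearMap.contDiff _
  have hd : ∀ y ∈ O, fderiv ℝ (fun y => L (θ y)) y = L.comp (fderiv ℝ θ y) := fun y hy =>
    (HasFDerivAt.comp (g := L) y (hLd _)
      ((hθ.contDiffAt (hO.mem_nhds hy)).differentiableAt (by simp)).hasFDerivAt).fderiv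
  obtain ⟨r, U, hr, hsub, hU, hU₀, hUd⟩ := exists_solution_of_flat hO
    (Γ := fun y => L (θ y)) (hLc.comp_contDiffOn hθ) (fun y hy X Y p => by
      rw [hd y hy]
      simp [hL, hclosed y hy X Y]) hy₀ ((0, 1) : ℝ × ℝ)
  have hUa : ∀ y ∈ ball y₀ r, HasFDerivAt U (fderiv ℝ U y) y := fun y hy =>
    ((hU.contDiffAt (isOpen_ball.mem_nhds hy)).differentiableAt (by simp)).hasFDerivAt
  have h2 : ∀ y ∈ ball y₀ r, (U y).2 = 1 := by
    intro y hy
    have hd2 : ∀ z ∈ ball y₀ r, HasFDerivAt (fun z => (U z).2) (0 : E →L[ℝ] ℝ) z := by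
      intro z hz
      refine (hUa z hz).snd.congr_fderiv ?_
      ext X
      simp [hUd z hz, hL]
    have := isOpen_ball.is_const_of_fderiv_eq_zero (convex_ball y₀ r).isPreconnected
      (fun z hz => (hd2 z hz).differentiableAt.differentiableWithinAt)
      (fun z hz => (hd2 z hz).fderiv) hy (mem_ball_self hr)
    simpa [hU₀] using this
  refine ⟨r, fun y => (U y).1, hr, hsub, contDiff_fst.comp_contDiffOn hU, by simp [hU₀], ?_⟩
  intro y hy
  rw [(hUa y hy).fst.fderiv]
  ext X
  simp [hUd y hy, hL, h2 y hy]

end Frobenius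

/-! ### Local warped product coordinates -/

section WarpedChart

variable {E E' : Type} [NormedAddCommGroup E] [NormedSpace ℝ E]
  [NormedAddCommGroup E'] [InnerProductSpace ℝ E']

theorem ContDiffOn.hasFDerivAt_of_isOpen {F G : Type*} [NormedAddCommGroup F] [NormedSpace ℝ F]
    [NormedAddCommGroup G] [NormedSpace ℝ G] {f : F → G} {O : Set F} (hf : ContDiffOn ℝ ∞ f O)
    (hO : IsOpen O) {y : F} (hy : y ∈ O) : HasFDerivAt f (fderiv ℝ f y) y :=
  ((hf.contDiffAt (hO.mem_nhds hy)).differentiableAt (by simp)).hasFDerivAt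

/-- A smooth chart around `0` of `ℝ × E'` can be reparametrized to be defined on the product of an
interval with all of `E'`. -/
theorem exists_chart_prod_univ {e₀ : OpenPartialHomeomorph (ℝ × E') E} (h0 : (0, 0) ∈ e₀.source)
    (hs : ContDiffOn ℝ ∞ e₀ e₀.source) (ht : ContDiffOn ℝ ∞ e₀.symm e₀.target) :
    ∃ (ε : ℝ) (m : E' → E') (e : OpenPartialHomeomorph (ℝ × E') E), 0 < ε ∧ ContDiff ℝ ∞ m ∧
      m 0 = 0 ∧ e.source = Ioo (-ε) ε ×ˢ univ ∧ (∀ p : ℝ × E', e p = e₀ (p.1, m p.2)) ∧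
      (∀ p ∈ e.source, (p.1, m p.2) ∈ e₀.source) ∧
      e.target ⊆ e₀.target ∧ ContDiffOn ℝ ∞ e e.source ∧ ContDiffOn ℝ ∞ e.symm e.target := by
  obtain ⟨ε, hε, hball⟩ := Metric.isOpen_iff.1 e₀.open_source _ h0
  let m : OpenPartialHomeomorph E' E' := OpenPartialHomeomorph.univBall (0 : E') ε
  let k : OpenPartialHomeomorph (ℝ × E') (ℝ × E') := (OpenPartialHomeomorph.refl ℝ).prod m
  have hmball : ∀ q, m q ∈ ball (0 : E') ε := fun q => by
    rw [← OpenPartialHomeomorph.univBall_target (0 : E') hε]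
    exact m.map_source (by rw [OpenPartialHomeomorph.univBall_source]; trivial)
  have hksrc : ∀ p : ℝ × E', p ∈ Ioo (-ε) ε ×ˢ (univ : Set E') → k p ∈ e₀.source := by
    rintro ⟨t, q⟩ ⟨ht, -⟩
    apply hball
    rw [mem_ball, Prod.dist_eq, max_lt_iff, Real.dist_eq, sub_zero]
    exact ⟨abs_lt.2 ht, hmball q⟩
  have hopen : IsOpen (Ioo (-ε) ε ×ˢ (univ : Set E')) := isOpen_Ioo.prod isOpen_univ
  let e := (k.trans e₀).restrOpen _ hopen
  have hk : k.source = univ := by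
    simp [k, m]
  have hsrc : e.source = Ioo (-ε) ε ×ˢ univ := by
    rw [OpenPartialHomeomorph.restrOpen_source, OpenPartialHomeomorph.trans_source, hk, univ_inter]
    exact inter_eq_right.2 hksrc
  have he : ∀ p : ℝ × E', e p = e₀ (p.1, m p.2) := fun p => rfl
  have hm : ContDiff ℝ ∞ m := OpenPartialHomeomorph.contDiff_univBall
  refine ⟨ε, m, e, hε, hm, OpenPartialHomeomorph.univBall_apply_zero _ _, hsrc, he, ?_, ?_, ?_, ?_⟩
  · intro p hp; exact hksrc p (hsrc ▸ hp)
  · intro y hy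
    have h1 := e.map_target hy
    rw [hsrc] at h1
    rw [← e.right_inv hy, he]
    exact e₀.map_source (hksrc _ h1)
  · refine hs.comp (contDiff_fst.prodMk (hm.comp contDiff_snd)).contDiffOn fun p hp => ?_
    exact hksrc p (hsrc ▸ hp)
  · have htar : ∀ y ∈ e.target, y ∈ e₀.target ∧ (e₀.symm y).2 ∈ ball (0 : E') ε := by
      intro y hy
      have h1 : y ∈ (k.trans e₀).target := hy.1
      rw [OpenPartialHomeomorph.trans_target] at h1
      have h2 : e₀.symm y ∈ k.target := h1.2
      refine ⟨h1.1, ?_⟩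
      rw [← OpenPartialHomeomorph.univBall_target (0 : E') hε]
      exact h2.2
    have h2 : ContDiffOn ℝ ∞ e₀.symm e.target := ht.mono fun y hy => (htar y hy).1
    exact (contDiff_fst.comp_contDiffOn h2).prodMk
      ((OpenPartialHomeomorph.contDiffOn_univBall_symm).comp (contDiff_snd.comp_contDiffOn h2)
        fun y hy => (htar y hy).2)

variable [FiniteDimensional ℝ E] [FiniteDimensional ℝ E']

/-- Hyperplanes of `E` are parametrized by spaces of dimension one less. -/
theorem exists_injective_range_ker (hdim : Module.finrank ℝ E' + 1 = Module.finrank ℝ E)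
    {u : E →L[ℝ] ℝ} (hu : u ≠ 0) :
    ∃ j : E' →L[ℝ] E, Function.Injective j ∧ ∀ X, u (j X) = 0 := by
  have h1 := Module.Dual.finrank_ker_add_one_of_ne_zero (f := (u : E →ₗ[ℝ] ℝ))
    (fun h => hu (ContinuousLinearMap.coe_injective h))
  let i : E' ≃ₗ[ℝ] LinearMap.ker (u : E →ₗ[ℝ] ℝ) := LinearEquiv.ofFinrankEq _ _ (by omega)
  refine ⟨LinearMap.toContinuousLinearMap ((LinearMap.ker (u : E →ₗ[ℝ] ℝ)).subtype ∘ₗ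
    (i : E' →ₗ[ℝ] _)), ?_, ?_⟩
  · intro X Y h
    exact i.injective (Subtype.ext h)
  · intro X
    exact (i X).2

/-- Around each point there are coordinates `(t, q)` in which a unit timelike vector field with
closed metric dual is `∂/∂t`, orthogonal to the slices `t = const`: `-t` is a primitive of the
metric dual, and `q` is constant along the integral curves. -/
theorem exists_synchronous_chart (hdim : Module.finrank ℝ E' + 1 = Module.finrank ℝ E)
    {b : E → E →L[ℝ] E →L[ℝ] ℝ} {U : E → E} {O : Set E} (hO : IsOpen O)
    (hb : ContDiffOn ℝ ∞ b O) (hU : ContDiffOn ℝ ∞ U O)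
    (hunit : ∀ y ∈ O, b y (U y) (U y) = -1)
    (hclosed : ∀ y ∈ O, ∀ X Y, fderiv ℝ (fun z => b z (U z)) y X Y
      = fderiv ℝ (fun z => b z (U z)) y Y X) {y₀ : E} (hy₀ : y₀ ∈ O) :
    ∃ (ε : ℝ) (e : OpenPartialHomeomorph (ℝ × E') E), 0 < ε ∧ e.source = Ioo (-ε) ε ×ˢ univ ∧
      y₀ ∈ e.target ∧ e.target ⊆ O ∧ ContDiffOn ℝ ∞ e e.source ∧
      ContDiffOn ℝ ∞ e.symm e.target ∧
      (∀ p ∈ e.source, HasDerivAt (fun t => e (t, p.2)) (U (e p)) p.1) ∧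
      ∀ p ∈ e.source, ∀ a X, b (e p) (U (e p)) (fderiv ℝ e p (a, X)) = -a := by
  have : CompleteSpace E := FiniteDimensional.complete ℝ E
  have hu : ContDiffOn ℝ ∞ (fun z => b z (U z)) O := hb.clm_apply hU
  obtain ⟨r, τ, hr, hrO, hτ, hτ₀, hdτ⟩ := exists_primitive_of_closed hO
    (θ := fun z => -b z (U z)) hu.neg (fun y hy X Y => by
      rw [fderiv_fun_neg]
      simp only [neg_apply, hclosed y hy X Y]) hy₀
  set B := ball y₀ r with hB
  have hBo : IsOpen B := isOpen_ball
  have hyB : y₀ ∈ B := mem_ball_self hr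
  have hdτa : ∀ y ∈ B, HasFDerivAt τ (-b y (U y)) y := fun y hy => by
    rw [← hdτ y hy]; exact hτ.hasFDerivAt_of_isOpen hBo hy
  obtain ⟨φ, ε, hε, hφ, hflow⟩ := exists_smooth_flow hBo (hU.mono hrO) hyB
  have hmemball : ∀ p : ℝ × E, p ∈ ball ((0 : ℝ), y₀) ε ↔ |p.1| < ε ∧ dist p.2 y₀ < ε := by
    intro p
    rw [mem_ball, Prod.dist_eq, max_lt_iff, Real.dist_eq, sub_zero]
  have hτflow : ∀ p ∈ ball ((0 : ℝ), y₀) ε, τ (φ p) = p.1 + τ p.2 := by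
    intro p hp
    have hp' := (hmemball p).1 hp
    have hin : ∀ t ∈ Ioo (-ε) ε, (t, p.2) ∈ ball ((0 : ℝ), y₀) ε := fun t ht =>
      (hmemball _).2 ⟨abs_lt.2 ht, hp'.2⟩
    have hd : ∀ t ∈ Ioo (-ε) ε, HasDerivAt (fun t => τ (φ (t, p.2))) 1 t := by
      intro t ht
      have h1 := hflow _ (hin t ht)
      have h2 := HasFDerivAt.comp_hasDerivAt (l := τ) t (hdτa _ h1.1) h1.2.2
      refine h2.congr_deriv ?_
      rw [neg_apply, hunit _ (hrO h1.1), neg_neg]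
    have hd' : ∀ t : ℝ, HasDerivAt (fun t : ℝ => t + τ p.2) 1 t := fun t =>
      (hasDerivAt_id t).add_const _
    have h0 : (0 : ℝ) ∈ Ioo (-ε) ε := ⟨by linarith, hε⟩
    refine isOpen_Ioo.eqOn_of_deriv_eq (g := fun t : ℝ => t + τ p.2) isPreconnected_Ioo
      (fun t ht => (hd t ht).differentiableAt.differentiableWithinAt)
      (fun t _ => (hd' t).differentiableAt.differentiableWithinAt) (fun t ht => ?_) h0 ?_
      (abs_lt.1 hp'.1)
    · rw [(hd t ht).deriv, (hd' t).deriv]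
    · simp only [(hflow _ (hin 0 h0)).2.1, zero_add]
  have hu₀ : b y₀ (U y₀) ≠ 0 := fun h => by
    have := hunit y₀ hy₀
    rw [h] at this
    simp at this
  obtain ⟨j, hj, hjker⟩ := exists_injective_range_ker (E' := E') hdim hu₀
  let ψ : E' → E := fun q => y₀ + j q
  have hψ : ContDiff ℝ ∞ ψ := contDiff_const.add j.contDiff
  let S₀ : Set (ℝ × E') := (fun p => ψ p.2) ⁻¹' B
  have hS₀ : IsOpen S₀ := hBo.preimage (hψ.continuous.comp continuous_snd)
  let c : ℝ × E' → ℝ × E := fun p => (p.1 - τ (ψ p.2), ψ p.2)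
  have hc : ContDiffOn ℝ ∞ c S₀ :=
    (contDiff_fst.contDiffOn.sub (hτ.comp (hψ.comp contDiff_snd).contDiffOn
      fun p hp => hp)).prodMk (hψ.comp contDiff_snd).contDiffOn
  let S : Set (ℝ × E') := S₀ ∩ c ⁻¹' ball ((0 : ℝ), y₀) ε
  have hS : IsOpen S := hc.continuousOn.isOpen_inter_preimage hS₀ isOpen_ball
  let Φ : ℝ × E' → E := fun p => φ (c p)
  have hΦ : ContDiffOn ℝ ∞ Φ S := hφ.comp (hc.mono inter_subset_left) fun p hp => hp.2
  have hΦB : ∀ p ∈ S, Φ p ∈ B := fun p hp => (hflow _ hp.2).1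
  have hΦt : ∀ p ∈ S, HasDerivAt (fun t => Φ (t, p.2)) (U (Φ p)) p.1 := by
    intro p hp
    have h1 := (hflow _ hp.2).2.2
    have h2 := HasDerivAt.scomp p.1 h1 ((hasDerivAt_id p.1).sub_const (τ (ψ p.2)))
    rw [one_smul] at h2
    exact h2
  have hτΦ : ∀ p ∈ S, τ (Φ p) = p.1 := fun p hp => by
    rw [hτflow _ hp.2]; simp [c]
  have hΦd : ∀ p ∈ S, HasFDerivAt Φ (fderiv ℝ Φ p) p := fun p hp =>
    hΦ.hasFDerivAt_of_isOpen hS hp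
  have hΦu : ∀ p ∈ S, ∀ a X, b (Φ p) (U (Φ p)) (fderiv ℝ Φ p (a, X)) = -a := by
    intro p hp a X
    have h1 := HasFDerivAt.comp (g := τ) p (hdτa _ (hΦB p hp)) (hΦd p hp)
    have h2 : HasFDerivAt (fun p => τ (Φ p)) (ContinuousLinearMap.fst ℝ ℝ E') p :=
      hasFDerivAt_fst.congr_of_eventuallyEq (by
        filter_upwards [hS.mem_nhds hp] with q hq using hτΦ q hq)
    have h3 := DFunLike.congr_fun (h1.unique h2) (a, X)
    simp only [ContinuousLinearMap.comp_apply, neg_apply, ContinuousLinearMap.coe_fst'] at h3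
    linarith
  have hc0 : c (0, 0) = (0, y₀) := by simp [c, ψ, hτ₀]
  have h0S : ((0 : ℝ), (0 : E')) ∈ S := by
    refine ⟨?_, ?_⟩
    · simpa [S₀, ψ] using hyB
    · rw [mem_preimage, hc0]; exact mem_ball_self hε
  have hΦ0 : Φ (0, 0) = y₀ := by
    change φ (c (0, 0)) = y₀
    rw [hc0]
    exact (hflow _ (mem_ball_self hε)).2.1
  -- the derivative at the base point is `(a, X) ↦ a U + j X`
  have hΦj : ∀ X, fderiv ℝ Φ (0, 0) (0, X) = j X := by
    intro X
    have h1 : HasFDerivAt φ (fderiv ℝ φ (0, y₀)) (0, y₀) :=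
      hφ.hasFDerivAt_of_isOpen isOpen_ball (mem_ball_self hε)
    have h2 : HasFDerivAt ψ j 0 := j.hasFDerivAt.const_add y₀
    have hψ0 : ψ 0 = y₀ := by simp [ψ]
    have h3 : HasFDerivAt (fun q => τ (ψ q)) ((-b y₀ (U y₀)).comp j) 0 := by
      have := hdτa y₀ hyB
      rw [← hψ0] at this
      rw [← hψ0]
      exact this.comp 0 h2
    have h4 : HasFDerivAt (fun q : E' => c (0, q)) (((0 : E' →L[ℝ] ℝ)
        - (-b y₀ (U y₀)).comp j).prod j) 0 := ((hasFDerivAt_const (0 : ℝ) 0).sub h3).prodMk h2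
    have h5 : HasFDerivAt (fun q : E' => Φ (0, q)) _ 0 :=
      HasFDerivAt.comp (g := φ) (f := fun q : E' => c (0, q)) 0 (hc0 ▸ h1) h4
    have h6 : HasFDerivAt (fun q : E' => Φ (0, q)) _ 0 :=
      HasFDerivAt.comp (g := Φ) (f := fun q : E' => ((0 : ℝ), q)) 0 (hΦd _ h0S)
        (hasFDerivAt_prodMk_right (0 : ℝ) (0 : E'))
    have h7 := DFunLike.congr_fun (h6.unique h5) X
    have h8 : HasFDerivAt (fun y : E => φ (0, y)) _ y₀ :=
      HasFDerivAt.comp (g := φ) (f := fun y : E => ((0 : ℝ), y)) y₀ h1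
        (hasFDerivAt_prodMk_right (0 : ℝ) y₀)
    have h9 : HasFDerivAt (fun y : E => φ (0, y)) (ContinuousLinearMap.id ℝ E) y₀ := by
      refine (hasFDerivAt_id y₀).congr_of_eventuallyEq ?_
      filter_upwards [ball_mem_nhds y₀ hε] with y hy
      exact (hflow (0, y) ((hmemball _).2 ⟨by simpa using hε, hy⟩)).2.1
    have h10 := DFunLike.congr_fun (h8.unique h9) (j X)
    simp only [ContinuousLinearMap.comp_apply, ContinuousLinearMap.inr_apply,
      ContinuousLinearMap.id_apply] at h10
    simpa [hc0, hjker, h10] using h7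
  have hinj : Function.Injective (fderiv ℝ Φ (0, 0)) := by
    rw [injective_iff_map_eq_zero]
    rintro ⟨a, X⟩ h
    have h1 := hΦu _ h0S a X
    rw [h, map_zero] at h1
    have ha : a = 0 := by linarith
    subst ha
    rw [hΦj] at h
    rw [(injective_iff_map_eq_zero j).1 hj X h]
    rfl
  have hfin : Module.finrank ℝ (ℝ × E') = Module.finrank ℝ E := by
    rw [Module.finrank_prod, Module.finrank_self, ← hdim, add_comm]
  let L : (ℝ × E') ≃L[ℝ] E := (LinearEquiv.ofInjectiveOfFinrankEq
    (fderiv ℝ Φ (0, 0) : ℝ × E' →ₗ[ℝ] E) hinj hfin).toContinuousLinearEquiv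
  have hL : HasFDerivAt Φ (L : ℝ × E' →L[ℝ] E) (0, 0) := by
    refine (hΦd _ h0S).congr_fderiv ?_
    ext p <;> rfl
  obtain ⟨e₀, h0e, heS, he₀, hsymm⟩ := exists_smooth_localInverse hS hΦ h0S hL
  have he₀' : (e₀ : ℝ × E' → E) = Φ := funext he₀
  obtain ⟨ε', m, e, hε', hm, hm0, hsrc, he, hmS, htar, hes, het⟩ := exists_chart_prod_univ h0e
    (by rw [he₀']; exact hΦ.mono heS) hsymm
  have heΦ : ∀ p : ℝ × E', e p = Φ (p.1, m p.2) := fun p => by rw [he, he₀]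
  refine ⟨ε', e, hε', hsrc, ?_, ?_, hes, het, ?_, ?_⟩
  · have h1 : ((0 : ℝ), (0 : E')) ∈ e.source := by
      rw [hsrc]; exact ⟨⟨by linarith, hε'⟩, trivial⟩
    have h2 : e (0, 0) = y₀ := by rw [heΦ]; simpa [hm0] using hΦ0
    rw [← h2]; exact e.map_source h1
  · intro y hy
    have h1 := e.map_target hy
    rw [← e.right_inv hy, heΦ]
    exact hrO (hΦB _ (heS (hmS _ h1)))
  · intro p hp
    have h1 := hΦt _ (heS (hmS p hp))
    simp only [heΦ]
    exact h1
  · intro p hp a X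
    have h1 : HasFDerivAt (fun p : ℝ × E' => (p.1, m p.2)) _ p :=
      hasFDerivAt_fst.prodMk (((hm.differentiable (by simp)) p.2).hasFDerivAt.comp p
        hasFDerivAt_snd)
    have h2 := HasFDerivAt.comp (g := Φ) p (hΦd _ (heS (hmS p hp))) h1
    have h3 : HasFDerivAt e _ p := h2.congr_of_eventuallyEq (Eventually.of_forall heΦ)
    rw [h3.fderiv, heΦ]
    exact hΦu _ (heS (hmS p hp)) a (fderiv ℝ m p.2 X)

end WarpedChart

section WarpedMetric

variable {E E' : Type} [NormedAddCommGroup E] [NormedSpace ℝ E] [FiniteDimensional ℝ E]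
  [NormedAddCommGroup E'] [InnerProductSpace ℝ E'] [FiniteDimensional ℝ E']

/-- A metric with a unit timelike vector field `U` that is irrotational (its dual `u` is closed) and
satisfies `L_U b = 2φ(b + u ⊗ u)`, where `dφ` is a multiple of `u`, is locally a warped product
`-dt² + f(t)² h`. In synchronous coordinates the metric `H` of the slices satisfies
`∂_t H = 2φ(t) H`, so that all its components have the same ratio to their initial values. -/
theorem exists_warped_chart (hdim : Module.finrank ℝ E' + 1 = Module.finrank ℝ E)
    [Nontrivial E'] {b : E → E →L[ℝ] E →L[ℝ] ℝ} {U : E → E} {φ : E → ℝ} {O : Set E} (hO : IsOpen O)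
    (hb : ContDiffOn ℝ ∞ b O) (hU : ContDiffOn ℝ ∞ U O) (hφ : ContDiffOn ℝ ∞ φ O)
    (hsymm : ∀ y ∈ O, ∀ X Y, b y X Y = b y Y X)
    (hunit : ∀ y ∈ O, b y (U y) (U y) = -1)
    (hpos : ∀ y ∈ O, ∀ X, b y (U y) X = 0 → X ≠ 0 → 0 < b y X X)
    (hclosed : ∀ y ∈ O, ∀ X Y, fderiv ℝ (fun z => b z (U z)) y X Y
      = fderiv ℝ (fun z => b z (U z)) y Y X)
    (hlie : ∀ y ∈ O, ∀ X Y, fderiv ℝ b y (U y) X Y + b y (fderiv ℝ U y X) Y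
      + b y X (fderiv ℝ U y Y) = 2 * φ y * (b y X Y + b y (U y) X * b y (U y) Y))
    (hφu : ∀ y ∈ O, ∀ X, b y (U y) X = 0 → fderiv ℝ φ y X = 0) {y₀ : E} (hy₀ : y₀ ∈ O) :
    ∃ (ε : ℝ) (f : ℝ → ℝ) (h : E' → E' →L[ℝ] E' →L[ℝ] ℝ) (e : OpenPartialHomeomorph (ℝ × E') E),
      0 < ε ∧ e.source = Ioo (-ε) ε ×ˢ univ ∧ y₀ ∈ e.target ∧ e.target ⊆ O ∧
      ContDiffOn ℝ ∞ e e.source ∧ ContDiffOn ℝ ∞ e.symm e.target ∧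
      ContDiffOn ℝ ∞ f (Ioo (-ε) ε) ∧ (∀ t ∈ Ioo (-ε) ε, 0 < f t) ∧
      ContDiff ℝ ∞ h ∧ (∀ q X Y, h q X Y = h q Y X) ∧ (∀ q X, X ≠ 0 → 0 < h q X X) ∧
      ∀ p ∈ e.source, ∀ a X c Y, b (e p) (fderiv ℝ e p (a, X)) (fderiv ℝ e p (c, Y))
        = -(a * c) + f p.1 ^ 2 * h p.2 X Y := by
  obtain ⟨ε, e, hε, hsrc, hye, htar, hes, het, het', heu⟩ :=
    exists_synchronous_chart (E' := E') hdim hO hb hU hunit hclosed hy₀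
  have hso : IsOpen e.source := e.open_source
  have heO : ∀ p ∈ e.source, e p ∈ O := fun p hp => htar (e.map_source hp)
  have hed : ∀ p ∈ e.source, HasFDerivAt e (fderiv ℝ e p) p := fun p hp =>
    hes.hasFDerivAt_of_isOpen hso hp
  have hmem : ∀ t ∈ Ioo (-ε) ε, ∀ q : E', (t, q) ∈ e.source := fun t ht q => by
    rw [hsrc]; exact ⟨ht, trivial⟩
  have hmem' : ∀ p ∈ e.source, p.1 ∈ Ioo (-ε) ε := fun p hp => by
    rw [hsrc] at hp; exact hp.1
  have h0I : (0 : ℝ) ∈ Ioo (-ε) ε := ⟨by linarith, hε⟩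
  have hu0 : ∀ p ∈ e.source, ∀ X, b (e p) (U (e p)) (fderiv ℝ e p (0, X)) = 0 := fun p hp X => by
    rw [heu p hp, neg_zero]
  have he1 : ∀ p ∈ e.source, fderiv ℝ e p (1, 0) = U (e p) := by
    intro p hp
    have hline : HasDerivAt (fun t : ℝ => (t, p.2)) ((1 : ℝ), (0 : E')) p.1 :=
      (hasDerivAt_id p.1).prodMk (hasDerivAt_const p.1 p.2)
    exact (HasFDerivAt.comp_hasDerivAt (l := e) p.1 (hed p hp) hline).unique (het' p hp)
  have hinj : ∀ p ∈ e.source, ∀ X : E', X ≠ 0 → fderiv ℝ e p (0, X) ≠ 0 := by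
    intro p hp X hX h0
    have h1 := het.hasFDerivAt_of_isOpen e.open_target (e.map_source hp)
    have h2 := HasFDerivAt.comp (g := e.symm) p h1 (hed p hp)
    have h3 : HasFDerivAt (fun q => e.symm (e q)) (ContinuousLinearMap.id ℝ (ℝ × E')) p := by
      refine (hasFDerivAt_id p).congr_of_eventuallyEq ?_
      filter_upwards [hso.mem_nhds hp] with q hq using e.left_inv hq
    have h4 := DFunLike.congr_fun (h2.unique h3) ((0 : ℝ), X)
    rw [ContinuousLinearMap.comp_apply, h0, map_zero] at h4
    exact hX (congrArg Prod.snd h4).symm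
  -- the metric of the slices
  let H : ℝ × E' → E' → E' → ℝ := fun p X Y => b (e p) (fderiv ℝ e p (0, X)) (fderiv ℝ e p (0, Y))
  have hHpos : ∀ p ∈ e.source, ∀ X, X ≠ 0 → 0 < H p X X := fun p hp X hX =>
    hpos _ (heO p hp) _ (hu0 p hp X) (hinj p hp X hX)
  have hHt : ∀ p ∈ e.source, ∀ X Y,
      HasDerivAt (fun t => H (t, p.2) X Y) (2 * φ (e p) * H p X Y) p.1 := by
    intro p hp X Y
    have hD : ∀ X : E', HasDerivAt (fun t => fderiv ℝ e (t, p.2) (0, X))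
        (fderiv ℝ U (e p) (fderiv ℝ e p (0, X))) p.1 := by
      intro X
      have h1 := hasDerivAt_fderiv_inr hso hes (g := fun p => U (e p)) het' hp X
      have h2 : fderiv ℝ (fun p => U (e p)) p = _ :=
        (HasFDerivAt.comp (g := U) p (hU.hasFDerivAt_of_isOpen hO (heO p hp)) (hed p hp)).fderiv
      rwa [h2] at h1
    have h1 : HasDerivAt (fun t => b (e (t, p.2))) (fderiv ℝ b (e p) (U (e p))) p.1 :=
      HasFDerivAt.comp_hasDerivAt (l := b) p.1 (hb.hasFDerivAt_of_isOpen hO (heO p hp))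
        (het' p hp)
    refine ((h1.clm_apply (hD X)).clm_apply (hD Y)).congr_deriv ?_
    have h2 := hlie _ (heO p hp) (fderiv ℝ e p (0, X)) (fderiv ℝ e p (0, Y))
    rw [hu0 p hp X, zero_mul, add_zero] at h2
    simpa using h2
  -- the expansion rate depends on the time only
  have hφt : ∀ t ∈ Ioo (-ε) ε, ∀ q : E', φ (e (t, q)) = φ (e (t, 0)) := by
    intro t ht q
    have hd : ∀ q : E', HasFDerivAt (fun q => φ (e (t, q))) (0 : E' →L[ℝ] ℝ) q := by
      intro q
      have h1 : HasFDerivAt (fun q : E' => e (t, q)) _ q :=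
        HasFDerivAt.comp (g := e) q (hed _ (hmem t ht q)) (hasFDerivAt_prodMk_right t q)
      have h2 := HasFDerivAt.comp (g := φ) q
        (hφ.hasFDerivAt_of_isOpen hO (heO _ (hmem t ht q))) h1
      refine h2.congr_fderiv ?_
      ext X
      exact hφu _ (heO _ (hmem t ht q)) _ (hu0 _ (hmem t ht q) X)
    exact is_const_of_fderiv_eq_zero (𝕜 := ℝ) (fun q => (hd q).differentiableAt)
      (fun q => (hd q).fderiv) q 0
  obtain ⟨X₀, hX₀⟩ := exists_ne (0 : E')
  let F : ℝ → ℝ := fun t => H (t, 0) X₀ X₀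
  have hF : ∀ t ∈ Ioo (-ε) ε, 0 < F t := fun t ht => hHpos _ (hmem t ht 0) X₀ hX₀
  have hHF : ∀ p ∈ e.source, ∀ X Y, H p X Y = F p.1 / F 0 * H (0, p.2) X Y := by
    intro p hp X Y
    have hd : ∀ t ∈ Ioo (-ε) ε, HasDerivAt (fun t => H (t, p.2) X Y / F t) 0 t := by
      intro t ht
      refine ((hHt _ (hmem t ht p.2) X Y).div (hHt _ (hmem t ht 0) X₀ X₀) (hF t ht).ne').congr_deriv
        ?_
      rw [hφt t ht p.2]
      have := (hF t ht).ne'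
      simp only [F] at this
      field_simp
      ring
    have h1 : H (p.1, p.2) X Y / F p.1 = H (0, p.2) X Y / F 0 :=
      isOpen_Ioo.is_const_of_deriv_eq_zero isPreconnected_Ioo
        (fun t ht => (hd t ht).differentiableAt.differentiableWithinAt)
        (fun t ht => (hd t ht).deriv) (hmem' p hp) h0I
    have hF1 := (hF _ (hmem' p hp)).ne'
    have h2 : H p X Y = H (0, p.2) X Y / F 0 * F p.1 := (div_eq_iff hF1).1 h1
    rw [h2]; ring
  have hDs : ContDiffOn ℝ ∞ (fderiv ℝ e) e.source := hes.fderiv_of_isOpen hso (by simp)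
  have hHs : ∀ X Y, ContDiffOn ℝ ∞ (fun p => H p X Y) e.source := fun X Y =>
    ((hb.comp hes heO).clm_apply (hDs.clm_apply contDiffOn_const)).clm_apply
      (hDs.clm_apply contDiffOn_const)
  have hFs : ContDiffOn ℝ ∞ F (Ioo (-ε) ε) :=
    (hHs X₀ X₀).comp (contDiff_id.prodMk contDiff_const).contDiffOn fun t ht => hmem t ht 0
  let J : E' → E' →L[ℝ] E := fun q => (fderiv ℝ e (0, q)).comp (ContinuousLinearMap.inr ℝ ℝ E')
  let h : E' → E' →L[ℝ] E' →L[ℝ] ℝ := fun q => (b (e (0, q))).bilinearComp (J q) (J q)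
  have hh : ∀ q X Y, h q X Y = H (0, q) X Y := fun q X Y => rfl
  refine ⟨ε, fun t => Real.sqrt (F t / F 0), h, e, hε, hsrc, hye, htar, hes, het, ?_, ?_, ?_, ?_,
    ?_, ?_⟩
  · exact (hFs.div_const _).sqrt fun t ht => (div_pos (hF t ht) (hF 0 h0I)).ne'
  · exact fun t ht => Real.sqrt_pos.2 (div_pos (hF t ht) (hF 0 h0I))
  · refine contDiff_clm_apply_iff.2 fun X => contDiff_clm_apply_iff.2 fun Y => ?_
    simp only [hh]
    rw [← contDiffOn_univ]
    exact (hHs X Y).comp (contDiff_const.prodMk contDiff_id).contDiffOn fun q _ => hmem 0 h0I q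
  · intro q X Y
    exact hsymm _ (heO _ (hmem 0 h0I q)) _ _
  · intro q X hX
    exact hHpos _ (hmem 0 h0I q) X hX
  · intro p hp a X c Y
    have hsplit : ∀ (a : ℝ) (X : E'), fderiv ℝ e p (a, X)
        = a • U (e p) + fderiv ℝ e p (0, X) := by
      intro a X
      rw [← he1 p hp, ← map_smul, ← map_add]
      simp
    have h1 : b (e p) (fderiv ℝ e p (0, X)) (U (e p)) = 0 := by
      rw [hsymm _ (heO p hp)]; exact hu0 p hp X
    have h2 : b (e p) (fderiv ℝ e p (0, X)) (fderiv ℝ e p (0, Y))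
        = F p.1 / F 0 * h p.2 X Y := hHF p hp X Y
    rw [hsplit a X, hsplit c Y, Real.sq_sqrt (div_pos (hF _ (hmem' p hp)) (hF 0 h0I)).le]
    simp only [map_add, map_smul, add_apply, smul_apply, smul_eq_mul, hunit _ (heO p hp),
      hu0 p hp Y, h1, h2]
    ring

end WarpedMetric

/-! ### The algebra of the curvature condition -/

namespace Spacetime

section Algebra

variable {n : ℕ}

/-- The contraction `g^{hk} T_{hk}` of a covariant 2-tensor. -/
def contract (gi : Fin n → Fin n → ℝ) (T : Fin n → Fin n → ℝ) : ℝ :=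
  ∑ h, ∑ k, gi h k * T h k

/-- The Kulkarni–Nomizu product of `g` and `T`, with the sign of a curvature tensor `R_{hijk}`. -/
def kulkarni (g : Fin n → Fin n → ℝ) (T : Fin n → Fin n → ℝ) (h i j k : Fin n) : ℝ :=
  g h k * T i j - g h j * T i k + g i j * T h k - g i k * T h j

variable {g gi : Fin n → Fin n → ℝ}

theorem contract_add (S T : Fin n → Fin n → ℝ) :
    contract gi (fun h k => S h k + T h k) = contract gi S + contract gi T := by
  simp only [contract, mul_add, Finset.sum_add_distrib]

theorem contract_sub (S T : Fin n → Fin n → ℝ) :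
    contract gi (fun h k => S h k - T h k) = contract gi S - contract gi T := by
  simp only [contract, mul_sub, Finset.sum_sub_distrib]

theorem contract_mul (c : ℝ) (T : Fin n → Fin n → ℝ) :
    contract gi (fun h k => c * T h k) = c * contract gi T := by
  simp only [contract, Finset.mul_sum, mul_left_comm]

theorem contract_congr {S T : Fin n → Fin n → ℝ} (h : ∀ i j, S i j = T i j) :
    contract gi S = contract gi T := by
  rw [show S = T from funext fun i => funext (h i)]

theorem contract_swap (hi : ∀ i j, gi i j = gi j i) (T : Fin n → Fin n → ℝ) :
    contract gi (fun h k => T k h) = contract gi T := by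
  rw [contract, Finset.sum_comm]
  exact Finset.sum_congr rfl fun i _ => Finset.sum_congr rfl fun j _ => by rw [hi]

theorem contract_metric_right (hgi : ∀ i j, ∑ k, gi i k * g k j = if i = j then 1 else 0)
    (a : Fin n → ℝ) (j : Fin n) : contract gi (fun h k => a h * g k j) = a j := by
  have : ∀ h, ∑ k, gi h k * (a h * g k j) = if h = j then a h else 0 := fun h => by
    rw [← mul_boole, ← hgi, Finset.mul_sum]
    exact Finset.sum_congr rfl fun k _ => by ring
  simp [contract, this]

theorem contract_metric_left (hi : ∀ i j, gi i j = gi j i)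
    (hgi : ∀ i j, ∑ k, gi i k * g k j = if i = j then 1 else 0) (a : Fin n → ℝ) (j : Fin n) :
    contract gi (fun h k => a k * g h j) = a j := by
  rw [contract_swap hi (fun h k => a h * g k j), contract_metric_right hgi]

theorem contract_metric (hg : ∀ i j, g i j = g j i)
    (hgi : ∀ i j, ∑ k, gi i k * g k j = if i = j then 1 else 0) :
    contract gi (fun h k => g h k) = n := by
  have : ∀ h, ∑ k, gi h k * g h k = 1 := fun h => by
    have h1 := hgi h h
    rw [if_pos rfl] at h1
    rw [← h1]
    exact Finset.sum_congr rfl fun k _ => by rw [hg h k]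
  simp [contract, this]

theorem contract_kulkarni (hg : ∀ i j, g i j = g j i) (hi : ∀ i j, gi i j = gi j i)
    (hgi : ∀ i j, ∑ k, gi i k * g k j = if i = j then 1 else 0)
    (T : Fin n → Fin n → ℝ) (i j : Fin n) :
    contract gi (fun h k => kulkarni g T h i j k) = (n - 2) * T i j + g i j * contract gi T := by
  have : ∀ h k, kulkarni g T h i j k
      = T i j * g h k - T i k * g h j + g i j * T h k - T h j * g k i := fun h k => by
    rw [kulkarni, hg i k]; ring
  rw [contract_congr this, contract_sub, contract_add, contract_sub, contract_mul, contract_mul,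
    contract_metric hg hgi, contract_metric_left hi hgi, contract_metric_right hgi]
  ring

/-- The first Bianchi identity forces the 2-tensor of a Kulkarni–Nomizu product to be symmetric. -/
theorem symm_of_kulkarni_bianchi (hn : 3 ≤ n) (hg : ∀ i j, g i j = g j i)
    (hi : ∀ i j, gi i j = gi j i) (hgi : ∀ i j, ∑ k, gi i k * g k j = if i = j then 1 else 0)
    {T : Fin n → Fin n → ℝ}
    (hB : ∀ h i j k, kulkarni g T h i j k + kulkarni g T h j k i + kulkarni g T h k i j = 0)
    (i j : Fin n) : T i j = T j i := by
  have h1 : ∀ h k, (T i j - T j i) * g h k + ((T j k - T k j) * g h i - (T i k - T k i) * g h j)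
      = 0 := by
    intro h k
    have := hB h i j k
    simp only [kulkarni] at this
    rw [hg j i, hg k i, hg k j] at this
    linear_combination this
  have h2 := contract_congr (gi := gi) h1
  rw [contract_add, contract_sub, contract_mul, contract_metric hg hgi,
    contract_metric_left hi hgi (fun k => T j k - T k j),
    contract_metric_left hi hgi (fun k => T i k - T k i)] at h2
  have h3 : contract gi (fun _ _ => (0 : ℝ)) = 0 := by simp [contract]
  have hn' : (3 : ℝ) ≤ n := by exact_mod_cast hn
  rw [h3] at h2
  have h4 : ((n : ℝ) - 2) * (T i j - T j i) = 0 := by linear_combination h2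
  rcases mul_eq_zero.1 h4 with h | h <;> linarith

/-- For `n ≥ 4`, the contracted second Bianchi identity for a Kulkarni–Nomizu product `g ∧ T` says
that `T` is a Codazzi tensor; `D i j l` stands for `T_{ij,l}`. -/
theorem codazzi_of_kulkarni_bianchi (hn : 4 ≤ n) (hg : ∀ i j, g i j = g j i)
    (hi : ∀ i j, gi i j = gi j i) (hgi : ∀ i j, ∑ k, gi i k * g k j = if i = j then 1 else 0)
    {D : Fin n → Fin n → Fin n → ℝ}
    (hB : ∀ h i j k l, kulkarni g (fun a b => D a b l) h i j k
      + kulkarni g (fun a b => D a b j) h i k l + kulkarni g (fun a b => D a b k) h i l j = 0)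
    (i j l : Fin n) : D i j l = D i l j := by
  obtain ⟨C, hCD⟩ : ∃ C : Fin n → Fin n → Fin n → ℝ, ∀ i j l, C i j l = D i j l - D i l j :=
    ⟨_, fun _ _ _ => rfl⟩
  obtain ⟨c, hc⟩ : ∃ c : Fin n → ℝ, ∀ l, c l = contract gi fun h k => C h k l := ⟨_, fun _ => rfl⟩
  have h0 : contract gi (fun _ _ => (0 : ℝ)) = 0 := by simp [contract]
  have hC : ∀ i j l, C i j l = -C i l j := fun i j l => by rw [hCD, hCD]; ring
  have h1 : ∀ i j l, ((n : ℝ) - 3) * C i j l = g i l * c j - g i j * c l := by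
    intro i j l
    have e : ∀ h k, C i j l * g h k - C i k l * g h j + C i k j * g h l - (C h j l * g k i
        + g i j * -C h k l + g i l * C h k j) = 0 := by
      intro h k
      have := hB h i j k l
      simp only [kulkarni] at this
      rw [hg i k] at this
      simp only [hCD]
      linear_combination this
    have := contract_congr (gi := gi) e
    have e3 : contract gi (fun h k => -C h k l) = -c l := by
      rw [contract_congr (T := fun h k => (-1 : ℝ) * C h k l) (fun h k => by ring), contract_mul,
        ← hc]
      ring
    rw [h0, contract_sub, contract_add, contract_sub, contract_add, contract_add, contract_mul,
      contract_mul, contract_mul, contract_metric hg hgi,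
      contract_metric_left hi hgi (fun k => C i k l),
      contract_metric_left hi hgi (fun k => C i k j),
      contract_metric_right hgi (fun h => C h j l), e3] at this
    have h2 := hC i l j
    rw [← hc] at this
    linear_combination this - h2
  have hn' : (4 : ℝ) ≤ n := by exact_mod_cast hn
  have h2 : ∀ l, c l = 0 := by
    intro l
    have e := contract_congr (gi := gi) fun i j => h1 i j l
    rw [contract_mul, contract_sub] at e
    have e1 : contract gi (fun i j => g i l * c j) = c l := by
      rw [contract_congr (T := fun i j => c j * g i l) (fun i j => mul_comm _ _),
        contract_metric_left hi hgi]
    have e2 : contract gi (fun i j => g i j * c l) = n * c l := by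
      rw [contract_congr (T := fun i j => c l * g i j) (fun i j => mul_comm _ _), contract_mul,
        contract_metric hg hgi, mul_comm]
    rw [e1, e2] at e
    rw [← hc] at e
    have h4 : (2 * (n : ℝ) - 4) * c l = 0 := by linear_combination e
    rcases mul_eq_zero.1 h4 with h | h
    · linarith
    · exact h
  have h3 := h1 i j l
  rw [h2, h2, mul_zero, mul_zero, sub_zero] at h3
  rcases mul_eq_zero.1 h3 with h | h
  · linarith
  · rw [hCD] at h; linarith

/-- The right-hand side of the pseudosymmetry condition satisfies the second Bianchi identity when
the curvature tensor is a Kulkarni–Nomizu product. -/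
theorem kulkarni_bianchi_of_pseudosymmetric (hg : ∀ i j, g i j = g j i) {v : Fin n → ℝ}
    {P : Fin n → Fin n → ℝ} (hP : ∀ i j, P i j = P j i) {D : Fin n → Fin n → Fin n → ℝ}
    (hps : ∀ h i j k l, kulkarni g (fun a b => D a b l) h i j k =
      2 * v l * kulkarni g P h i j k + v h * kulkarni g P l i j k + v i * kulkarni g P h l j k
        + v j * kulkarni g P h i l k + v k * kulkarni g P h i j l) (h i j k l : Fin n) :
    kulkarni g (fun a b => D a b l) h i j k + kulkarni g (fun a b => D a b j) h i k l
      + kulkarni g (fun a b => D a b k) h i l j = 0 := by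
  rw [hps, hps, hps]
  simp only [kulkarni]
  simp only [hg l k, hg l j, hg k j, hP l k, hP l j, hP k j]
  ring

/-- **Algebraic core.** At a point, let `P` be the Schouten tensor of a conformally flat
pseudosymmetric metric with associated covector `v`, and `D i j l = P_{ij,l}`. If `v` is not null,
then `P = α v ⊗ v + β g`, and `P_{ij,l}` is determined by `α`, `β` and `v`. -/
theorem schouten_eq_of_pseudosymmetric (hn : 3 ≤ n) (hg : ∀ i j, g i j = g j i)
    (hi : ∀ i j, gi i j = gi j i) (hgi : ∀ i j, ∑ k, gi i k * g k j = if i = j then 1 else 0)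
    {v : Fin n → ℝ} {P : Fin n → Fin n → ℝ}
    (hP : ∀ i j, P i j = P j i) {D : Fin n → Fin n → Fin n → ℝ}
    (hps : ∀ h i j k l, kulkarni g (fun a b => D a b l) h i j k =
      2 * v l * kulkarni g P h i j k + v h * kulkarni g P l i j k + v i * kulkarni g P h l j k
        + v j * kulkarni g P h i l k + v k * kulkarni g P h i j l)
    (hcot : n = 3 → ∀ i j l, D i j l = D i l j) {q p lam α β : ℝ}
    (hq : q = contract gi fun h k => v h * v k) (hq0 : q ≠ 0) (hp : p = contract gi P)
    (hlam : q * lam = contract gi fun a b => v a * contract gi fun h k => v h * P b k)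
    (hβ : ((n : ℝ) - 1) * β = p - lam) (hα : α * q = lam - β) :
    (∀ i j, P i j = α * (v i * v j) + β * g i j) ∧
      ∀ i j l, D i j l = 4 * α * (v i * v j * v l)
        + 2 * β * (v l * g i j + v i * g l j + v j * g i l) := by
  have hn' : (3 : ℝ) ≤ n := by exact_mod_cast hn
  have h0 : contract gi (fun _ _ => (0 : ℝ)) = 0 := by simp [contract]
  have hcod : ∀ i j l, D i j l = D i l j := by
    rcases Nat.eq_or_lt_of_le hn with h | h
    · exact hcot h.symm
    · exact codazzi_of_kulkarni_bianchi h hg hi hgi (kulkarni_bianchi_of_pseudosymmetric hg hP hps)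
  obtain ⟨w, hw⟩ : ∃ w : Fin n → ℝ, ∀ i, w i = contract gi fun h k => v h * P i k :=
    ⟨_, fun _ => rfl⟩
  have hw' : ∀ i, contract gi (fun h k => v k * P h i) = w i := fun i => by
    rw [hw, ← contract_swap hi]
    exact contract_congr fun h k => by rw [hP]
  have hlam' : q * lam = contract gi fun a b => v a * w b := by
    rw [hlam]; exact contract_congr fun a b => by rw [hw]
  obtain ⟨t, ht⟩ : ∃ t : Fin n → ℝ, ∀ l, t l = contract gi fun a b => D a b l := ⟨_, fun _ => rfl⟩
  -- contraction of the pseudosymmetry condition over the first and the fourth index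
  have T1 : ∀ i j l, ((n : ℝ) - 2) * D i j l + g i j * t l =
      2 * v l * ((n - 2) * P i j + g i j * p)
        + (v l * P i j - w i * g l j + g i j * w l - v i * P l j)
        + v i * ((n - 2) * P l j + g l j * p) + v j * ((n - 2) * P i l + g i l * p)
        + (v l * P i j - v j * P i l + g i j * w l - g i l * w j) := by
    intro i j l
    have e := contract_congr (gi := gi) fun h k => hps h i j k l
    rw [contract_add, contract_add, contract_add, contract_add, contract_mul, contract_mul,
      contract_mul, contract_kulkarni hg hi hgi, contract_kulkarni hg hi hgi,
      contract_kulkarni hg hi hgi, contract_kulkarni hg hi hgi, ← ht, ← hp] at e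
    have e1 : contract gi (fun h k => v h * kulkarni g P l i j k)
        = v l * P i j - w i * g l j + g i j * w l - v i * P l j := by
      have : ∀ h k, v h * kulkarni g P l i j k = P i j * (v h * g k l) - g l j * (v h * P i k)
          + g i j * (v h * P l k) - P l j * (v h * g k i) := fun h k => by
        rw [kulkarni, hg l k, hg i k]; ring
      rw [contract_congr this, contract_sub, contract_add, contract_sub, contract_mul, contract_mul,
        contract_mul, contract_mul, contract_metric_right hgi, contract_metric_right hgi,
        ← hw, ← hw]
      ring
    have e2 : contract gi (fun h k => v k * kulkarni g P h i j l)
        = v l * P i j - v j * P i l + g i j * w l - g i l * w j := by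
      have : ∀ h k, v k * kulkarni g P h i j l = P i j * (v k * g h l) - P i l * (v k * g h j)
          + g i j * (v k * P h l) - g i l * (v k * P h j) := fun h k => by
        rw [kulkarni]; ring
      rw [contract_congr this, contract_sub, contract_add, contract_sub, contract_mul, contract_mul,
        contract_mul, contract_mul, contract_metric_left hi hgi, contract_metric_left hi hgi,
        hw', hw']
      ring
    rw [e1, e2] at e
    exact e
  have T2 : ∀ l, ((n : ℝ) - 1) * t l = 2 * n * p * v l + 2 * (n - 2) * w l := by
    intro l
    have : ∀ i j, ((n : ℝ) - 2) * D i j l + t l * g i j =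
        (2 * v l * (n - 2) + 2 * v l) * P i j + (2 * v l * p + 2 * w l) * g i j
        - w i * g j l + (n - 3) * (v i * P l j) + p * (v i * g j l)
        + (n - 3) * (v j * P i l) + p * (v j * g i l) - w j * g i l := by
      intro i j
      rw [mul_comm (t l), T1, hg l j]; ring
    have e := contract_congr (gi := gi) this
    rw [contract_add, contract_sub, contract_add, contract_add, contract_add, contract_add,
      contract_sub, contract_add] at e
    simp only [contract_mul] at e
    rw [contract_metric hg hgi, contract_metric_right hgi, contract_metric_right hgi,
      contract_metric_left hi hgi, contract_metric_left hi hgi, hw', ← hw, ← ht, ← hp] at e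
    linear_combination e / 2
  -- the Codazzi equation for `P`
  have hE : ∀ i j l, (((n : ℝ) - 1) * P i j) * v l - (((n : ℝ) - 1) * v j) * P i l
      + (w l * g i j - (p * g i j) * v l) - (w j - p * v j) * g i l = 0 := by
    intro i j l
    have e1 := T1 i j l
    have e2 := T1 i l j
    rw [hcod i l j] at e2
    rw [hP j l, hg j l] at e2
    have h1 : ((n : ℝ) + 1) * ((((n : ℝ) - 1) * P i j) * v l - (((n : ℝ) - 1) * v j) * P i l
      + (w l * g i j - (p * g i j) * v l) - (w j - p * v j) * g i l) = 0 := by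
      rw [hg l j, hP l j] at *
      linear_combination ((n : ℝ) - 1) * (e2 - e1) + g i j * T2 l - g i l * T2 j
    rcases mul_eq_zero.1 h1 with h | h
    · linarith
    · exact h
  have hF : ∀ i j, ((n : ℝ) - 1) * P i j * q - ((n : ℝ) - 1) * v j * w i
      + (q * lam - p * q) * g i j - (w j - p * v j) * v i = 0 := by
    intro i j
    have : ∀ a l, (((n : ℝ) - 1) * P i j - p * g i j) * (v a * v l)
        - (((n : ℝ) - 1) * v j) * (v a * P i l)
        + g i j * (v a * w l) - (w j - p * v j) * (v a * g l i) = 0 := fun a l => by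
      rw [hg l i]; linear_combination v a * hE i j l
    have e := contract_congr (gi := gi) this
    rw [contract_sub, contract_add, contract_sub, contract_mul, contract_mul, contract_mul,
      contract_mul, contract_metric_right hgi, ← hq, ← hw, ← hlam', h0] at e
    linear_combination e
  have hvw : ∀ i j, v i * w j = v j * w i := by
    intro i j
    have e1 := hF i j
    have e2 := hF j i
    rw [hP j i, hg j i] at e2
    have h1 : ((n : ℝ) - 2) * (v i * w j - v j * w i) = 0 := by linear_combination e1 - e2
    rcases mul_eq_zero.1 h1 with h | h <;> linarith
  have hwv : ∀ j, w j = lam * v j := by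
    intro j
    have : ∀ a i, w j * (v a * v i) = v j * (v a * w i) := fun a i => by
      linear_combination v a * hvw i j
    have e := contract_congr (gi := gi) this
    rw [contract_mul, contract_mul, ← hq, ← hlam'] at e
    have h1 : q * (w j - lam * v j) = 0 := by linear_combination e
    rcases mul_eq_zero.1 h1 with h | h
    · exact absurd h hq0
    · linarith
  have hlamα : lam = α * q + β := by linarith
  have hpα : p = α * q + n * β := by linarith
  have hPα : ∀ i j, P i j = α * (v i * v j) + β * g i j := by
    intro i j
    have e := hF i j
    rw [hwv, hwv, hlamα, hpα] at e
    have h1 : (((n : ℝ) - 1) * q) * (P i j - (α * (v i * v j) + β * g i j)) = 0 := by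
      linear_combination e
    rcases mul_eq_zero.1 h1 with h | h
    · rcases mul_eq_zero.1 h with h | h
      · linarith
      · exact absurd h hq0
    · linarith
  refine ⟨hPα, fun i j l => ?_⟩
  have e := T1 i j l
  have e2 := T2 l
  rw [hwv l, hlamα, hpα] at e2
  rw [hPα, hPα, hPα, hwv i, hwv j, hwv l, hlamα, hpα] at e
  have h1 : (((n : ℝ) - 1) * (n - 2)) * (D i j l - (4 * α * (v i * v j * v l)
        + 2 * β * (v l * g i j + v i * g l j + v j * g i l))) = 0 := by
    linear_combination ((n : ℝ) - 1) * e - g i j * e2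
  rcases mul_eq_zero.1 h1 with h | h
  · rcases mul_eq_zero.1 h with h | h <;> linarith
  · linarith

/-- The differential consequences of `P = α v ⊗ v + β g` and of the formula for `P_{ij,l}`: here
`a`, `b` are the differentials of `α`, `β`, and `x i l = v_{i,l}`. -/
theorem deriv_eq_of_schouten_eq (hn : 3 ≤ n) (hg : ∀ i j, g i j = g j i)
    (hi : ∀ i j, gi i j = gi j i) (hgi : ∀ i j, ∑ k, gi i k * g k j = if i = j then 1 else 0)
    {v a b s : Fin n → ℝ}
    {x : Fin n → Fin n → ℝ} {q α β : ℝ}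
    (hq : q = contract gi fun h k => v h * v k) (hq0 : q ≠ 0)
    (hs : ∀ l, s l = contract gi fun h k => v h * x k l)
    (H : ∀ i j l, a l * (v i * v j) + α * (x i l * v j + v i * x j l) + b l * g i j =
      4 * α * (v i * v j * v l) + 2 * β * (v l * g i j + v i * g l j + v j * g i l)) :
    (∀ l, b l = 2 * β * v l) ∧ (∀ l, a l * q + 2 * α * s l = 4 * α * q * v l + 4 * β * v l) ∧
      ∀ i l, α * q * x i l = 2 * β * q * g i l + v i * (α * s l - 2 * β * v l) := by
  have hn' : (3 : ℝ) ≤ n := by exact_mod_cast hn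
  have hs' : ∀ l, contract gi (fun h k => v k * x h l) = s l := fun l => by
    rw [hs, ← contract_swap hi]
  have T : ∀ l, a l * q + 2 * α * s l + n * b l = 4 * α * q * v l + 2 * β * (n + 2) * v l := by
    intro l
    have : ∀ i j, a l * (v i * v j) + α * (v j * x i l) + α * (v i * x j l) + b l * g i j =
        (4 * α * v l) * (v i * v j) + (2 * β * v l) * g i j + (2 * β) * (v i * g j l)
          + (2 * β) * (v j * g i l) := fun i j => by
      rw [hg j l]; linear_combination H i j l
    have e := contract_congr (gi := gi) this
    simp only [contract_add, contract_mul] at e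
    rw [← hq, hs', ← hs, contract_metric hg hgi, contract_metric_right hgi,
      contract_metric_left hi hgi] at e
    linear_combination e
  have X : ∀ i l, a l * v i * q + α * (x i l * q + v i * s l) + b l * v i =
      4 * α * q * (v i * v l) + 2 * β * (2 * (v i * v l) + q * g i l) := by
    intro i l
    have : ∀ c j, (a l * v i + α * x i l) * (v c * v j) + (α * v i) * (v c * x j l)
        + b l * (v c * g j i) = (4 * α * v i * v l + 2 * β * g i l) * (v c * v j)
          + (2 * β * v l) * (v c * g j i) + (2 * β * v i) * (v c * g j l) := fun c j => by
      rw [hg j i, hg j l]; linear_combination v c * H i j l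
    have e := contract_congr (gi := gi) this
    simp only [contract_add, contract_mul] at e
    rw [← hq, ← hs, contract_metric_right hgi, contract_metric_right hgi] at e
    linear_combination e
  have Y : ∀ l, a l * q ^ 2 + 2 * α * q * s l + b l * q
      = 4 * α * q ^ 2 * v l + 6 * β * q * v l := by
    intro l
    have : ∀ c i, (a l * q + α * s l + b l) * (v c * v i) + (α * q) * (v c * x i l) =
        (4 * α * q * v l + 4 * β * v l) * (v c * v i) + (2 * β * q) * (v c * g i l) := fun c i => by
      linear_combination v c * X i l
    have e := contract_congr (gi := gi) this
    simp only [contract_add, contract_mul] at e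
    rw [← hq, ← hs, contract_metric_right hgi] at e
    linear_combination e
  have hb : ∀ l, b l = 2 * β * v l := by
    intro l
    have h1 : (((n : ℝ) - 1) * q) * (b l - 2 * β * v l) = 0 := by
      linear_combination q * T l - Y l
    rcases mul_eq_zero.1 h1 with h | h
    · rcases mul_eq_zero.1 h with h | h
      · linarith
      · exact absurd h hq0
    · linarith
  have ha : ∀ l, a l * q + 2 * α * s l = 4 * α * q * v l + 4 * β * v l := fun l => by
    linear_combination T l - n * hb l
  refine ⟨hb, ha, fun i l => ?_⟩
  linear_combination X i l - v i * ha l - v i * hb l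

end Algebra

end Spacetime

/-! ### Tensor calculus in coordinates -/

namespace Spacetime

section Calculus

variable {n : ℕ} {O : Set (Coord n)} {F F' : Coord n → ℝ} {y : Coord n}

theorem partialDeriv_congr (hO : IsOpen O) (h : ∀ z ∈ O, F z = F' z) (hy : y ∈ O) (i : Fin n) :
    partialDeriv i F y = partialDeriv i F' y := by
  have : F =ᶠ[𝓝 y] F' := by filter_upwards [hO.mem_nhds hy] with z hz using h z hz
  rw [partialDeriv, partialDeriv, this.fderiv_eq]

theorem ContDiffOn.partialDeriv (hO : IsOpen O) (hF : ContDiffOn ℝ ∞ F O) (i : Fin n) :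
    ContDiffOn ℝ ∞ (partialDeriv i F) O :=
  (hF.fderiv_of_isOpen hO (by simp)).clm_apply contDiffOn_const

theorem partialDeriv_add (hF : DifferentiableAt ℝ F y) (hF' : DifferentiableAt ℝ F' y) (i : Fin n) :
    partialDeriv i (fun z => F z + F' z) y = partialDeriv i F y + partialDeriv i F' y := by
  simp only [partialDeriv, fderiv_fun_add hF hF', add_apply]

theorem partialDeriv_sub (hF : DifferentiableAt ℝ F y) (hF' : DifferentiableAt ℝ F' y) (i : Fin n) :
    partialDeriv i (fun z => F z - F' z) y = partialDeriv i F y - partialDeriv i F' y := by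
  simp only [partialDeriv, fderiv_fun_sub hF hF', sub_apply]

theorem partialDeriv_mul (hF : DifferentiableAt ℝ F y) (hF' : DifferentiableAt ℝ F' y) (i : Fin n) :
    partialDeriv i (fun z => F z * F' z) y
      = partialDeriv i F y * F' y + F y * partialDeriv i F' y := by
  simp only [partialDeriv, fderiv_fun_mul hF hF', add_apply, smul_apply, smul_eq_mul]
  ring

theorem partialDeriv_sum {ι : Type*} (s : Finset ι) {f : ι → Coord n → ℝ}
    (hf : ∀ a ∈ s, DifferentiableAt ℝ (f a) y) (i : Fin n) :
    partialDeriv i (fun z => ∑ a ∈ s, f a z) y = ∑ a ∈ s, partialDeriv i (f a) y := by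
  simp only [partialDeriv, fderiv_fun_sum hf, sum_apply]

theorem partialDeriv_const (c : ℝ) (i : Fin n) : partialDeriv i (fun _ => c) y = 0 := by
  simp [partialDeriv]

theorem fderiv_apply_eq_sum (F : Coord n → ℝ) (y X : Coord n) :
    fderiv ℝ F y X = ∑ i, X i * partialDeriv i F y := by
  have hX : X = ∑ i, X i • EuclideanSpace.single i (1 : ℝ) := by
    ext j
    simp [Finset.sum_apply, Pi.single_apply]
  conv_lhs => rw [hX]
  simp [partialDeriv]

theorem ContDiffOn.differentiableAt_of_isOpen {f : Coord n → ℝ} (hf : ContDiffOn ℝ ∞ f O)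
    (hO : IsOpen O) (hy : y ∈ O) : DifferentiableAt ℝ f y :=
  (hf.contDiffAt (hO.mem_nhds hy)).differentiableAt (by simp)

end Calculus

section Metric

variable {n : ℕ} {O : Set (Coord n)} {G : Coord n → Matrix (Fin n) (Fin n) ℝ}

/-- The matrix of a smooth pseudo-Riemannian metric on an open set of coordinates. -/
structure IsSmoothMetric (G : Coord n → Matrix (Fin n) (Fin n) ℝ) (O : Set (Coord n)) : Prop where
  isOpen : IsOpen O
  smooth (i j : Fin n) : ContDiffOn ℝ ∞ (fun y => G y i j) O
  symm {y : Coord n} (hy : y ∈ O) (i j : Fin n) : G y i j = G y j i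
  det_ne_zero {y : Coord n} (hy : y ∈ O) : (G y).det ≠ 0

theorem contDiffOn_det {A : Coord n → Matrix (Fin n) (Fin n) ℝ}
    (hA : ∀ i j, ContDiffOn ℝ ∞ (fun y => A y i j) O) : ContDiffOn ℝ ∞ (fun y => (A y).det) O := by
  simp only [Matrix.det_apply']
  exact ContDiffOn.sum fun σ _ => contDiffOn_const.mul (contDiffOn_prod fun i _ => hA _ _)

theorem contDiffOn_inv {A : Coord n → Matrix (Fin n) (Fin n) ℝ}
    (hA : ∀ i j, ContDiffOn ℝ ∞ (fun y => A y i j) O) (hdet : ∀ y ∈ O, (A y).det ≠ 0)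
    (i j : Fin n) : ContDiffOn ℝ ∞ (fun y => (A y)⁻¹ i j) O := by
  simp only [Matrix.inv_def, Ring.inverse_eq_inv', Matrix.smul_apply, smul_eq_mul,
    Matrix.adjugate_apply]
  refine ((contDiffOn_det hA).inv hdet).mul (contDiffOn_det fun k l => ?_)
  by_cases hk : k = j
  · subst hk; simp only [Matrix.updateRow_self]; exact contDiffOn_const
  · simp only [Matrix.updateRow_ne hk]; exact hA k l

namespace IsSmoothMetric

variable (hG : IsSmoothMetric G O)
include hG

theorem inv_smooth (i j : Fin n) : ContDiffOn ℝ ∞ (fun y => (G y)⁻¹ i j) O :=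
  contDiffOn_inv hG.smooth (fun _ hy => hG.det_ne_zero hy) i j

variable {y : Coord n} (hy : y ∈ O)
include hy

theorem transpose_eq : (G y).transpose = G y := by
  ext i j; exact hG.symm hy j i

theorem inv_symm (i j : Fin n) : (G y)⁻¹ i j = (G y)⁻¹ j i := by
  have h := Matrix.transpose_nonsing_inv (G y)
  rw [hG.transpose_eq hy] at h
  exact congrFun (congrFun h.symm i) j

theorem sum_inv_mul (i j : Fin n) :
    ∑ k, (G y)⁻¹ i k * G y k j = if i = j then 1 else 0 := by
  rw [← Matrix.mul_apply, Matrix.nonsing_inv_mul _ (isUnit_iff_ne_zero.2 (hG.det_ne_zero hy)),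
    Matrix.one_apply]

theorem sum_mul_inv (i j : Fin n) :
    ∑ k, G y i k * (G y)⁻¹ k j = if i = j then 1 else 0 := by
  rw [← Matrix.mul_apply, Matrix.mul_nonsing_inv _ (isUnit_iff_ne_zero.2 (hG.det_ne_zero hy)),
    Matrix.one_apply]

theorem partialDeriv_symm (l i j : Fin n) :
    partialDeriv l (fun z => G z i j) y = partialDeriv l (fun z => G z j i) y :=
  partialDeriv_congr hG.isOpen (fun _ hz => hG.symm hz i j) hy l

theorem christoffel_symm (k i j : Fin n) : christoffel G k i j y = christoffel G k j i y := by
  rw [christoffel, christoffel]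
  congr 1
  refine Finset.sum_congr rfl fun l _ => ?_
  rw [hG.partialDeriv_symm hy l i j]
  ring

/-- The Christoffel symbols of the first kind. -/
theorem sum_mul_christoffel (m i j : Fin n) :
    ∑ k, G y m k * christoffel G k i j y = (1 / 2) * (partialDeriv i (fun z => G z j m) y
      + partialDeriv j (fun z => G z i m) y - partialDeriv m (fun z => G z i j) y) := by
  set A : Fin n → ℝ := fun l => partialDeriv i (fun z => G z j l) y
      + partialDeriv j (fun z => G z i l) y - partialDeriv l (fun z => G z i j) y with hA
  have h1 : ∀ k, G y m k * christoffel G k i j y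
      = ∑ l, (1 / 2) * A l * (G y m k * (G y)⁻¹ k l) := fun k => by
    rw [christoffel, Finset.mul_sum, Finset.mul_sum]
    exact Finset.sum_congr rfl fun l _ => by simp only [hA]; ring
  simp only [h1]
  rw [Finset.sum_comm]
  simp only [← Finset.mul_sum, hG.sum_mul_inv hy]
  simp [hA]

/-- The Levi-Civita connection is metric. -/
theorem partialDeriv_eq (l i j : Fin n) : partialDeriv l (fun z => G z i j) y
    = ∑ p, (christoffel G p l i y * G y p j + christoffel G p l j y * G y i p) := by
  have h1 := hG.sum_mul_christoffel hy j l i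
  have h2 := hG.sum_mul_christoffel hy i l j
  have h3 : ∑ p, (christoffel G p l i y * G y p j + christoffel G p l j y * G y i p)
      = ∑ k, G y j k * christoffel G k l i y + ∑ k, G y i k * christoffel G k l j y := by
    rw [← Finset.sum_add_distrib]
    exact Finset.sum_congr rfl fun p _ => by rw [hG.symm hy p j]; ring
  rw [h3, h1, h2, hG.partialDeriv_symm hy l j i, hG.partialDeriv_symm hy i l j,
    hG.partialDeriv_symm hy j l i]
  ring

omit hy in
theorem christoffel_smooth (k i j : Fin n) : ContDiffOn ℝ ∞ (christoffel G k i j) O := by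
  unfold christoffel
  refine contDiffOn_const.mul (ContDiffOn.sum fun l _ => (hG.inv_smooth k l).mul ?_)
  exact ((ContDiffOn.partialDeriv hG.isOpen (hG.smooth _ _) _).add
    (ContDiffOn.partialDeriv hG.isOpen (hG.smooth _ _) _)).sub
    (ContDiffOn.partialDeriv hG.isOpen (hG.smooth _ _) _)

omit hy in
theorem riemannUp_smooth (h i j k : Fin n) : ContDiffOn ℝ ∞ (riemannUp G h i j k) O := by
  unfold riemannUp
  refine ((ContDiffOn.partialDeriv hG.isOpen (hG.christoffel_smooth _ _ _) _).sub
    (ContDiffOn.partialDeriv hG.isOpen (hG.christoffel_smooth _ _ _) _)).add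
    (ContDiffOn.sum fun p _ => ?_)
  exact ((hG.christoffel_smooth _ _ _).mul (hG.christoffel_smooth _ _ _)).sub
    ((hG.christoffel_smooth _ _ _).mul (hG.christoffel_smooth _ _ _))

omit hy in
theorem ricci_smooth (i j : Fin n) : ContDiffOn ℝ ∞ (ricci G i j) O :=
  ContDiffOn.sum fun h _ => hG.riemannUp_smooth h i j h

omit hy in
theorem schouten_smooth (i j : Fin n) : ContDiffOn ℝ ∞ (schouten G i j) O := by
  have hS : ContDiffOn ℝ ∞ (scalarCurv G) O :=
    ContDiffOn.sum fun i _ => ContDiffOn.sum fun j _ =>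
      (hG.inv_smooth i j).mul (hG.ricci_smooth i j)
  exact contDiffOn_const.mul ((hG.ricci_smooth i j).sub ((hS.div_const _).mul (hG.smooth i j)))

/-- The first Bianchi identity. -/
theorem riemann_bianchi (h i j k : Fin n) :
    riemann G h i j k y + riemann G h j k i y + riemann G h k i j y = 0 := by
  have hup : ∀ p, riemannUp G p i j k y + riemannUp G p j k i y + riemannUp G p k i j y = 0 := by
    intro p
    have hΓ : ∀ l a b, partialDeriv l (christoffel G p a b) y
        = partialDeriv l (christoffel G p b a) y := fun l a b =>
      partialDeriv_congr hG.isOpen (fun z hz => hG.christoffel_symm hz p a b) hy l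
    simp only [riemannUp, Finset.sum_sub_distrib]
    rw [hΓ k i j, hΓ j i k, hΓ i j k]
    simp only [hG.christoffel_symm hy _ j i, hG.christoffel_symm hy _ k i,
      hG.christoffel_symm hy _ k j]
    ring
  simp only [riemann, ← Finset.sum_add_distrib, ← mul_add, hup, mul_zero, Finset.sum_const_zero]

/-- The covariant derivative of a Kulkarni–Nomizu product with the metric. -/
theorem covRiemann_eq (hR : ∀ z ∈ O, ∀ h i j k, riemann G h i j k z
      = kulkarni (fun a b => G z a b) (fun a b => schouten G a b z) h i j k) (h i j k l : Fin n) :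
    covRiemann G h i j k l y
      = kulkarni (fun a b => G y a b) (fun a b => covSchouten G a b l y) h i j k := by
  have hPd : ∀ a b, DifferentiableAt ℝ (schouten G a b) y := fun a b =>
    ContDiffOn.differentiableAt_of_isOpen (hG.schouten_smooth a b) hG.isOpen hy
  have hGd : ∀ a b, DifferentiableAt ℝ (fun z => G z a b) y := fun a b =>
    ContDiffOn.differentiableAt_of_isOpen (hG.smooth a b) hG.isOpen hy
  have hm : ∀ a b c d, partialDeriv l (fun z => G z a b * schouten G c d z) y
      = (∑ p, (christoffel G p l a y * G y p b + christoffel G p l b y * G y a p))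
          * schouten G c d y + G y a b * partialDeriv l (schouten G c d) y := fun a b c d => by
    rw [partialDeriv_mul (hGd a b) (hPd c d), hG.partialDeriv_eq hy]
  have hd : partialDeriv l (riemann G h i j k) y
      = partialDeriv l (fun z => G z h k * schouten G i j z) y
        - partialDeriv l (fun z => G z h j * schouten G i k z) y
        + partialDeriv l (fun z => G z i j * schouten G h k z) y
        - partialDeriv l (fun z => G z i k * schouten G h j z) y := by
    rw [partialDeriv_congr hG.isOpen (F' := fun z => G z h k * schouten G i j z
      - G z h j * schouten G i k z + G z i j * schouten G h k z - G z i k * schouten G h j z)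
      (fun z hz => hR z hz h i j k) hy]
    have hpd : ∀ a b c d, DifferentiableAt ℝ (fun z => G z a b * schouten G c d z) y :=
      fun a b c d => (hGd a b).mul (hPd c d)
    rw [partialDeriv_sub (((hpd h k i j).fun_sub (hpd h j i k)).fun_add (hpd i j h k))
      (hpd i k h j),
      partialDeriv_add ((hpd h k i j).fun_sub (hpd h j i k)) (hpd i j h k),
      partialDeriv_sub (hpd h k i j) (hpd h j i k)]
  have hs : ∑ p, (christoffel G p l h y * riemann G p i j k y
      + christoffel G p l i y * riemann G h p j k y
      + christoffel G p l j y * riemann G h i p k y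
      + christoffel G p l k y * riemann G h i j p y)
      = ((∑ p, (christoffel G p l h y * G y p k + christoffel G p l k y * G y h p))
          * schouten G i j y + G y h k * ∑ p, (christoffel G p l i y * schouten G p j y
            + christoffel G p l j y * schouten G i p y))
      - ((∑ p, (christoffel G p l h y * G y p j + christoffel G p l j y * G y h p))
          * schouten G i k y + G y h j * ∑ p, (christoffel G p l i y * schouten G p k y
            + christoffel G p l k y * schouten G i p y))
      + ((∑ p, (christoffel G p l i y * G y p j + christoffel G p l j y * G y i p))
          * schouten G h k y + G y i j * ∑ p, (christoffel G p l h y * schouten G p k y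
            + christoffel G p l k y * schouten G h p y))
      - ((∑ p, (christoffel G p l i y * G y p k + christoffel G p l k y * G y i p))
          * schouten G h j y + G y i k * ∑ p, (christoffel G p l h y * schouten G p j y
            + christoffel G p l j y * schouten G h p y)) := by
    simp only [Finset.mul_sum, Finset.sum_mul, ← Finset.sum_add_distrib, ← Finset.sum_sub_distrib]
    refine Finset.sum_congr rfl fun p _ => ?_
    rw [hR y hy, hR y hy, hR y hy, hR y hy]
    simp only [kulkarni]
    ring
  rw [covRiemann, hd, hs, hm, hm, hm, hm]
  simp only [kulkarni, covSchouten]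
  ring

end IsSmoothMetric

end Metric

end Spacetime

/-! ### Unit timelike torse-forming vector fields in coordinates -/

namespace Spacetime

section Forms

variable {n : ℕ} {O : Set (Coord n)} {G : Coord n → Matrix (Fin n) (Fin n) ℝ}

/-- The `i`-th standard basis vector of the coordinate space. -/
noncomputable abbrev basisVec (i : Fin n) : Coord n := EuclideanSpace.single i 1

theorem eq_sum_basisVec (X : Coord n) : X = ∑ i, X i • basisVec i := by
  ext j
  simp [basisVec, Pi.single_apply]

theorem clm_ext_basisVec {F : Type*} [NormedAddCommGroup F] [NormedSpace ℝ F]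
    {A B : Coord n →L[ℝ] F} (h : ∀ i, A (basisVec i) = B (basisVec i)) : A = B := by
  ext X
  rw [eq_sum_basisVec X]
  simp only [map_sum, map_smul, h]

/-- The scalar product with matrix `A`, as a continuous bilinear form. -/
noncomputable def bilinForm (A : Matrix (Fin n) (Fin n) ℝ) : Coord n →L[ℝ] Coord n →L[ℝ] ℝ :=
  ∑ i, ∑ j, A i j • (EuclideanSpace.proj i : Coord n →L[ℝ] ℝ).smulRight
    (EuclideanSpace.proj j : Coord n →L[ℝ] ℝ)

theorem bilinForm_apply (A : Matrix (Fin n) (Fin n) ℝ) (X Y : Coord n) :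
    bilinForm A X Y = ∑ i, ∑ j, A i j * (X i * Y j) := by
  simp [bilinForm, sum_apply]

theorem bilinForm_basisVec_right (A : Matrix (Fin n) (Fin n) ℝ) (X : Coord n) (j : Fin n) :
    bilinForm A X (basisVec j) = ∑ i, A i j * X i := by
  simp [bilinForm_apply]

theorem bilinForm_basisVec_left (A : Matrix (Fin n) (Fin n) ℝ) (Y : Coord n) (i : Fin n) :
    bilinForm A (basisVec i) Y = ∑ j, A i j * Y j := by
  rw [bilinForm_apply, Finset.sum_comm]
  simp

theorem bilinForm_basisVec (A : Matrix (Fin n) (Fin n) ℝ) (i j : Fin n) :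
    bilinForm A (basisVec i) (basisVec j) = A i j := by
  simp [bilinForm_basisVec_right]

theorem contDiffOn_bilinForm (hG : ∀ i j, ContDiffOn ℝ ∞ (fun y => G y i j) O) :
    ContDiffOn ℝ ∞ (fun y => bilinForm (G y)) O := by
  refine contDiffOn_clm_apply.2 fun X => contDiffOn_clm_apply.2 fun Y => ?_
  simp only [bilinForm_apply]
  exact ContDiffOn.sum fun i _ => ContDiffOn.sum fun j _ => (hG i j).mul contDiffOn_const

/-- The component `u_i = g_{ij} U^j` of the metric dual of a vector field. -/
noncomputable def lowered (G : Coord n → Matrix (Fin n) (Fin n) ℝ) (U : Coord n → Coord n)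
    (i : Fin n) (y : Coord n) : ℝ := ∑ j, G y i j * U y j

/-- The covariant derivative `θ_{i,l}` of a 1-form. -/
noncomputable def covForm (G : Coord n → Matrix (Fin n) (Fin n) ℝ) (θ : Fin n → Coord n → ℝ)
    (i l : Fin n) (y : Coord n) : ℝ := partialDeriv l (θ i) y - ∑ p, christoffel G p l i y * θ p y

theorem IsSmoothMetric.mono (hG : IsSmoothMetric G O) {O' : Set (Coord n)} (hO' : IsOpen O')
    (h : O' ⊆ O) : IsSmoothMetric G O' where
  isOpen := hO'
  smooth i j := (hG.smooth i j).mono h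
  symm hy := hG.symm (h hy)
  det_ne_zero hy := hG.det_ne_zero (h hy)

theorem contDiffOn_apply {U : Coord n → Coord n} (hU : ContDiffOn ℝ ∞ U O) (p : Fin n) :
    ContDiffOn ℝ ∞ (fun z => U z p) O :=
  (EuclideanSpace.proj p : Coord n →L[ℝ] ℝ).contDiff.comp_contDiffOn hU

theorem fderiv_basisVec_apply {U : Coord n → Coord n} {y : Coord n} (hU : DifferentiableAt ℝ U y)
    (l p : Fin n) : fderiv ℝ U y (basisVec l) p = partialDeriv l (fun z => U z p) y := by
  have h := ((EuclideanSpace.proj p : Coord n →L[ℝ] ℝ).hasFDerivAt.comp y hU.hasFDerivAt).fderiv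
  exact (DFunLike.congr_fun h (basisVec l)).symm

namespace IsSmoothMetric

variable (hG : IsSmoothMetric G O)
include hG

theorem lowered_smooth {U : Coord n → Coord n} (hU : ContDiffOn ℝ ∞ U O) (i : Fin n) :
    ContDiffOn ℝ ∞ (lowered G U i) O :=
  ContDiffOn.sum fun j _ => (hG.smooth i j).mul (contDiffOn_apply hU j)

variable {y : Coord n} (hy : y ∈ O)
include hy

theorem bilinForm_symm (X Y : Coord n) : bilinForm (G y) X Y = bilinForm (G y) Y X := by
  rw [bilinForm_apply, bilinForm_apply, Finset.sum_comm]
  exact Finset.sum_congr rfl fun i _ => Finset.sum_congr rfl fun j _ => by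
    rw [hG.symm hy j i]; ring

theorem bilinForm_lowered (U : Coord n → Coord n) (X : Coord n) :
    bilinForm (G y) (U y) X = ∑ i, lowered G U i y * X i := by
  rw [bilinForm_apply, Finset.sum_comm]
  refine Finset.sum_congr rfl fun i _ => ?_
  rw [lowered, Finset.sum_mul]
  exact Finset.sum_congr rfl fun j _ => by rw [hG.symm hy j i]; ring

theorem fderiv_bilinForm_apply (Z : Coord n) (i j : Fin n) :
    fderiv ℝ (fun z => bilinForm (G z)) y Z (basisVec i) (basisVec j)
      = ∑ p, Z p * partialDeriv p (fun z => G z i j) y := by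
  have hd := (contDiffOn_bilinForm hG.smooth).hasFDerivAt_of_isOpen hG.isOpen hy
  have h1 := (hd.clm_apply (hasFDerivAt_const (basisVec i) y)).clm_apply
    (hasFDerivAt_const (basisVec j) y)
  have h2 : (fun z => bilinForm (G z) (basisVec i) (basisVec j)) = fun z => G z i j :=
    funext fun z => bilinForm_basisVec _ i j
  rw [h2] at h1
  rw [← fderiv_apply_eq_sum, h1.fderiv]
  simp

theorem partialDeriv_lowered {U : Coord n → Coord n} (hU : ContDiffOn ℝ ∞ U O) (l i : Fin n) :
    partialDeriv l (lowered G U i) y = ∑ p, (partialDeriv l (fun z => G z i p) y * U y p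
      + G y i p * partialDeriv l (fun z => U z p) y) := by
  have hGd : ∀ a b, DifferentiableAt ℝ (fun z => G z a b) y := fun a b =>
    ContDiffOn.differentiableAt_of_isOpen (hG.smooth a b) hG.isOpen hy
  have hUd : ∀ p, DifferentiableAt ℝ (fun z => U z p) y := fun p =>
    ContDiffOn.differentiableAt_of_isOpen (contDiffOn_apply hU p) hG.isOpen hy
  unfold lowered
  rw [partialDeriv_sum Finset.univ (fun p _ => (hGd i p).fun_mul (hUd p))]
  exact Finset.sum_congr rfl fun p _ => partialDeriv_mul (hGd i p) (hUd p) l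

/-- The Lie derivative of the metric is the symmetrized covariant derivative of the dual form. -/
theorem lie_metric_eq {U : Coord n → Coord n} (hU : ContDiffOn ℝ ∞ U O) (i j : Fin n) :
    ∑ p, U y p * partialDeriv p (fun z => G z i j) y
      + ∑ p, G y p j * partialDeriv i (fun z => U z p) y
      + ∑ p, G y i p * partialDeriv j (fun z => U z p) y
      = covForm G (lowered G U) i j y + covForm G (lowered G U) j i y := by
  have h1 : ∑ k, christoffel G k i j y * lowered G U k y
      = ∑ m, U y m * ((1 / 2) * (partialDeriv i (fun z => G z j m) y
      + partialDeriv j (fun z => G z i m) y - partialDeriv m (fun z => G z i j) y)) := by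
    simp only [← hG.sum_mul_christoffel hy, lowered, Finset.mul_sum]
    rw [Finset.sum_comm]
    exact Finset.sum_congr rfl fun m _ => Finset.sum_congr rfl fun k _ => by
      rw [hG.symm hy k m]; ring
  have h2 : ∑ k, christoffel G k j i y * lowered G U k y
      = ∑ k, christoffel G k i j y * lowered G U k y :=
    Finset.sum_congr rfl fun k _ => by rw [hG.christoffel_symm hy k j i]
  rw [covForm, covForm, h2, h1, hG.partialDeriv_lowered hy hU, hG.partialDeriv_lowered hy hU]
  simp only [← Finset.sum_add_distrib, ← Finset.sum_sub_distrib]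
  refine Finset.sum_congr rfl fun p _ => ?_
  rw [hG.symm hy p j]
  ring

/-- The derivative of the square of a vector field. -/
theorem partialDeriv_sq_eq {U : Coord n → Coord n} (hU : ContDiffOn ℝ ∞ U O) (l : Fin n) :
    partialDeriv l (fun z => ∑ i, lowered G U i z * U z i) y
      = 2 * ∑ i, U y i * covForm G (lowered G U) i l y := by
  have hGd : ∀ a b, DifferentiableAt ℝ (fun z => G z a b) y := fun a b =>
    ContDiffOn.differentiableAt_of_isOpen (hG.smooth a b) hG.isOpen hy
  have hUd : ∀ p, DifferentiableAt ℝ (fun z => U z p) y := fun p =>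
    ContDiffOn.differentiableAt_of_isOpen (contDiffOn_apply hU p) hG.isOpen hy
  have hud : ∀ p, DifferentiableAt ℝ (lowered G U p) y := fun p =>
    ContDiffOn.differentiableAt_of_isOpen (hG.lowered_smooth hU p) hG.isOpen hy
  rw [partialDeriv_sum Finset.univ (fun p _ => (hud p).fun_mul (hUd p))]
  have h1 : ∀ i, partialDeriv l (fun z => lowered G U i z * U z i) y
      = partialDeriv l (lowered G U i) y * U y i
        + lowered G U i y * partialDeriv l (fun z => U z i) y :=
    fun i => partialDeriv_mul (hud i) (hUd i) l
  simp only [h1, Finset.sum_add_distrib]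
  -- `u_i ∂U^i` in terms of `U^i ∂u_i` and the derivative of the metric
  have h2 : ∑ i, U y i * partialDeriv l (lowered G U i) y
      = ∑ i, ∑ p, U y i * (partialDeriv l (fun z => G z i p) y * U y p)
        + ∑ i, lowered G U i y * partialDeriv l (fun z => U z i) y := by
    have e : ∑ i, lowered G U i y * partialDeriv l (fun z => U z i) y
        = ∑ i, ∑ p, U y i * (G y i p * partialDeriv l (fun z => U z p) y) := by
      simp only [lowered, Finset.sum_mul]
      rw [Finset.sum_comm]
      exact Finset.sum_congr rfl fun i _ => Finset.sum_congr rfl fun p _ => by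
        rw [hG.symm hy p i]; ring
    rw [e, ← Finset.sum_add_distrib]
    refine Finset.sum_congr rfl fun i _ => ?_
    rw [hG.partialDeriv_lowered hy hU, Finset.mul_sum, ← Finset.sum_add_distrib]
    exact Finset.sum_congr rfl fun p _ => by ring
  have h3 : ∑ i, ∑ p, U y i * (partialDeriv l (fun z => G z i p) y * U y p)
      = 2 * ∑ i, U y i * ∑ p, christoffel G p l i y * lowered G U p y := by
    have e1 : ∀ i p, U y i * (partialDeriv l (fun z => G z i p) y * U y p)
        = ∑ q, U y i * (christoffel G q l i y * G y q p * U y p)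
          + ∑ q, U y i * (christoffel G q l p y * G y i q * U y p) := fun i p => by
      rw [hG.partialDeriv_eq hy, Finset.sum_mul, Finset.mul_sum, ← Finset.sum_add_distrib]
      exact Finset.sum_congr rfl fun q _ => by ring
    have e2 : ∑ i, ∑ p, ∑ q, U y i * (christoffel G q l i y * G y q p * U y p)
        = ∑ i, U y i * ∑ p, christoffel G p l i y * lowered G U p y := by
      refine Finset.sum_congr rfl fun i _ => ?_
      rw [Finset.sum_comm, Finset.mul_sum]
      refine Finset.sum_congr rfl fun q _ => ?_
      rw [lowered, Finset.mul_sum, Finset.mul_sum]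
      exact Finset.sum_congr rfl fun p _ => by ring
    have e3 : ∑ i, ∑ p, ∑ q, U y i * (christoffel G q l p y * G y i q * U y p)
        = ∑ i, U y i * ∑ p, christoffel G p l i y * lowered G U p y := by
      rw [← e2, Finset.sum_comm]
      exact Finset.sum_congr rfl fun i _ => Finset.sum_congr rfl fun p _ =>
        Finset.sum_congr rfl fun q _ => by rw [hG.symm hy p q]; ring
    simp only [e1, Finset.sum_add_distrib]
    rw [e2, e3]; ring
  have h4 : ∑ i, partialDeriv l (lowered G U i) y * U y i
      = ∑ i, U y i * partialDeriv l (lowered G U i) y :=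
    Finset.sum_congr rfl fun i _ => mul_comm _ _
  simp only [covForm, mul_sub, Finset.sum_sub_distrib]
  rw [h4]
  linarith

omit hy in
/-- A unit timelike vector field with `u_{i,l} = φ(g_{il} + u_i u_l)`, `dφ` being a multiple of `u`,
gives local warped product coordinates. -/
theorem exists_warped_chart_of_torseForming (hn : 3 ≤ n) {U : Coord n → Coord n} {φ : Coord n → ℝ}
    (hU : ContDiffOn ℝ ∞ U O) (hφ : ContDiffOn ℝ ∞ φ O)
    (hunit : ∀ y ∈ O, ∑ i, lowered G U i y * U y i = -1)
    (hpos : ∀ y ∈ O, ∀ X, bilinForm (G y) (U y) X = 0 → X ≠ 0 → 0 < bilinForm (G y) X X)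
    (htorse : ∀ y ∈ O, ∀ i l, covForm G (lowered G U) i l y
      = φ y * (G y i l + lowered G U i y * lowered G U l y))
    (hφu : ∀ y ∈ O, ∀ X, bilinForm (G y) (U y) X = 0 → fderiv ℝ φ y X = 0) {y₀ : Coord n}
    (hy₀ : y₀ ∈ O) :
    ∃ (ε : ℝ) (f : ℝ → ℝ) (h : Coord (n - 1) → Coord (n - 1) →L[ℝ] Coord (n - 1) →L[ℝ] ℝ)
      (e : OpenPartialHomeomorph (ℝ × Coord (n - 1)) (Coord n)),
      0 < ε ∧ e.source = Ioo (-ε) ε ×ˢ univ ∧ y₀ ∈ e.target ∧ e.target ⊆ O ∧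
      ContDiffOn ℝ ∞ e e.source ∧ ContDiffOn ℝ ∞ e.symm e.target ∧
      ContDiffOn ℝ ∞ f (Ioo (-ε) ε) ∧ (∀ t ∈ Ioo (-ε) ε, 0 < f t) ∧
      ContDiff ℝ ∞ h ∧ (∀ q X Y, h q X Y = h q Y X) ∧ (∀ q X, X ≠ 0 → 0 < h q X X) ∧
      ∀ p ∈ e.source, ∀ a X c Y,
        bilinForm (G (e p)) (fderiv ℝ e p (a, X)) (fderiv ℝ e p (c, Y))
          = -(a * c) + f p.1 ^ 2 * h p.2 X Y := by
  have hb := contDiffOn_bilinForm hG.smooth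
  have : Nonempty (Fin (n - 1)) := ⟨⟨0, by omega⟩⟩
  refine exists_warped_chart (E' := Coord (n - 1)) (by simp; omega) hG.isOpen hb hU hφ
    (fun y hy => hG.bilinForm_symm hy) ?_ hpos ?_ ?_ hφu hy₀
  · intro y hy
    rw [hG.bilinForm_lowered hy, hunit y hy]
  · intro y hy X Y
    have hbU := (hb.clm_apply hU).hasFDerivAt_of_isOpen hG.isOpen hy
    set A := fderiv ℝ (fun z => bilinForm (G z) (U z)) y with hA
    have hAe : ∀ l j, A (basisVec l) (basisVec j) = partialDeriv l (lowered G U j) y := by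
      intro l j
      have h1 := hbU.clm_apply (hasFDerivAt_const (basisVec j) y)
      rw [partialDeriv_congr hG.isOpen (F' := fun z => bilinForm (G z) (U z) (basisVec j))
        (fun z hz => ?_) hy, partialDeriv, h1.fderiv]
      · simp
      · rw [hG.bilinForm_lowered hz]; simp
    have hsymm : A = A.flip := by
      refine clm_ext_basisVec fun l => clm_ext_basisVec fun j => ?_
      rw [ContinuousLinearMap.flip_apply, hAe, hAe]
      have h1 := htorse y hy j l
      have h2 := htorse y hy l j
      rw [covForm] at h1 h2
      rw [hG.symm hy l j] at h2
      have h3 : ∑ p, christoffel G p l j y * lowered G U p y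
          = ∑ p, christoffel G p j l y * lowered G U p y :=
        Finset.sum_congr rfl fun p _ => by rw [hG.christoffel_symm hy p l j]
      linear_combination h1 - h2 + h3
    exact DFunLike.congr_fun (DFunLike.congr_fun hsymm X) Y
  · intro y hy X Y
    have hUd : DifferentiableAt ℝ U y := (hU.hasFDerivAt_of_isOpen hG.isOpen hy).differentiableAt
    have hext : fderiv ℝ (fun z => bilinForm (G z)) y (U y) + (bilinForm (G y)).comp (fderiv ℝ U y)
        + ((bilinForm (G y)).flip.comp (fderiv ℝ U y)).flip
        = (2 * φ y) • (bilinForm (G y)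
          + (bilinForm (G y) (U y)).smulRight (bilinForm (G y) (U y))) := by
      refine clm_ext_basisVec fun i => clm_ext_basisVec fun j => ?_
      have h1 := hG.lie_metric_eq hy hU i j
      rw [htorse y hy, htorse y hy] at h1
      have hu : ∀ i, bilinForm (G y) (U y) (basisVec i) = lowered G U i y := fun i => by
        rw [hG.bilinForm_lowered hy]; simp
      simp only [add_apply, smul_apply, ContinuousLinearMap.comp_apply,
        ContinuousLinearMap.flip_apply, ContinuousLinearMap.smulRight_apply, smul_eq_mul,
        hG.fderiv_bilinForm_apply hy, hu, bilinForm_basisVec]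
      rw [bilinForm_basisVec_right, bilinForm_basisVec_left]
      simp only [fderiv_basisVec_apply hUd]
      rw [h1, hG.symm hy j i]
      ring
    have := DFunLike.congr_fun (DFunLike.congr_fun hext X) Y
    simpa only [add_apply, smul_apply, ContinuousLinearMap.comp_apply,
      ContinuousLinearMap.flip_apply, ContinuousLinearMap.smulRight_apply, smul_eq_mul] using this

end IsSmoothMetric

end Forms

end Spacetime

/-! ### Parallel vector fields of flat metrics -/

namespace Spacetime

section Flat

variable {n : ℕ} {O : Set (Coord n)} {G : Coord n → Matrix (Fin n) (Fin n) ℝ}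

/-- The connection form `X ↦ (w ↦ -Γ(X, w))` for which `∇U = 0` reads `dU(X) = connForm X U`. -/
noncomputable def connForm (G : Coord n → Matrix (Fin n) (Fin n) ℝ) (y : Coord n) :
    Coord n →L[ℝ] Coord n →L[ℝ] Coord n :=
  ∑ k, ∑ p, (EuclideanSpace.proj k : Coord n →L[ℝ] ℝ).smulRight
    ((EuclideanSpace.proj p : Coord n →L[ℝ] ℝ).smulRight
      (∑ h, (-christoffel G h k p y) • basisVec h))

theorem connForm_apply (y X w : Coord n) (h : Fin n) :
    connForm G y X w h = ∑ k, ∑ p, X k * (w p * -christoffel G h k p y) := by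
  simp [connForm, sum_apply, WithLp.ofLp_sum, Pi.single_apply]

theorem connForm_basisVec_left (y w : Coord n) (k h : Fin n) :
    connForm G y (basisVec k) w h = ∑ p, w p * -christoffel G h k p y := by
  rw [connForm_apply, Finset.sum_comm]
  simp

theorem connForm_basisVec (y : Coord n) (k p h : Fin n) :
    connForm G y (basisVec k) (basisVec p) h = -christoffel G h k p y := by
  rw [connForm_basisVec_left]
  simp

namespace IsSmoothMetric

variable (hG : IsSmoothMetric G O)
include hG

theorem connForm_smooth : ContDiffOn ℝ ∞ (connForm G) O := by
  refine contDiffOn_clm_apply.2 fun X => contDiffOn_clm_apply.2 fun w => ?_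
  refine contDiffOn_euclidean.2 fun h => ?_
  simp only [connForm_apply]
  exact ContDiffOn.sum fun k _ => ContDiffOn.sum fun p _ => contDiffOn_const.mul
    (contDiffOn_const.mul (hG.christoffel_smooth h k p).neg)

theorem fderiv_connForm_apply {y : Coord n} (hy : y ∈ O) (l k q h : Fin n) :
    fderiv ℝ (connForm G) y (basisVec l) (basisVec k) (basisVec q) h
      = -partialDeriv l (christoffel G h k q) y := by
  have hd := hG.connForm_smooth.hasFDerivAt_of_isOpen hG.isOpen hy
  have h1 := (hd.clm_apply (hasFDerivAt_const (basisVec k) y)).clm_apply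
    (hasFDerivAt_const (basisVec q) y)
  have h2 := (EuclideanSpace.proj h : Coord n →L[ℝ] ℝ).hasFDerivAt.comp y h1
  have h3 : (EuclideanSpace.proj h : Coord n →L[ℝ] ℝ) ∘
      (fun z => connForm G z (basisVec k) (basisVec q)) = fun z => -christoffel G h k q z :=
    funext fun z => connForm_basisVec z k q h
  rw [h3] at h2
  have h4 : partialDeriv l (christoffel G h k q) y
      = -fderiv ℝ (fun z => -christoffel G h k q z) y (basisVec l) := by
    rw [partialDeriv, fderiv_fun_neg]
    simp
  rw [h4, h2.fderiv, neg_neg]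
  simp

/-- In a flat metric every tangent vector extends locally to a parallel vector field. -/
theorem exists_parallel (hflat : ∀ y ∈ O, ∀ h i j k, riemannUp G h i j k y = 0) {y₀ : Coord n}
    (hy₀ : y₀ ∈ O) (U₀ : Coord n) :
    ∃ (r : ℝ) (U : Coord n → Coord n), 0 < r ∧ ball y₀ r ⊆ O ∧ ContDiffOn ℝ ∞ U (ball y₀ r) ∧
      U y₀ = U₀ ∧ ∀ y ∈ ball y₀ r, ∀ i l, covForm G (lowered G U) i l y = 0 := by
  have hfl : ∀ y ∈ O, ∀ X Y w, fderiv ℝ (connForm G) y X Y w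
      + connForm G y Y (connForm G y X w) = fderiv ℝ (connForm G) y Y X w
      + connForm G y X (connForm G y Y w) := by
    intro y hy X Y w
    -- flatness of the connection form is the vanishing of the curvature tensor
    let A : Coord n →L[ℝ] Coord n →L[ℝ] Coord n →L[ℝ] Coord n := fderiv ℝ (connForm G) y
      + ((ContinuousLinearMap.compL ℝ (Coord n) (Coord n) (Coord n)).bilinearComp
        (connForm G y) (connForm G y)).flip
    have hA : ∀ X Y w, A X Y w = fderiv ℝ (connForm G) y X Y w
      + connForm G y Y (connForm G y X w) := fun X Y w => rfl
    have hsymm : A = A.flip := by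
      refine clm_ext_basisVec fun l => clm_ext_basisVec fun k => clm_ext_basisVec fun q => ?_
      rw [ContinuousLinearMap.flip_apply, hA, hA]
      ext h
      simp only [PiLp.add_apply, hG.fderiv_connForm_apply hy]
      rw [connForm_basisVec_left, connForm_basisVec_left]
      simp only [connForm_basisVec]
      have h1 := hflat y hy h q l k
      have hΓ : ∀ a b c, partialDeriv a (christoffel G h b c) y
          = partialDeriv a (christoffel G h c b) y := fun a b c =>
        partialDeriv_congr hG.isOpen (fun z hz => hG.christoffel_symm hz h b c) hy a
      rw [riemannUp, Finset.sum_sub_distrib, hΓ k q l, hΓ l q k] at h1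
      have h2 : ∀ a b, ∑ p, -christoffel G p a q y * -christoffel G h b p y
          = ∑ p, christoffel G h b p y * christoffel G p q a y := fun a b =>
        Finset.sum_congr rfl fun p _ => by rw [hG.christoffel_symm hy p a q]; ring
      rw [h2, h2]
      linear_combination h1
    have := DFunLike.congr_fun (DFunLike.congr_fun (DFunLike.congr_fun hsymm X) Y) w
    rwa [ContinuousLinearMap.flip_apply, hA, hA] at this
  obtain ⟨r, U, hr, hrO, hU, hU₀, hdU⟩ :=
    exists_solution_of_flat hG.isOpen hG.connForm_smooth hfl hy₀ U₀
  refine ⟨r, U, hr, hrO, hU, hU₀, fun y hy i l => ?_⟩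
  have hGb := hG.mono isOpen_ball hrO
  have hyO := hrO hy
  have hdU' : ∀ p, partialDeriv l (fun z => U z p) y = ∑ q, U y q * -christoffel G p l q y := by
    intro p
    rw [← fderiv_basisVec_apply (hU.hasFDerivAt_of_isOpen isOpen_ball hy).differentiableAt,
      hdU y hy, connForm_basisVec_left]
  rw [covForm, hGb.partialDeriv_lowered hy hU]
  simp only [hG.partialDeriv_eq hyO, hdU', lowered, Finset.sum_mul, Finset.mul_sum,
    Finset.sum_add_distrib, add_mul]
  have h1 : ∑ p, ∑ q, christoffel G q l i y * G y q p * U y p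
      = ∑ p, ∑ q, christoffel G p l i y * (G y p q * U y q) := by
    rw [Finset.sum_comm]
    exact Finset.sum_congr rfl fun p _ => Finset.sum_congr rfl fun q _ => by ring
  have h2 : ∑ p, ∑ q, christoffel G q l p y * G y i q * U y p
      = -∑ p, ∑ q, G y i p * (U y q * -christoffel G p l q y) := by
    rw [Finset.sum_comm, ← Finset.sum_neg_distrib]
    refine Finset.sum_congr rfl fun p _ => ?_
    rw [← Finset.sum_neg_distrib]
    exact Finset.sum_congr rfl fun q _ => by ring
  rw [h1, h2]
  ring

end IsSmoothMetric

end Flat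

end Spacetime

/-! ### Conformally flat pseudosymmetric metrics in coordinates -/

namespace Spacetime

/-- The reverse of the Cauchy–Schwarz inequality in its qualitative form: if the orthogonal
complement of some vector is spacelike, then so is that of every timelike vector. -/
theorem pos_of_orthogonal_timelike {E : Type*} [NormedAddCommGroup E] [NormedSpace ℝ E]
    {b : E →L[ℝ] E →L[ℝ] ℝ} (hb : ∀ X Y, b X Y = b Y X) {T V : E}
    (hT : ∀ X, b T X = 0 → X ≠ 0 → 0 < b X X) (hV : b V V < 0) {X : E} (hX : b V X = 0)
    (hX0 : X ≠ 0) : 0 < b X X := by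
  by_contra hXX
  rw [not_lt] at hXX
  have hTY : b T (b T X • V - b T V • X) = 0 := by
    simp only [map_sub, map_smul, smul_eq_mul]
    ring
  have hYY : b (b T X • V - b T V • X) (b T X • V - b T V • X)
      = b T X ^ 2 * b V V + b T V ^ 2 * b X X := by
    simp only [map_sub, map_smul, sub_apply, smul_apply, smul_eq_mul, hX, hb X V]
    ring
  have hY : b T X • V - b T V • X = 0 := by
    by_contra h
    have h1 := hT _ hTY h
    rw [hYY] at h1
    nlinarith [mul_nonneg (sq_nonneg (b T X)) (neg_nonneg.2 hV.le),
      mul_nonneg (sq_nonneg (b T V)) (neg_nonneg.2 hXX)]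
  have h1 : b V (b T X • V - b T V • X) = 0 := by rw [hY, map_zero]
  simp only [map_sub, map_smul, smul_eq_mul, hX, mul_zero, sub_zero] at h1
  rcases mul_eq_zero.1 h1 with h | h
  · exact hXX.not_gt (hT X h hX0)
  · exact hV.ne h

section

variable {n : ℕ} {O : Set (Coord n)} {F : Coord n → ℝ}

/-- The symmetry of second partial derivatives. -/
theorem partialDeriv_comm (hO : IsOpen O) (hF : ContDiffOn ℝ ∞ F O) {y : Coord n} (hy : y ∈ O)
    (l m : Fin n) :
    partialDeriv m (partialDeriv l F) y = partialDeriv l (partialDeriv m F) y := by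
  have hd : ContDiffOn ℝ ∞ (fderiv ℝ F) O := hF.fderiv_of_isOpen hO (by simp)
  have h1 : ∀ a b, partialDeriv a (partialDeriv b F) y
      = fderiv ℝ (fderiv ℝ F) y (basisVec a) (basisVec b) := fun a b => by
    have := ((hd.hasFDerivAt_of_isOpen hO hy).clm_apply
      (hasFDerivAt_const (basisVec b) y)).fderiv
    rw [partialDeriv]
    refine (DFunLike.congr_fun this _).trans ?_
    simp
  rw [h1, h1]
  exact ((hF.contDiffAt (hO.mem_nhds hy)).isSymmSndFDerivAt
    (by simpa using ENat.LEInfty.out)).eq _ _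

/-- A solution of a homogeneous linear total differential equation on a ball vanishes if it vanishes
at the centre. -/
theorem eq_zero_of_partialDeriv_eq_mul {y₀ : Coord n} {r : ℝ} (hF : ContDiffOn ℝ ∞ F (ball y₀ r))
    {c : Fin n → Coord n → ℝ} (hc : ∀ l, ContinuousOn (c l) (ball y₀ r))
    (hd : ∀ y ∈ ball y₀ r, ∀ l, partialDeriv l F y = c l y * F y) (h0 : F y₀ = 0) :
    ∀ y ∈ ball y₀ r, F y = 0 := by
  intro y hy
  have hseg : ∀ t ∈ Icc (0 : ℝ) 1, y₀ + t • (y - y₀) ∈ ball y₀ r := by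
    intro t ht
    have hr : 0 < r := dist_nonneg.trans_lt hy
    exact (convex_ball y₀ r).add_smul_sub_mem (mem_ball_self hr) hy ht
  have hγ : ∀ t : ℝ, HasDerivAt (fun t : ℝ => y₀ + t • (y - y₀)) (y - y₀) t := fun t => by
    simpa using ((hasDerivAt_id t).smul_const (y - y₀)).const_add y₀
  have := eq_zero_of_hasDerivAt_clm (f := fun t : ℝ => F (y₀ + t • (y - y₀))) (b := 1)
    (A := fun t => (∑ l, (y - y₀) l * c l (y₀ + t • (y - y₀))) • ContinuousLinearMap.id ℝ ℝ)
    ?_ ?_ (by simpa using h0) 1 (by simp)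
  · simpa using this
  · refine ContinuousOn.smul (continuousOn_finsetSum _ fun l _ => continuousOn_const.mul
      ((hc l).comp ?_ hseg)) continuousOn_const
    exact fun t _ => (hγ t).continuousAt.continuousWithinAt
  · intro t ht
    have h1 := (hF.hasFDerivAt_of_isOpen isOpen_ball (hseg t ht)).comp_hasDerivAt t (hγ t)
    refine h1.congr_deriv ?_
    rw [fderiv_apply_eq_sum]
    simp only [hd _ (hseg t ht), smul_apply, ContinuousLinearMap.id_apply, smul_eq_mul,
      Finset.sum_mul, mul_assoc]

end

/-- If the Weyl tensor vanishes, the curvature tensor is the Kulkarni–Nomizu product of the metric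
with the Schouten tensor. -/
theorem riemann_eq_kulkarni {n : ℕ} {G : Coord n → Matrix (Fin n) (Fin n) ℝ} (hn : 3 ≤ n)
    {y : Coord n} {h i j k : Fin n} (hW : weyl G h i j k y = 0) : riemann G h i j k y
      = kulkarni (fun a b => G y a b) (fun a b => schouten G a b y) h i j k := by
  have hn' : (3 : ℝ) ≤ n := by exact_mod_cast hn
  have h1 : (n : ℝ) - 1 ≠ 0 := by linarith
  have h2 : (n : ℝ) - 2 ≠ 0 := by linarith
  rw [weyl] at hW
  have : riemann G h i j k y
      = 1 / ((n : ℝ) - 2) * (G y h k * ricci G i j y - G y h j * ricci G i k y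
      + G y i j * ricci G h k y - G y i k * ricci G h j y)
      - scalarCurv G y / (((n : ℝ) - 1) * ((n : ℝ) - 2))
        * (G y h k * G y i j - G y h j * G y i k) := by
    linear_combination hW
  rw [this]
  simp only [kulkarni, schouten]
  field_simp
  ring

namespace IsSmoothMetric

variable {n : ℕ} {O : Set (Coord n)} {G : Coord n → Matrix (Fin n) (Fin n) ℝ}
  (hG : IsSmoothMetric G O)
include hG

/-- Contraction with the inverse metric of a tensor `v ⊗ T`, where `v = V^♭`. -/
theorem contract_lowered {y : Coord n} (hy : y ∈ O) (V : Coord n → Coord n) (T : Fin n → ℝ) :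
    contract (fun a b => (G y)⁻¹ a b) (fun h k => lowered G V h y * T k) = ∑ k, V y k * T k := by
  rw [contract, Finset.sum_comm]
  refine Finset.sum_congr rfl fun k _ => ?_
  have h1 : ∀ h, (G y)⁻¹ h k * (lowered G V h y * T k)
      = ∑ j, (G y)⁻¹ k h * G y h j * (V y j * T k) := fun h => by
    rw [lowered, Finset.sum_mul, Finset.mul_sum, hG.inv_symm hy k h]
    exact Finset.sum_congr rfl fun j _ => by ring
  simp only [h1]
  rw [Finset.sum_comm]
  simp only [← Finset.sum_mul, hG.sum_inv_mul hy]
  simp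

/-- The Schouten tensor of a conformally flat pseudosymmetric metric with non-null covector `v` is
`α v ⊗ v + β g`. The three identities relate the differentials of `α`, `β` and the covariant
derivative of `v`; `∑ k, V y k * covForm G v k l y` is half the differential of `v_p v^p`. -/
theorem exists_schouten_eq (hn : 3 ≤ n) {V : Coord n → Coord n} (hV : ContDiffOn ℝ ∞ V O)
    (hq : ∀ y ∈ O, ∑ i, lowered G V i y * V y i ≠ 0)
    (hps : ∀ y ∈ O, ∀ h i j k l, covRiemann G h i j k l y =
      2 * lowered G V l y * riemann G h i j k y + lowered G V h y * riemann G l i j k y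
        + lowered G V i y * riemann G h l j k y + lowered G V j y * riemann G h i l k y
        + lowered G V k y * riemann G h i j l y)
    (hW : ∀ y ∈ O, ∀ h i j k, weyl G h i j k y = 0)
    (hC : ∀ y ∈ O, n = 3 → ∀ i j k, cotton G i j k y = 0) :
    ∃ α β : Coord n → ℝ, ContDiffOn ℝ ∞ α O ∧ ContDiffOn ℝ ∞ β O ∧
      (∀ y ∈ O, ∀ i j, schouten G i j y
        = α y * (lowered G V i y * lowered G V j y) + β y * G y i j) ∧
      (∀ y ∈ O, ∀ l, partialDeriv l β y = 2 * β y * lowered G V l y) ∧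
      (∀ y ∈ O, ∀ l, partialDeriv l α y * (∑ i, lowered G V i y * V y i)
        + 2 * α y * (∑ k, V y k * covForm G (lowered G V) k l y)
          = 4 * α y * (∑ i, lowered G V i y * V y i) * lowered G V l y
            + 4 * β y * lowered G V l y) ∧
      ∀ y ∈ O, ∀ i l, α y * (∑ i, lowered G V i y * V y i) * covForm G (lowered G V) i l y
        = 2 * β y * (∑ i, lowered G V i y * V y i) * G y i l
          + lowered G V i y * (α y * (∑ k, V y k * covForm G (lowered G V) k l y)
            - 2 * β y * lowered G V l y) := by
  have hn' : (3 : ℝ) ≤ n := by exact_mod_cast hn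
  have hn1 : (n : ℝ) - 1 ≠ 0 := by linarith
  have hv := hG.lowered_smooth hV
  have hVs := fun p => contDiffOn_apply hV p
  obtain ⟨q, hqd⟩ : ∃ q : Coord n → ℝ, ∀ y, q y = ∑ i, lowered G V i y * V y i := ⟨_, fun _ => rfl⟩
  simp only [← hqd] at hq ⊢
  have hqs : ContDiffOn ℝ ∞ q O := by
    rw [show q = fun y => ∑ i, lowered G V i y * V y i from funext hqd]
    exact ContDiffOn.sum fun i _ => (hv i).mul (hVs i)
  let p : Coord n → ℝ := fun y => contract (fun a b => (G y)⁻¹ a b) fun a b => schouten G a b y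
  let lam : Coord n → ℝ := fun y => (∑ b, V y b * ∑ k, V y k * schouten G b k y) / q y
  let β : Coord n → ℝ := fun y => (p y - lam y) / ((n : ℝ) - 1)
  let α : Coord n → ℝ := fun y => (lam y - β y) / q y
  have hp : ContDiffOn ℝ ∞ p O := ContDiffOn.sum fun a _ => ContDiffOn.sum fun b _ =>
    (hG.inv_smooth a b).mul (hG.schouten_smooth a b)
  have hlam : ContDiffOn ℝ ∞ lam O := (ContDiffOn.sum fun b _ => (hVs b).mul
    (ContDiffOn.sum fun k _ => (hVs k).mul (hG.schouten_smooth b k))).div hqs hq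
  have hβ : ContDiffOn ℝ ∞ β O := (hp.sub hlam).div_const _
  have hα : ContDiffOn ℝ ∞ α O := (hlam.sub hβ).div hqs hq
  have hR : ∀ z ∈ O, ∀ h i j k, riemann G h i j k z
      = kulkarni (fun a b => G z a b) (fun a b => schouten G a b z) h i j k :=
    fun z hz h i j k => riemann_eq_kulkarni hn (hW z hz h i j k)
  have hqc : ∀ y ∈ O, q y = contract (fun a b => (G y)⁻¹ a b)
      fun h k => lowered G V h y * lowered G V k y := fun y hy => by
    rw [hG.contract_lowered hy, hqd]
    exact Finset.sum_congr rfl fun i _ => mul_comm _ _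
  have hcore : ∀ y ∈ O, (∀ i j, schouten G i j y
      = α y * (lowered G V i y * lowered G V j y) + β y * G y i j) ∧
      ∀ i j l, covSchouten G i j l y
        = 4 * α y * (lowered G V i y * lowered G V j y * lowered G V l y)
        + 2 * β y * (lowered G V l y * G y i j + lowered G V i y * G y l j
          + lowered G V j y * G y i l) := by
    intro y hy
    refine schouten_eq_of_pseudosymmetric (gi := fun a b => (G y)⁻¹ a b) (q := q y) (p := p y)
      (g := fun a b => G y a b) (P := fun a b => schouten G a b y)
      (D := fun a b l => covSchouten G a b l y)
      (lam := lam y) hn (hG.symm hy) (hG.inv_symm hy) (hG.sum_inv_mul hy) ?_ ?_ ?_ (hqc y hy)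
      (hq y hy) rfl ?_ ?_ ?_
    · refine symm_of_kulkarni_bianchi (g := fun a b => G y a b) (gi := fun a b => (G y)⁻¹ a b) hn
        (hG.symm hy) (hG.inv_symm hy) (hG.sum_inv_mul hy) fun h i j k => ?_
      simp only [← hR y hy]
      exact hG.riemann_bianchi hy h i j k
    · intro h i j k l
      simp only [← hR y hy]
      rw [← hG.covRiemann_eq hy hR, hps y hy]
    · intro h3 i j l
      exact sub_eq_zero.1 (hC y hy h3 i j l)
    · rw [contract_congr (T := fun a b => lowered G V a y * ∑ k, V y k * schouten G b k y)
        (fun a b => by rw [hG.contract_lowered hy]), hG.contract_lowered hy]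
      exact mul_div_cancel₀ _ (hq y hy)
    · exact mul_div_cancel₀ _ hn1
    · exact div_mul_cancel₀ _ (hq y hy)
  have hderiv : ∀ y ∈ O, (∀ l, partialDeriv l β y = 2 * β y * lowered G V l y) ∧
      (∀ l, partialDeriv l α y * q y + 2 * α y * (∑ k, V y k * covForm G (lowered G V) k l y)
          = 4 * α y * q y * lowered G V l y + 4 * β y * lowered G V l y) ∧
      ∀ i l, α y * q y * covForm G (lowered G V) i l y
        = 2 * β y * q y * G y i l
          + lowered G V i y * (α y * (∑ k, V y k * covForm G (lowered G V) k l y)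
            - 2 * β y * lowered G V l y) := by
    intro y hy
    refine deriv_eq_of_schouten_eq (gi := fun a b => (G y)⁻¹ a b) (g := fun a b => G y a b)
      (v := fun i => lowered G V i y) (a := fun l => partialDeriv l α y)
      (b := fun l => partialDeriv l β y)
      (x := fun i l => covForm G (lowered G V) i l y) hn (hG.symm hy) (hG.inv_symm hy)
      (hG.sum_inv_mul hy) (hqc y hy) (hq y hy)
      (fun l => (hG.contract_lowered hy V fun k => covForm G (lowered G V) k l y).symm)
      fun i j l => ?_
    have hαd := ContDiffOn.differentiableAt_of_isOpen hα hG.isOpen hy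
    have hβd := ContDiffOn.differentiableAt_of_isOpen hβ hG.isOpen hy
    have hvd := fun i => ContDiffOn.differentiableAt_of_isOpen (hv i) hG.isOpen hy
    have hGd := fun i j => ContDiffOn.differentiableAt_of_isOpen (hG.smooth i j) hG.isOpen hy
    have hvv : DifferentiableAt ℝ (fun z => lowered G V i z * lowered G V j z) y :=
      (hvd i).mul (hvd j)
    have h1 : partialDeriv l (schouten G i j) y
        = partialDeriv l α y * (lowered G V i y * lowered G V j y)
        + α y * (partialDeriv l (lowered G V i) y * lowered G V j y
          + lowered G V i y * partialDeriv l (lowered G V j) y)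
        + (partialDeriv l β y * G y i j + β y * ∑ p, (christoffel G p l i y * G y p j
          + christoffel G p l j y * G y i p)) := by
      rw [partialDeriv_congr hG.isOpen (fun z hz => (hcore z hz).1 i j) hy l,
        partialDeriv_add (hαd.fun_mul hvv) (hβd.fun_mul (hGd i j)), partialDeriv_mul hαd hvv,
        partialDeriv_mul (hvd i) (hvd j), partialDeriv_mul hβd (hGd i j), hG.partialDeriv_eq hy]
    have h2 : ∑ p, (christoffel G p l i y * schouten G p j y
          + christoffel G p l j y * schouten G i p y)
        = α y * ((∑ p, christoffel G p l i y * lowered G V p y) * lowered G V j y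
          + lowered G V i y * ∑ p, christoffel G p l j y * lowered G V p y)
        + β y * ∑ p, (christoffel G p l i y * G y p j + christoffel G p l j y * G y i p) := by
      simp only [(hcore y hy).1, Finset.mul_sum, Finset.sum_mul, ← Finset.sum_add_distrib]
      exact Finset.sum_congr rfl fun p _ => by ring
    have h3 := (hcore y hy).2 i j l
    rw [covSchouten, h1, h2] at h3
    simp only [covForm]
    linear_combination h3
  exact ⟨α, β, hα, hβ, fun y hy => (hcore y hy).1, fun y hy => (hderiv y hy).1,
    fun y hy => (hderiv y hy).2.1, fun y hy => (hderiv y hy).2.2⟩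

end IsSmoothMetric

end Spacetime

/-! ### The torse-forming vector field of a conformally flat pseudosymmetric metric -/

namespace Spacetime

namespace IsSmoothMetric

variable {n : ℕ} {O : Set (Coord n)} {G : Coord n → Matrix (Fin n) (Fin n) ℝ}
  (hG : IsSmoothMetric G O)
include hG

theorem riemannUp_eq_zero {y : Coord n} (hy : y ∈ O) (h0 : ∀ h i j k, riemann G h i j k y = 0)
    (h i j k : Fin n) : riemannUp G h i j k y = 0 := by
  have := Matrix.eq_zero_of_mulVec_eq_zero (hG.det_ne_zero hy)
    (v := fun p => riemannUp G p i j k y) (funext fun a => h0 a i j k)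
  exact congrFun this h

/-- A timelike vector field and its unit normalization `κ V`. The differential of `κ` follows from
`κ² v_p v^p = -1`. -/
theorem exists_normalization {V : Coord n → Coord n} (hV : ContDiffOn ℝ ∞ V O)
    (hq : ∀ y ∈ O, ∑ i, lowered G V i y * V y i < 0) :
    ∃ κ : Coord n → ℝ, ContDiffOn ℝ ∞ κ O ∧
      (∀ y ∈ O, κ y ^ 2 * (∑ i, lowered G V i y * V y i) = -1) ∧
      ∀ y ∈ O, ∀ l, partialDeriv l κ y * (∑ i, lowered G V i y * V y i)
        = -(κ y * ∑ k, V y k * covForm G (lowered G V) k l y) := by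
  have hqs : ContDiffOn ℝ ∞ (fun y => ∑ i, lowered G V i y * V y i) O :=
    ContDiffOn.sum fun i _ => (hG.lowered_smooth hV i).mul (contDiffOn_apply hV i)
  have hpos : ∀ y ∈ O, 0 < √(-∑ i, lowered G V i y * V y i) := fun y hy =>
    Real.sqrt_pos.2 (neg_pos.2 (hq y hy))
  let κ : Coord n → ℝ := fun y => (√(-∑ i, lowered G V i y * V y i))⁻¹
  have hκ : ContDiffOn ℝ ∞ κ O := ContDiffOn.inv
    (ContDiffOn.sqrt hqs.neg fun y hy => (neg_pos.2 (hq y hy)).ne') fun y hy => (hpos y hy).ne'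
  have hsq : ∀ y ∈ O, κ y ^ 2 * (∑ i, lowered G V i y * V y i) = -1 := by
    intro y hy
    have h1 := Real.sq_sqrt (neg_pos.2 (hq y hy)).le
    change (√(-∑ i, lowered G V i y * V y i))⁻¹ ^ 2 * _ = -1
    rw [inv_pow, h1, inv_neg, neg_mul, inv_mul_cancel₀ (hq y hy).ne]
  refine ⟨κ, hκ, hsq, fun y hy l => ?_⟩
  have hκd := ContDiffOn.differentiableAt_of_isOpen hκ hG.isOpen hy
  have hqd := ContDiffOn.differentiableAt_of_isOpen hqs hG.isOpen hy
  have hκ0 : κ y ≠ 0 := inv_ne_zero (hpos y hy).ne'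
  have h1 : partialDeriv l (fun z => κ z * κ z * (∑ i, lowered G V i z * V z i)) y = 0 := by
    rw [partialDeriv_congr hG.isOpen (F' := fun _ => -1)
      (fun z hz => by rw [← sq, hsq z hz]) hy, partialDeriv_const]
  rw [partialDeriv_mul (hκd.fun_mul hκd) hqd, partialDeriv_mul hκd hκd,
    hG.partialDeriv_sq_eq hy hV l] at h1
  have h2 : κ y * (partialDeriv l κ y * (∑ i, lowered G V i y * V y i)
      + κ y * ∑ k, V y k * covForm G (lowered G V) k l y) = 0 := by
    linear_combination h1 / 2
  rcases mul_eq_zero.1 h2 with h | h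
  · exact absurd h hκ0
  · linarith

omit hG in
theorem lowered_smul (V : Coord n → Coord n) (κ : Coord n → ℝ) (i : Fin n) (y : Coord n) :
    lowered G (fun z => κ z • V z) i y = κ y * lowered G V i y := by
  simp only [lowered, PiLp.smul_apply, smul_eq_mul, Finset.mul_sum]
  exact Finset.sum_congr rfl fun j _ => by ring

/-- The covariant derivative of the normalized covector. -/
theorem covForm_smul {V : Coord n → Coord n} (hV : ContDiffOn ℝ ∞ V O) {κ : Coord n → ℝ}
    (hκ : ContDiffOn ℝ ∞ κ O) {y : Coord n} (hy : y ∈ O) (i l : Fin n) :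
    covForm G (lowered G fun z => κ z • V z) i l y
      = partialDeriv l κ y * lowered G V i y + κ y * covForm G (lowered G V) i l y := by
  have h1 : lowered G (fun z => κ z • V z) i = fun z => κ z * lowered G V i z :=
    funext fun z => lowered_smul V κ i z
  rw [covForm, h1, partialDeriv_mul (ContDiffOn.differentiableAt_of_isOpen hκ hG.isOpen hy)
    (ContDiffOn.differentiableAt_of_isOpen (hG.lowered_smooth hV i) hG.isOpen hy), covForm]
  simp only [lowered_smul, mul_left_comm, mul_sub, Finset.mul_sum]
  ring

/-- Where the coefficient `α` of the Schouten tensor `α v ⊗ v + β g` does not vanish, the normalized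
covector `u = κ v` is torse-forming, `u_{i,l} = φ (g_{il} + u_i u_l)` with `φ = 2βκ/α`, and `dφ` is
proportional to `u`. The hypotheses are the conclusions of `exists_schouten_eq` and
`exists_normalization`. -/
theorem torseForming_of_ne_zero {V : Coord n → Coord n} (hV : ContDiffOn ℝ ∞ V O)
    (hq : ∀ y ∈ O, ∑ i, lowered G V i y * V y i < 0) {α β κ : Coord n → ℝ}
    (hα : ContDiffOn ℝ ∞ α O) (hβ : ContDiffOn ℝ ∞ β O) (hκ : ContDiffOn ℝ ∞ κ O)
    (hα0 : ∀ y ∈ O, α y ≠ 0)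
    (h1 : ∀ y ∈ O, ∀ l, partialDeriv l β y = 2 * β y * lowered G V l y)
    (h2 : ∀ y ∈ O, ∀ l, partialDeriv l α y * (∑ i, lowered G V i y * V y i)
        + 2 * α y * (∑ k, V y k * covForm G (lowered G V) k l y)
          = 4 * α y * (∑ i, lowered G V i y * V y i) * lowered G V l y
            + 4 * β y * lowered G V l y)
    (h3 : ∀ y ∈ O, ∀ i l, α y * (∑ i, lowered G V i y * V y i) * covForm G (lowered G V) i l y
        = 2 * β y * (∑ i, lowered G V i y * V y i) * G y i l
          + lowered G V i y * (α y * (∑ k, V y k * covForm G (lowered G V) k l y)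
            - 2 * β y * lowered G V l y))
    (hκq : ∀ y ∈ O, κ y ^ 2 * (∑ i, lowered G V i y * V y i) = -1)
    (hdκ : ∀ y ∈ O, ∀ l, partialDeriv l κ y * (∑ i, lowered G V i y * V y i)
        = -(κ y * ∑ k, V y k * covForm G (lowered G V) k l y)) {y : Coord n} (hy : y ∈ O) :
    (∀ i l, covForm G (lowered G fun z => κ z • V z) i l y = 2 * β y * κ y / α y *
        (G y i l + lowered G (fun z => κ z • V z) i y * lowered G (fun z => κ z • V z) l y)) ∧
      ∀ X, bilinForm (G y) (κ y • V y) X = 0 →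
        fderiv ℝ (fun z => 2 * β z * κ z / α z) y X = 0 := by
  have hv := hG.lowered_smooth hV
  obtain ⟨q, hqd⟩ : ∃ q : Coord n → ℝ, ∀ y, q y = ∑ i, lowered G V i y * V y i := ⟨_, fun _ => rfl⟩
  obtain ⟨s, hsd⟩ : ∃ s : Fin n → Coord n → ℝ,
    ∀ l y, s l y = ∑ k, V y k * covForm G (lowered G V) k l y := ⟨_, fun _ _ => rfl⟩
  simp only [← hqd, ← hsd] at hq h2 h3 hκq hdκ
  have hq0 := (hq y hy).ne
  have ha := hα0 y hy
  constructor
  · intro i l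
    rw [hG.covForm_smul hV hκ hy, lowered_smul, lowered_smul]
    have e1 := h3 y hy i l
    have e2 := hdκ y hy l
    have e3 := hκq y hy
    have : (α y * q y) * (partialDeriv l κ y * lowered G V i y
        + κ y * covForm G (lowered G V) i l y - 2 * β y * κ y / α y *
        (G y i l + κ y * lowered G V i y * (κ y * lowered G V l y))) = 0 := by
      field_simp
      linear_combination α y * lowered G V i y * e2 + κ y * e1
        - 2 * β y * κ y * lowered G V i y * lowered G V l y * e3
    rcases mul_eq_zero.1 this with h | h
    · exact absurd h (mul_ne_zero ha hq0)
    · linarith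
  · -- the symmetry of the second derivatives of `β` makes `β dv` vanish
    have hsym : ∀ i l, β y * (lowered G V i y * s l y) = β y * (lowered G V l y * s i y) := by
      intro i l
      have hβd := ContDiffOn.differentiableAt_of_isOpen hβ hG.isOpen hy
      have e : ∀ a b, partialDeriv a (partialDeriv b β) y
          = 2 * (2 * β y * lowered G V a y * lowered G V b y
            + β y * partialDeriv a (lowered G V b) y) := fun a b => by
        rw [partialDeriv_congr hG.isOpen (F' := fun z => 2 * (β z * lowered G V b z))
          (fun z hz => by rw [h1 z hz]; ring) hy,
          partialDeriv_mul (differentiableAt_const _) (hβd.fun_mul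
            (ContDiffOn.differentiableAt_of_isOpen (hv b) hG.isOpen hy)),
          partialDeriv_const, partialDeriv_mul hβd
            (ContDiffOn.differentiableAt_of_isOpen (hv b) hG.isOpen hy), h1 y hy]
        ring
      have e1 := partialDeriv_comm hG.isOpen hβ hy i l
      rw [e, e] at e1
      have e2 : β y * (covForm G (lowered G V) i l y - covForm G (lowered G V) l i y) = 0 := by
        have : ∑ p, christoffel G p i l y * lowered G V p y
            = ∑ p, christoffel G p l i y * lowered G V p y :=
          Finset.sum_congr rfl fun p _ => by rw [hG.christoffel_symm hy p i l]
        rw [covForm, covForm, this]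
        linear_combination e1 / 2
      have e3 := h3 y hy i l
      have e4 := h3 y hy l i
      rw [hG.symm hy l i] at e4
      have : α y * (β y * (lowered G V i y * s l y) - β y * (lowered G V l y * s i y)) = 0 := by
        linear_combination α y * q y * e2 - β y * (e3 - e4)
      rcases mul_eq_zero.1 this with h | h
      · exact absurd h ha
      · linarith
    intro X hX
    have hvX : ∑ l, lowered G V l y * X l = 0 := by
      rw [map_smul, smul_apply, hG.bilinForm_lowered hy, smul_eq_mul] at hX
      rcases mul_eq_zero.1 hX with h | h
      · have := hκq y hy
        rw [h] at this
        norm_num at this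
      · exact h
    -- contraction with `V ⊗ X`: where `β ≠ 0`, the differential of `v_p v^p` is a multiple of `v`
    have hS : β y * ∑ l, X l * s l y = 0 := by
      have e : ∑ i, ∑ l, V y i * X l * (β y * (lowered G V i y * s l y))
          = ∑ i, ∑ l, V y i * X l * (β y * (lowered G V l y * s i y)) := by simp only [hsym]
      have e1 : ∑ i, ∑ l, V y i * X l * (β y * (lowered G V i y * s l y))
          = q y * (β y * ∑ l, X l * s l y) := by
        rw [hqd, Finset.sum_mul]
        refine Finset.sum_congr rfl fun i _ => ?_
        rw [Finset.mul_sum, Finset.mul_sum]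
        exact Finset.sum_congr rfl fun l _ => by ring
      have e2 : ∑ i, ∑ l, V y i * X l * (β y * (lowered G V l y * s i y))
          = ∑ i, V y i * β y * s i y * ∑ l, lowered G V l y * X l := by
        refine Finset.sum_congr rfl fun i _ => ?_
        rw [Finset.mul_sum]
        exact Finset.sum_congr rfl fun l _ => by ring
      rw [e1, e2, hvX] at e
      simp only [mul_zero, Finset.sum_const_zero] at e
      exact (mul_eq_zero.1 e).resolve_left hq0
    have hφ : ContDiffOn ℝ ∞ (fun z => 2 * β z * κ z / α z) O :=
      ((contDiffOn_const.mul hβ).mul hκ).div hα hα0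
    have hφd := ContDiffOn.differentiableAt_of_isOpen hφ hG.isOpen hy
    have hαd := ContDiffOn.differentiableAt_of_isOpen hα hG.isOpen hy
    have hβd := ContDiffOn.differentiableAt_of_isOpen hβ hG.isOpen hy
    have hκd := ContDiffOn.differentiableAt_of_isOpen hκ hG.isOpen hy
    have hl : ∀ l, α y * q y * partialDeriv l (fun z => 2 * β z * κ z / α z) y
        = (4 * β y * κ y * q y - 2 * β y * κ y / α y * (4 * α y * q y + 4 * β y))
          * lowered G V l y + 2 * κ y * (β y * s l y) := by
      intro l
      have e : partialDeriv l (fun z => 2 * β z * κ z / α z * α z) y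
          = partialDeriv l (fun z => 2 * (β z * κ z)) y :=
        partialDeriv_congr hG.isOpen (fun z hz => by
          rw [div_mul_cancel₀ _ (hα0 z hz), mul_assoc]) hy l
      rw [partialDeriv_mul hφd hαd, partialDeriv_mul (differentiableAt_const _) (hβd.fun_mul hκd),
        partialDeriv_const, partialDeriv_mul hβd hκd, h1 y hy] at e
      have e3 : 2 * β y * κ y / α y * α y = 2 * β y * κ y := div_mul_cancel₀ _ ha
      linear_combination q y * e - 2 * β y * κ y / α y * h2 y hy l + 2 * β y * hdκ y hy l
        + 2 * s l y * e3
    rw [fderiv_apply_eq_sum]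
    have : α y * q y * ∑ l, X l * partialDeriv l (fun z => 2 * β z * κ z / α z) y = 0 := by
      have e : ∀ l, α y * q y * (X l * partialDeriv l (fun z => 2 * β z * κ z / α z) y)
          = (4 * β y * κ y * q y - 2 * β y * κ y / α y * (4 * α y * q y + 4 * β y))
            * (lowered G V l y * X l) + 2 * κ y * β y * (X l * s l y) := fun l => by
        linear_combination X l * hl l
      rw [Finset.mul_sum, Finset.sum_congr rfl fun l _ => e l, Finset.sum_add_distrib,
        ← Finset.mul_sum, ← Finset.mul_sum, hvX]
      linear_combination 2 * κ y * hS
    exact (mul_eq_zero.1 this).resolve_left (mul_ne_zero ha hq0)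

/-- If the coefficient `α` of the Schouten tensor `α v ⊗ v + β g` vanishes at a point, the metric is
flat near that point: the values of `β` and of `α v_p v^p` propagate along rays. -/
theorem schouten_eq_zero_of_eq_zero (hn : 3 ≤ n) {V : Coord n → Coord n} (hV : ContDiffOn ℝ ∞ V O)
    (hq : ∀ y ∈ O, ∑ i, lowered G V i y * V y i < 0) {α β : Coord n → ℝ}
    (hα : ContDiffOn ℝ ∞ α O) (hβ : ContDiffOn ℝ ∞ β O)
    (h1 : ∀ y ∈ O, ∀ l, partialDeriv l β y = 2 * β y * lowered G V l y)
    (h2 : ∀ y ∈ O, ∀ l, partialDeriv l α y * (∑ i, lowered G V i y * V y i)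
        + 2 * α y * (∑ k, V y k * covForm G (lowered G V) k l y)
          = 4 * α y * (∑ i, lowered G V i y * V y i) * lowered G V l y
            + 4 * β y * lowered G V l y)
    (h3 : ∀ y ∈ O, ∀ i l, α y * (∑ i, lowered G V i y * V y i) * covForm G (lowered G V) i l y
        = 2 * β y * (∑ i, lowered G V i y * V y i) * G y i l
          + lowered G V i y * (α y * (∑ k, V y k * covForm G (lowered G V) k l y)
            - 2 * β y * lowered G V l y)) {y₀ : Coord n} (hα0 : α y₀ = 0) {r : ℝ}
    (hr : 0 < r) (hrO : ball y₀ r ⊆ O) : ∀ y ∈ ball y₀ r, α y = 0 ∧ β y = 0 := by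
  have hn' : (3 : ℝ) ≤ n := by exact_mod_cast hn
  have hy₀ : y₀ ∈ O := hrO (mem_ball_self hr)
  have hv := hG.lowered_smooth hV
  have hqs : ContDiffOn ℝ ∞ (fun y => ∑ i, lowered G V i y * V y i) O :=
    ContDiffOn.sum fun i _ => (hv i).mul (contDiffOn_apply hV i)
  have hc : ∀ (c : ℝ) l, ContinuousOn (fun z => c * lowered G V l z) (ball y₀ r) := fun c l =>
    continuousOn_const.mul ((hv l).continuousOn.mono hrO)
  have hβ0 : β y₀ = 0 := by
    have e : ∀ i l, (∑ i, lowered G V i y₀ * V y₀ i) * β y₀ * G y₀ i l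
        = β y₀ * (lowered G V i y₀ * lowered G V l y₀) := fun i l => by
      have := h3 y₀ hy₀ i l
      rw [hα0] at this
      linear_combination -this / 2
    have e1 := contract_congr (gi := fun a b => (G y₀)⁻¹ a b) e
    rw [contract_mul _ (fun i j => G y₀ i j), contract_metric (g := fun a b => G y₀ a b)
      (gi := fun a b => (G y₀)⁻¹ a b) (hG.symm hy₀) (hG.sum_inv_mul hy₀), contract_mul,
      hG.contract_lowered hy₀] at e1
    have e2 : ∑ k, V y₀ k * lowered G V k y₀ = ∑ i, lowered G V i y₀ * V y₀ i :=
      Finset.sum_congr rfl fun i _ => mul_comm _ _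
    rw [e2] at e1
    have e3 : (((n : ℝ) - 1) * ∑ i, lowered G V i y₀ * V y₀ i) * β y₀ = 0 := by
      linear_combination e1
    exact (mul_eq_zero.1 e3).resolve_left
      (mul_ne_zero (by linarith) (hq y₀ hy₀).ne)
  have hβz : ∀ y ∈ ball y₀ r, β y = 0 := eq_zero_of_partialDeriv_eq_mul (hβ.mono hrO) (hc 2)
    (fun y hy l => by rw [h1 y (hrO hy)]; ring) hβ0
  have hαz : ∀ y ∈ ball y₀ r, α y * (∑ i, lowered G V i y * V y i) = 0 := by
    refine eq_zero_of_partialDeriv_eq_mul ((hα.mul hqs).mono hrO) (hc 4) (fun y hy l => ?_)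
      (by rw [hα0, zero_mul])
    have hyO := hrO hy
    rw [partialDeriv_mul (ContDiffOn.differentiableAt_of_isOpen hα hG.isOpen hyO)
      (ContDiffOn.differentiableAt_of_isOpen hqs hG.isOpen hyO), hG.partialDeriv_sq_eq hyO hV l]
    have := h2 y hyO l
    rw [hβz y hy] at this
    linear_combination this
  exact fun y hy => ⟨(mul_eq_zero.1 (hαz y hy)).resolve_right (hq y (hrO hy)).ne, hβz y hy⟩

/-- Near every point, a conformally flat pseudosymmetric metric with timelike covector has a unit
timelike torse-forming vector field. -/
theorem exists_torseForming (hn : 3 ≤ n) {V : Coord n → Coord n} (hV : ContDiffOn ℝ ∞ V O)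
    (hq : ∀ y ∈ O, ∑ i, lowered G V i y * V y i < 0)
    (hps : ∀ y ∈ O, ∀ h i j k l, covRiemann G h i j k l y =
      2 * lowered G V l y * riemann G h i j k y + lowered G V h y * riemann G l i j k y
        + lowered G V i y * riemann G h l j k y + lowered G V j y * riemann G h i l k y
        + lowered G V k y * riemann G h i j l y)
    (hW : ∀ y ∈ O, ∀ h i j k, weyl G h i j k y = 0)
    (hC : ∀ y ∈ O, n = 3 → ∀ i j k, cotton G i j k y = 0) {y₀ : Coord n} (hy₀ : y₀ ∈ O) :
    ∃ (O' : Set (Coord n)) (U : Coord n → Coord n) (φ : Coord n → ℝ),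
      IsOpen O' ∧ O' ⊆ O ∧ y₀ ∈ O' ∧ ContDiffOn ℝ ∞ U O' ∧ ContDiffOn ℝ ∞ φ O' ∧
      (∀ y ∈ O', ∑ i, lowered G U i y * U y i = -1) ∧
      (∀ y ∈ O', ∀ i l, covForm G (lowered G U) i l y
        = φ y * (G y i l + lowered G U i y * lowered G U l y)) ∧
      ∀ y ∈ O', ∀ X, bilinForm (G y) (U y) X = 0 → fderiv ℝ φ y X = 0 := by
  obtain ⟨α, β, hα, hβ, hP, h1, h2, h3⟩ :=
    hG.exists_schouten_eq hn hV (fun y hy => (hq y hy).ne) hps hW hC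
  obtain ⟨κ, hκ, hκq, hdκ⟩ := hG.exists_normalization hV hq
  have hunit : ∀ y ∈ O, ∑ i, lowered G (fun z => κ z • V z) i y * (κ y • V y) i = -1 := by
    intro y hy
    rw [← hκq y hy, Finset.mul_sum]
    refine Finset.sum_congr rfl fun i _ => ?_
    rw [lowered_smul, PiLp.smul_apply, smul_eq_mul]
    ring
  by_cases hα0 : α y₀ = 0
  · obtain ⟨r, hr, hrO⟩ := Metric.isOpen_iff.1 hG.isOpen y₀ hy₀
    have hz := hG.schouten_eq_zero_of_eq_zero hn hV hq hα hβ h1 h2 h3 hα0 hr hrO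
    have hGb := hG.mono isOpen_ball hrO
    have hflat : ∀ y ∈ ball y₀ r, ∀ h i j k, riemannUp G h i j k y = 0 := fun y hy =>
      hGb.riemannUp_eq_zero hy fun h i j k => by
        rw [riemann_eq_kulkarni hn (hW y (hrO hy) h i j k)]
        simp [kulkarni, hP y (hrO hy), hz y hy]
    obtain ⟨r', U, hr', hsub, hU, hU₀, hpar⟩ :=
      hGb.exists_parallel hflat (mem_ball_self hr) (κ y₀ • V y₀)
    have hGr := hGb.mono isOpen_ball hsub
    refine ⟨ball y₀ r', U, fun _ => 0, isOpen_ball, hsub.trans hrO, mem_ball_self hr', hU,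
      contDiffOn_const, fun y hy => ?_, fun y hy i l => by rw [hpar y hy, zero_mul],
      fun y _ X _ => by simp⟩
    -- a parallel vector field has constant square
    have hs : ContDiffOn ℝ ∞ (fun z => ∑ i, lowered G U i z * U z i) (ball y₀ r') :=
      ContDiffOn.sum fun i _ => (hGr.lowered_smooth hU i).mul (contDiffOn_apply hU i)
    have hz := eq_zero_of_partialDeriv_eq_mul
      (F := fun z => (∑ i, lowered G U i z * U z i) - -1) (hs.sub contDiffOn_const)
      (c := fun _ _ => 0) (fun _ => continuousOn_const) (fun z hz l => ?_) ?_ y hy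
    · exact sub_eq_zero.1 hz
    · rw [partialDeriv_sub (ContDiffOn.differentiableAt_of_isOpen hs isOpen_ball hz)
        (differentiableAt_const _), partialDeriv_const, hGr.partialDeriv_sq_eq hz hU l]
      simp [hpar z hz]
    · have := hunit y₀ hy₀
      simp only [lowered, ← hU₀] at this ⊢
      exact sub_eq_zero.2 this
  · have hO' : IsOpen (O ∩ α ⁻¹' {0}ᶜ) :=
      hα.continuousOn.isOpen_inter_preimage hG.isOpen isOpen_compl_singleton
    have hsub : O ∩ α ⁻¹' {0}ᶜ ⊆ O := inter_subset_left
    have hG' := hG.mono hO' hsub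
    have H := fun y (hy : y ∈ O ∩ α ⁻¹' {0}ᶜ) => hG'.torseForming_of_ne_zero (hV.mono hsub)
      (fun z hz => hq z hz.1) (hα.mono hsub) (hβ.mono hsub) (hκ.mono hsub) (fun z hz => hz.2)
      (fun z hz => h1 z hz.1) (fun z hz => h2 z hz.1) (fun z hz => h3 z hz.1)
      (fun z hz => hκq z hz.1) (fun z hz => hdκ z hz.1) hy
    exact ⟨_, fun z => κ z • V z, fun z => 2 * β z * κ z / α z, hO', hsub, ⟨hy₀, hα0⟩,
      (hκ.smul hV).mono hsub, (((contDiffOn_const.mul hβ).mul hκ).mono hsub).div (hα.mono hsub)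
        fun z hz => hz.2, fun y hy => hunit y hy.1, fun y hy => (H y hy).1, fun y hy => (H y hy).2⟩

/-- In coordinates, a conformally flat pseudosymmetric Lorentzian metric with timelike covector is
locally a warped product `-dt² + f² h`. -/
theorem exists_warped_chart_of_pseudosymmetric (hn : 3 ≤ n)
    (hL : ∀ y ∈ O, ∃ T, ∀ X, bilinForm (G y) T X = 0 → X ≠ 0 → 0 < bilinForm (G y) X X)
    {V : Coord n → Coord n} (hV : ContDiffOn ℝ ∞ V O)
    (hq : ∀ y ∈ O, ∑ i, lowered G V i y * V y i < 0)
    (hps : ∀ y ∈ O, ∀ h i j k l, covRiemann G h i j k l y =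
      2 * lowered G V l y * riemann G h i j k y + lowered G V h y * riemann G l i j k y
        + lowered G V i y * riemann G h l j k y + lowered G V j y * riemann G h i l k y
        + lowered G V k y * riemann G h i j l y)
    (hW : ∀ y ∈ O, ∀ h i j k, weyl G h i j k y = 0)
    (hC : ∀ y ∈ O, n = 3 → ∀ i j k, cotton G i j k y = 0) {y₀ : Coord n} (hy₀ : y₀ ∈ O) :
    ∃ (ε : ℝ) (f : ℝ → ℝ) (h : Coord (n - 1) → Coord (n - 1) →L[ℝ] Coord (n - 1) →L[ℝ] ℝ)
      (e : OpenPartialHomeomorph (ℝ × Coord (n - 1)) (Coord n)),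
      0 < ε ∧ e.source = Ioo (-ε) ε ×ˢ univ ∧ y₀ ∈ e.target ∧ e.target ⊆ O ∧
      ContDiffOn ℝ ∞ e e.source ∧ ContDiffOn ℝ ∞ e.symm e.target ∧
      ContDiffOn ℝ ∞ f (Ioo (-ε) ε) ∧ (∀ t ∈ Ioo (-ε) ε, 0 < f t) ∧
      ContDiff ℝ ∞ h ∧ (∀ q X Y, h q X Y = h q Y X) ∧ (∀ q X, X ≠ 0 → 0 < h q X X) ∧
      ∀ p ∈ e.source, ∀ a X c Y,
        bilinForm (G (e p)) (fderiv ℝ e p (a, X)) (fderiv ℝ e p (c, Y))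
          = -(a * c) + f p.1 ^ 2 * h p.2 X Y := by
  obtain ⟨O', U, φ, hO', hsub, hyO', hU, hφ, hunit, htorse, hφu⟩ :=
    hG.exists_torseForming hn hV hq hps hW hC hy₀
  have hpos : ∀ y ∈ O', ∀ X, bilinForm (G y) (U y) X = 0 → X ≠ 0 → 0 < bilinForm (G y) X X := by
    intro y hy X hX hX0
    obtain ⟨T, hT⟩ := hL y (hsub hy)
    refine pos_of_orthogonal_timelike (hG.bilinForm_symm (hsub hy)) hT (V := U y) ?_ hX hX0
    rw [hG.bilinForm_lowered (hsub hy), hunit y hy]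
    norm_num
  obtain ⟨ε, f, h, e, h1, h2, h3, h4, hrest⟩ :=
    (hG.mono hO' hsub).exists_warped_chart_of_torseForming
    hn hU hφ hunit hpos htorse hφu hyO'
  exact ⟨ε, f, h, e, h1, h2, h3, h4.trans hsub, hrest⟩

end IsSmoothMetric

end Spacetime

/-! ### Lorentzian manifolds in charts -/

namespace Spacetime

open Bundle

section Prod
variable {E F G : Type*} [NormedAddCommGroup E] [NormedSpace ℝ E] [NormedAddCommGroup F]
  [NormedSpace ℝ F] [NormedAddCommGroup G] [NormedSpace ℝ G]

theorem contMDiffOn_prod_iff_contDiffOn {f : E × F → G} {s : Set (E × F)} :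
    ContMDiffOn (𝓘(ℝ, E).prod 𝓘(ℝ, F)) 𝓘(ℝ, G) ∞ f s ↔ ContDiffOn ℝ ∞ f s := by
  rw [← contMDiffOn_iff_contDiffOn, modelWithCornersSelf_prod, ← chartedSpaceSelf_prod]

theorem contMDiffOn_iff_contDiffOn_prod {f : G → E × F} {s : Set G} :
    ContMDiffOn 𝓘(ℝ, G) (𝓘(ℝ, E).prod 𝓘(ℝ, F)) ∞ f s ↔ ContDiffOn ℝ ∞ f s := by
  rw [← contMDiffOn_iff_contDiffOn, modelWithCornersSelf_prod, ← chartedSpaceSelf_prod]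

theorem mfderiv_prod_eq_fderiv {f : E × F → G} {p : E × F} :
    mfderiv (𝓘(ℝ, E).prod 𝓘(ℝ, F)) 𝓘(ℝ, G) f p = fderiv ℝ f p := by
  rw [← mfderiv_eq_fderiv]
  rw [modelWithCornersSelf_prod, ← chartedSpaceSelf_prod]
end Prod

variable {n : ℕ} {M : Type*} [TopologicalSpace M] [ChartedSpace (Coord n) M]
  [IsManifold 𝓘(ℝ, Coord n) ∞ M]

/-- The differential of the inverse chart. -/
noncomputable def chartFrame (e : OpenPartialHomeomorph M (Coord n)) (y : Coord n) :
    Coord n →L[ℝ] TangentSpace 𝓘(ℝ, Coord n) (e.symm y) :=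
  mfderiv 𝓘(ℝ, Coord n) 𝓘(ℝ, Coord n) e.symm y

/-- The coordinate vector with constant components `X`, as a local section of the tangent bundle
along the inverse chart. -/
theorem contMDiffOn_chartFrame {e : OpenPartialHomeomorph M (Coord n)}
    (he : e ∈ atlas (Coord n) M) (X : Coord n) :
    ContMDiffOn 𝓘(ℝ, Coord n) (𝓘(ℝ, Coord n).prod 𝓘(ℝ, Coord n)) ∞
      (fun y => (TotalSpace.mk' (Coord n) (e.symm y)
        (chartFrame e y X) : TangentBundle 𝓘(ℝ, Coord n) M))
      e.target := by
  have h1 : ContMDiffOn 𝓘(ℝ, Coord n) 𝓘(ℝ, Coord n) ∞ e.symm e.target :=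
    contMDiffOn_symm_of_mem_maximalAtlas (IsManifold.subset_maximalAtlas he)
  have h2 := h1.contMDiffOn_tangentMapWithin (m := ∞) (by simp) e.open_target.uniqueMDiffOn
  have h3 : ContMDiffOn 𝓘(ℝ, Coord n) (𝓘(ℝ, Coord n).prod 𝓘(ℝ, Coord n)) ∞
      (fun y : Coord n => (TotalSpace.mk' (Coord n) y X : TangentBundle 𝓘(ℝ, Coord n) (Coord n)))
      e.target := contMDiffOn_vectorSpace_iff_contDiffOn.2 contDiffOn_const
  refine (h2.comp h3 fun y hy => hy).congr fun y hy => ?_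
  simp only [Function.comp, tangentMapWithin, chartFrame]
  rw [mfderivWithin_of_mem_nhds (e.open_target.mem_nhds hy)]
  rfl

theorem LorentzMetric.contDiffOn_inner (g : LorentzMetric n M)
    {e : OpenPartialHomeomorph M (Coord n)} (he : e ∈ atlas (Coord n) M) (X Y : Coord n) :
    ContDiffOn ℝ ∞ (fun y => g.inner (e.symm y)
      (chartFrame e y X)
      (chartFrame e y Y)) e.target := by
  rw [← contMDiffOn_iff_contDiffOn]
  intro y hy
  have h1 : ContMDiffOn 𝓘(ℝ, Coord n) 𝓘(ℝ, Coord n) ∞ e.symm e.target :=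
    contMDiffOn_symm_of_mem_maximalAtlas (IsManifold.subset_maximalAtlas he)
  have : ContMDiffWithinAt 𝓘(ℝ, Coord n) (𝓘(ℝ, Coord n).prod 𝓘(ℝ, ℝ)) ∞
      (fun y => TotalSpace.mk' ℝ (E := Bundle.Trivial M ℝ) (e.symm y) (g.inner (e.symm y)
      (chartFrame e y X)
      (chartFrame e y Y))) e.target y := by
    apply ContMDiffWithinAt.clm_bundle_apply₂ (F₁ := Coord n) (F₂ := Coord n)
    · exact ContMDiffAt.comp_contMDiffWithinAt y g.contMDiff.contMDiffAt (h1 y hy)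
    · exact contMDiffOn_chartFrame he X y hy
    · exact contMDiffOn_chartFrame he Y y hy
  simp only [contMDiffWithinAt_totalSpace] at this
  exact this.2

theorem CovectorField.contDiffOn_form (v : CovectorField n M)
    {e : OpenPartialHomeomorph M (Coord n)} (he : e ∈ atlas (Coord n) M) (X : Coord n) :
    ContDiffOn ℝ ∞ (fun y => v.form (e.symm y)
      (chartFrame e y X)) e.target := by
  rw [← contMDiffOn_iff_contDiffOn]
  intro y hy
  have h1 : ContMDiffOn 𝓘(ℝ, Coord n) 𝓘(ℝ, Coord n) ∞ e.symm e.target :=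
    contMDiffOn_symm_of_mem_maximalAtlas (IsManifold.subset_maximalAtlas he)
  have : ContMDiffWithinAt 𝓘(ℝ, Coord n) (𝓘(ℝ, Coord n).prod 𝓘(ℝ, ℝ)) ∞
      (fun y => TotalSpace.mk' ℝ (E := Bundle.Trivial M ℝ) (e.symm y) (v.form (e.symm y)
      (chartFrame e y X))) e.target y := by
    apply ContMDiffWithinAt.clm_bundle_apply (F₁ := Coord n)
    · exact ContMDiffAt.comp_contMDiffWithinAt y v.contMDiff.contMDiffAt (h1 y hy)
    · exact contMDiffOn_chartFrame he X y hy
  simp only [contMDiffWithinAt_totalSpace] at this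
  exact this.2

/-- The inverse of a chart, as a partial diffeomorphism. -/
noncomputable def chartParam {e : OpenPartialHomeomorph M (Coord n)} (he : e ∈ atlas (Coord n) M) :
    PartialDiffeomorph 𝓘(ℝ, Coord n) 𝓘(ℝ, Coord n) (Coord n) M ∞ where
  toPartialEquiv := e.toPartialEquiv.symm
  open_source := e.open_target
  open_target := e.open_source
  contMDiffOn_toFun := contMDiffOn_symm_of_mem_maximalAtlas (IsManifold.subset_maximalAtlas he)
  contMDiffOn_invFun := contMDiffOn_of_mem_maximalAtlas (IsManifold.subset_maximalAtlas he)

theorem bijective_chartFrame {e : OpenPartialHomeomorph M (Coord n)}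
    (he : e ∈ atlas (Coord n) M) {y : Coord n} (hy : y ∈ e.target) :
    Function.Bijective (chartFrame e y) := by
  have h : IsLocalDiffeomorphAt 𝓘(ℝ, Coord n) 𝓘(ℝ, Coord n) ∞ e.symm y :=
    ⟨chartParam he, hy, fun _ _ => rfl⟩
  exact (h.mfderivToContinuousLinearEquiv (by simp)).bijective

/-- The unit ball of a positive definite form on a finite-dimensional space is bounded. -/
theorem isVonNBounded_lt_one {E : Type*} [NormedAddCommGroup E] [NormedSpace ℝ E]
    [FiniteDimensional ℝ E] {b : E →L[ℝ] E →L[ℝ] ℝ} (hb : ∀ X, X ≠ 0 → 0 < b X X) :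
    Bornology.IsVonNBounded ℝ {X : E | b X X < 1} := by
  have : ProperSpace E := FiniteDimensional.proper ℝ E
  obtain ⟨c, hc, hcb⟩ := (isCompact_sphere (0 : E) 1).exists_forall_le' (f := fun X => b X X)
    (a := 0) (b.continuous.clm_apply continuous_id).continuousOn fun X hX =>
      hb X (ne_zero_of_mem_unit_sphere ⟨X, hX⟩)
  refine NormedSpace.isVonNBounded_of_isBounded ℝ
    (isBounded_iff_forall_norm_le.2 ⟨1 + c⁻¹, fun X hX => ?_⟩)
  rw [mem_ofPred_eq] at hX
  rcases eq_or_ne X 0 with rfl | hX0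
  · rw [norm_zero]
    positivity
  have hn : 0 < ‖X‖ := norm_pos_iff.2 hX0
  have h1 := hcb (‖X‖⁻¹ • X) (by simp [norm_smul, hn.ne'])
  simp only [map_smul, smul_apply, smul_eq_mul] at h1
  have h2 : c * ‖X‖ ^ 2 ≤ b X X := by
    have := mul_le_mul_of_nonneg_right h1 (sq_nonneg ‖X‖)
    refine this.trans_eq ?_
    field_simp
  have h3 : ‖X‖ ^ 2 ≤ c⁻¹ := by
    rw [← one_div, le_div_iff₀ hc]
    linarith
  have h4 : 0 < c⁻¹ := inv_pos.2 hc
  nlinarith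

/-- A smooth positive definite form as a Riemannian metric on a vector space. -/
noncomputable def riemannianMetricOfForm {E : Type*} [NormedAddCommGroup E] [NormedSpace ℝ E]
    [FiniteDimensional ℝ E] (h : E → E →L[ℝ] E →L[ℝ] ℝ) (hs : ContDiff ℝ ∞ h)
    (hsymm : ∀ q X Y, h q X Y = h q Y X) (hpos : ∀ q X, X ≠ 0 → 0 < h q X X) :
    ContMDiffRiemannianMetric 𝓘(ℝ, E) ∞ E (fun q : E => TangentSpace 𝓘(ℝ, E) q) where
  inner := h
  symm := hsymm
  pos := hpos
  isVonNBounded q := isVonNBounded_lt_one (E := E) (b := h q) (hpos q)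
  contMDiff := by
    intro x
    refine (contMDiffAt_section (F := E →L[ℝ] E →L[ℝ] ℝ)
      (E := fun q : E => TangentSpace 𝓘(ℝ, E) q →L[ℝ] TangentSpace 𝓘(ℝ, E) q →L[ℝ] ℝ)
      (s := fun q => h q) x).2 ?_
    refine (hs.contMDiff.contMDiffAt (x := x)).congr_of_eventuallyEq
      (Eventually.of_forall fun q => ?_)
    ext v w
    refine (inCoordinates_apply_eq₂ (F₁ := E) (F₂ := E) (F₃ := ℝ)
      (E₁ := fun q : E => TangentSpace 𝓘(ℝ, E) q) (E₂ := fun q : E => TangentSpace 𝓘(ℝ, E) q)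
      (E₃ := Bundle.Trivial E ℝ) (x₀ := x) (x := q) (ϕ := h q) (v := v) (w := w)
      (mem_univ q) (mem_univ q) (mem_univ q)).trans ?_
    have hsymmL : ∀ u : E, (trivializationAt E (fun q : E => TangentSpace 𝓘(ℝ, E) q) x).symm q u
        = u := fun u => (Trivialization.symmL_apply _ (mem_univ q) _).symm.trans
      (DFunLike.congr_fun (TangentBundle.symmL_model_space (𝕜 := ℝ) x q) u)
    rw [hsymmL, hsymmL]
    simp only [Trivial.fiberBundle_trivializationAt', Trivial.linearMapAt_trivialization,
      LinearMap.id_coe, id_eq]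
    rfl

/-- The components of the metric in a chart, as a bilinear form. -/
theorem LorentzMetric.bilinForm_comp (g : LorentzMetric n M) (e : OpenPartialHomeomorph M (Coord n))
    (y X Y : Coord n) : bilinForm (g.comp e y) X Y
      = g.inner (e.symm y) (chartFrame e y X) (chartFrame e y Y) := by
  let b : Coord n →L[ℝ] Coord n →L[ℝ] ℝ := g.inner (e.symm y)
  let L : Coord n →L[ℝ] Coord n := chartFrame e y
  have h : bilinForm (g.comp e y) = b.bilinearComp L L := by
    refine clm_ext_basisVec fun i => clm_ext_basisVec fun j => ?_
    rw [bilinForm_basisVec]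
    rfl
  rw [h]
  rfl

theorem CovectorField.sum_comp (v : CovectorField n M) (e : OpenPartialHomeomorph M (Coord n))
    (y X : Coord n) : ∑ i, v.comp e i y * X i = v.form (e.symm y) (chartFrame e y X) := by
  change _ = (v.form (e.symm y)).comp (chartFrame e y) X
  conv_rhs => rw [eq_sum_basisVec X]
  rw [map_sum]
  exact Finset.sum_congr rfl fun i _ => by rw [map_smul, smul_eq_mul, mul_comm]; rfl

/-- A symmetric form that is positive definite on the orthogonal complement of some vector is
nondegenerate. -/
theorem eq_zero_of_lorentzian {E : Type*} [NormedAddCommGroup E] [NormedSpace ℝ E]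
    {b : E →L[ℝ] E →L[ℝ] ℝ} (hb : ∀ X Y, b X Y = b Y X) {T : E}
    (hpos : ∀ X, b T X = 0 → X ≠ 0 → 0 < b X X) {X : E} (hX : ∀ Y, b X Y = 0) : X = 0 := by
  by_contra h
  exact (hpos X (by rw [hb, hX]) h).ne' (hX X)

theorem LorentzMetric.exists_orthogonal_pos_comp (g : LorentzMetric n M)
    {e : OpenPartialHomeomorph M (Coord n)} (he : e ∈ atlas (Coord n) M) {y : Coord n}
    (hy : y ∈ e.target) : ∃ T : Coord n,
      ∀ X, bilinForm (g.comp e y) T X = 0 → X ≠ 0 → 0 < bilinForm (g.comp e y) X X := by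
  obtain ⟨U, -, hpos⟩ := g.lorentzian (e.symm y)
  obtain ⟨hinj, hsurj⟩ := bijective_chartFrame he hy
  obtain ⟨T, hT⟩ := hsurj U
  refine ⟨T, fun X hX hX0 => ?_⟩
  rw [g.bilinForm_comp] at hX ⊢
  rw [hT] at hX
  exact hpos _ hX fun h => hX0 (hinj (h.trans (map_zero _).symm))

theorem LorentzMetric.isSmoothMetric_comp (g : LorentzMetric n M)
    {e : OpenPartialHomeomorph M (Coord n)} (he : e ∈ atlas (Coord n) M) :
    IsSmoothMetric (g.comp e) e.target where
  isOpen := e.open_target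
  smooth i j := g.contDiffOn_inner he (basisVec i) (basisVec j)
  symm _ i j := g.symm _ _ _
  det_ne_zero {y} hy := by
    intro hdet
    obtain ⟨w, hw0, hw⟩ := Matrix.exists_mulVec_eq_zero_iff.2 hdet
    obtain ⟨T, hpos⟩ := g.exists_orthogonal_pos_comp he hy
    have hsymm : ∀ X Y, bilinForm (g.comp e y) X Y = bilinForm (g.comp e y) Y X := fun X Y => by
      rw [g.bilinForm_comp, g.bilinForm_comp, g.symm]
    have hX : ∀ Y, bilinForm (g.comp e y) (WithLp.toLp 2 w) Y = 0 := by
      intro Y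
      rw [hsymm, bilinForm_apply]
      refine Finset.sum_eq_zero fun i _ => ?_
      have h1 : ∑ j, g.comp e y i j * w j = 0 := congrFun hw i
      have h2 : ∀ j, g.comp e y i j * (Y i * w j) = Y i * (g.comp e y i j * w j) := fun j => by
        ring
      simp only [h2, ← Finset.mul_sum, h1, mul_zero]
    have := eq_zero_of_lorentzian hsymm hpos hX
    exact hw0 (congrArg WithLp.ofLp this)

/-- The vector field metrically equivalent to a timelike covector field, in a chart. -/
theorem exists_sharp {g : LorentzMetric n M} {v : CovectorField n M} (hv : IsTimelike g v)
    {e : OpenPartialHomeomorph M (Coord n)} (he : e ∈ atlas (Coord n) M) :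
    ∃ V : Coord n → Coord n, ContDiffOn ℝ ∞ V e.target ∧
      (∀ y ∈ e.target, ∀ i, lowered (g.comp e) V i y = v.comp e i y) ∧
      ∀ y ∈ e.target, ∑ i, lowered (g.comp e) V i y * V y i < 0 := by
  have hG := g.isSmoothMetric_comp he
  have hV : ∀ y ∈ e.target, ∀ i,
      ∑ j, g.comp e y i j * ∑ k, (g.comp e y)⁻¹ j k * v.comp e k y = v.comp e i y := by
    intro y hy i
    simp only [Finset.mul_sum, ← mul_assoc]
    rw [Finset.sum_comm]
    simp only [← Finset.sum_mul, hG.sum_mul_inv hy]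
    simp
  refine ⟨fun y => WithLp.toLp 2 fun j => ∑ k, (g.comp e y)⁻¹ j k * v.comp e k y, ?_, hV,
    fun y hy => ?_⟩
  · have hvs : ∀ k, ContDiffOn ℝ ∞ (v.comp e k) e.target := fun k =>
      v.contDiffOn_form he (basisVec k)
    refine contDiffOn_euclidean.2 fun j => ?_
    change ContDiffOn ℝ ∞ (fun y => ∑ k, (g.comp e y)⁻¹ j k * v.comp e k y) e.target
    exact ContDiffOn.sum fun k _ => (hG.inv_smooth j k).mul (hvs k)
  · set V : Coord n → Coord n :=
      fun y => WithLp.toLp 2 fun j => ∑ k, (g.comp e y)⁻¹ j k * v.comp e k y with hVdef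
    obtain ⟨W, hW, hWW⟩ := hv (e.symm y)
    obtain ⟨Z, hZ⟩ := (bijective_chartFrame he hy).2 W
    have hVZ : ∀ X, bilinForm (g.comp e y) (V y) X = bilinForm (g.comp e y) Z X := fun X => by
      rw [hG.bilinForm_lowered hy V, g.bilinForm_comp, hZ, ← hW, ← v.sum_comp]
      exact Finset.sum_congr rfl fun i _ => by rw [← hV y hy i]; rfl
    rw [← hG.bilinForm_lowered hy V, hVZ, hG.bilinForm_symm hy, hVZ, g.bilinForm_comp, hZ]
    exact hWW

end Spacetime

end

theorem theorem1p2 (n : ℕ) (hn : 3 ≤ n) (M : Type*) [TopologicalSpace M]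
    [ChartedSpace (Spacetime.Coord n) M] [IsManifold 𝓘(ℝ, Spacetime.Coord n) ∞ M]
    (g : Spacetime.LorentzMetric n M) (v : Spacetime.CovectorField n M)
    (hv : Spacetime.IsTimelike g v) (hps : Spacetime.IsPseudosymmetric g v)
    (hcf : Spacetime.IsConformallyFlat g) :
    Spacetime.IsLocallyGRW g := by
  intro x
  let e := chartAt (Spacetime.Coord n) x
  have he : e ∈ atlas (Spacetime.Coord n) M := chart_mem_atlas _ x
  have hx : e x ∈ e.target := mem_chart_target _ x
  have hG := g.isSmoothMetric_comp he
  obtain ⟨V, hV, hVv, hq⟩ := Spacetime.exists_sharp hv he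
  obtain ⟨ε, f, h, c, hε, hsrc, hxc, hsub, hc, hcs, hf, hfpos, hh, hhs, hhp, hiso⟩ :=
    hG.exists_warped_chart_of_pseudosymmetric hn (fun y hy => g.exists_orthogonal_pos_comp he hy) hV hq
      (fun y hy h i j k l => by
        rw [hps e he y hy]
        simp only [hVv y hy]) (fun y hy => (hcf e he y hy).1) (fun y hy => (hcf e he y hy).2) hx
  let Ψ : PartialDiffeomorph (𝓘(ℝ, ℝ).prod 𝓘(ℝ, Spacetime.Coord (n - 1))) 𝓘(ℝ, Spacetime.Coord n)
      (ℝ × Spacetime.Coord (n - 1)) (Spacetime.Coord n) ∞ :=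
    { toPartialEquiv := c.toPartialEquiv
      open_source := c.open_source
      open_target := c.open_target
      contMDiffOn_toFun := Spacetime.contMDiffOn_prod_iff_contDiffOn.2 hc
      contMDiffOn_invFun := Spacetime.contMDiffOn_iff_contDiffOn_prod.2 hcs }
  let Φ := Ψ.trans (Spacetime.chartParam he)
  have hΦsrc : Φ.source = Set.Ioo (-ε) ε ×ˢ Set.univ := by
    change c.source ∩ c ⁻¹' e.target = _
    have hm : c.source ⊆ c ⁻¹' e.target := fun p hp => hsub (c.map_source hp)
    rw [Set.inter_eq_left.2 hm, hsrc]
  refine ⟨Set.Ioo (-ε) ε, f, Spacetime.Coord (n - 1), inferInstance, chartedSpaceSelf _,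
    inferInstance, inferInstance, inferInstance, inferInstance,
    Spacetime.riemannianMetricOfForm h hh hhs hhp, Φ,
    ?_, ?_⟩
  · change x ∈ e.source ∩ e ⁻¹' c.target
    exact ⟨mem_chart_source _ x, hxc⟩
  · refine ⟨isOpen_Ioo, Set.nonempty_Ioo.2 (by linarith), Set.ordConnected_Ioo, hf, hfpos, hΦsrc,
      ?_⟩
    intro t ht q a b X Y
    have hp : (t, q) ∈ c.source := by
      rw [hsrc]
      exact ⟨ht, Set.mem_univ q⟩
    have hcp : c (t, q) ∈ e.target := hsub (c.map_source hp)
    have hd : ∀ w : ℝ × Spacetime.Coord (n - 1),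
        mfderiv (𝓘(ℝ, ℝ).prod 𝓘(ℝ, Spacetime.Coord (n - 1))) 𝓘(ℝ, Spacetime.Coord n) Φ (t, q) w
          = Spacetime.chartFrame e (c (t, q)) (fderiv ℝ c (t, q) w) := by
      intro w
      have h1 := mfderiv_comp (t, q) ((Spacetime.chartParam he).mdifferentiableAt (by simp) hcp)
        (Ψ.mdifferentiableAt (by simp) hp)
      have h2 : mfderiv (𝓘(ℝ, ℝ).prod 𝓘(ℝ, Spacetime.Coord (n - 1))) 𝓘(ℝ, Spacetime.Coord n)
          c (t, q) = fderiv ℝ c (t, q) := Spacetime.mfderiv_prod_eq_fderiv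
      rw [h2] at h1
      exact DFunLike.congr_fun h1 w
    have h1 := hiso (t, q) hp a X b Y
    rw [g.bilinForm_comp, ← hd, ← hd] at h1
    exact h1
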